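/- **Setting.** Let $(\mathcal M,g)$ be a smooth 4-manifold with a smooth metric of signature $(-1,1,1,1)$ and Levi-Civita connection $\nabla$. A smooth 2-form $F$ on an open set $U$ is a *null force-free solution* if $dF=0$, $i_{j^\sharp}F=0$ for the current $j=*\,d*F$, and $F_{\mu\nu}F^{\mu\nu}=0$ on $U$; its kernel at $q$ is $\ker F_q=\{v\in T_q\mathcal M: F(v,\cdot)=0\}$. A chart $(x^1,\dots,x^4)$ with domain $U$ is *adapted* to a rank-two distribution $D$ if $D=\{dx^3=dx^4=0\}$ on $U$ and the slices $x^3=\mathrm{const},\ x^4=\mathrm{const}$ of $U$ are connected. A foliation $\mathcal F$ of $\mathcal M$ by 2-dimensional leaves is *null* if $g$ restricted to the tangent planes of the leaves is degenerate. A *null foliation adapted frame* for $\mathcal F$ on an open set $W$ consists of smooth vector fields $(s,l,\alpha^\sharp,n)$ on $W$ such that $s,l$ span the tangent planes of $\mathcal F$, $g(s,s)=g(\alpha^\sharp,\alpha^\sharp)=1$, $g(l,n)=-1$, and all other inner products among $s,l,\alpha^\sharp,n$ vanish. A null foliation $\mathcal F$ is a *null field sheet foliation* if about every point there is an adapted frame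 $(s,l,\alpha^\sharp,n)$ with $\nabla_l l=0$ and $\theta=g(\nabla_s l,s)$, where $\theta=\tfrac12\,[\,g(\nabla_s l,s)+g(\nabla_{\alpha^\sharp}l,\alpha^\sharp)\,]$ (equipartition of null mean curvature). **Theorem.** Let $\mathcal F$ be a null field sheet foliation of $\mathcal M$ and let $(s,l,\alpha^\sharp,n)$ be a null foliation adapted frame for $\mathcal F$ on an open set $W\subseteq\mathcal M$. Suppose that $\alpha^\sharp$ and $l$ span an involutive distribution on $W$, i.e. $[\alpha^\sharp,l]\in\mathrm{span}\{\alpha^\sharp,l\}$. Then: 1. About every $p\in W$ there is a chart centered at $p$, with domain in $W$, which is adapted to $\mathrm{span}\{\alpha^\sharp,l\}$. 2. Let $(U;x^1,\dots,x^4)$ be any chart with $U\subseteq W$ adapted to $\mathrm{span}\{\alpha^\sharp,l\}$. For every smooth function $u$ on the (open) set of values of $(x^3,x^4)$, the 2-form $$\tilde F=u(x^3,x^4)\,dx^3\wedge dx^4=(u\,\tilde\kappa)\,s^\flat\wedge l^\flat,\qquad \tilde\kappa=(s^\flat_3\,l^\flat_4-s^\flat_4\,l^\flat_3)^{-1},$$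 is a null force-free solution on $U$, and for $q\in U$ its kernel at $q$ is exactly $\mathrm{span}\{\alpha^\sharp,l\}_q$ if and only if $u\neq 0$ at $q$. 3. Conversely, in any such chart, every null force-free solution on $U$ whose kernel is exactly $\mathrm{span}\{\alpha^\sharp,l\}$ at every point of $U$ is of the form $u(x^3,x^4)\,dx^3\wedge dx^4$ with $u$ smooth and nowhere zero. -/

import Mathlib

open Set VectorField
open scoped Manifold ContDiff Matrix Nat

noncomputable section

namespace NullFF

/-- The coordinate space of four-dimensional charts. Its coordinates `x¹, x², x³, x⁴` carry the
indices `0, 1, 2, 3`. -/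
abbrev E4 : Type := EuclideanSpace ℝ (Fin 4)

/-- The `i`-th standard basis vector of the coordinate space. -/
abbrev stdVec (i : Fin 4) : E4 := EuclideanSpace.single i (1 : ℝ)

/-! ### Exterior algebra in coordinates -/

section Algebra

/-- The wedge product `a₁ ∧ ⋯ ∧ aₖ` of covectors (see `wedge_apply`). -/
def wedge {V : Type*} [AddCommGroup V] [Module ℝ V] [TopologicalSpace V] {k : ℕ}
    (a : Fin k → V →L[ℝ] ℝ) : V [⋀^Fin k]→L[ℝ] ℝ :=
  ContinuousMultilinearMap.alternatization
    ((ContinuousMultilinearMap.mkPiAlgebra ℝ (Fin k) ℝ).compContinuousLinearMap a)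

theorem wedge_apply {V : Type*} [AddCommGroup V] [Module ℝ V] [TopologicalSpace V] {k : ℕ}
    (a : Fin k → V →L[ℝ] ℝ) (v : Fin k → V) :
    wedge a v = Matrix.det (Matrix.of fun i j => a j (v i)) := by
  simp [wedge, ContinuousMultilinearMap.alternatization_apply_apply, Matrix.det_apply]

theorem wedge_two_apply {V : Type*} [AddCommGroup V] [Module ℝ V] [TopologicalSpace V]
    (a b : V →L[ℝ] ℝ) (x y : V) :
    wedge ![a, b] ![x, y] = a x * b y - b x * a y := by
  simp [wedge_apply, Matrix.det_fin_two]

/-- The Levi-Civita symbol: the sign of `f` if `f` is a permutation, and `0` otherwise. -/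
def leviCivitaSymbol (f : Fin 4 → Fin 4) : ℝ :=
  Matrix.det (Matrix.of fun i j : Fin 4 => if f i = j then (1 : ℝ) else 0)

/-- The components `η^{i₁ … iₖ}` of a `k`-form on the coordinate space, with the indices raised
by the metric whose matrix of components is `G`. -/
def raise {k : ℕ} (G : Matrix (Fin 4) (Fin 4) ℝ) (η : E4 [⋀^Fin k]→L[ℝ] ℝ)
    (I : Fin k → Fin 4) : ℝ :=
  ∑ K : Fin k → Fin 4, (∏ i, G⁻¹ (I i) (K i)) * η (fun i => stdVec (K i))

/-- The Hodge star of a `k`-form on the coordinate space, for the metric with matrix `G` and the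
orientation `dx¹ ∧ dx² ∧ dx³ ∧ dx⁴`:
`*η = √|det G| / (k! m!) ∑ η^{i₁…iₖ} ε_{i₁…iₖ j₁…jₘ} dx^{j₁} ∧ ⋯ ∧ dx^{jₘ}`, `k + m = 4`. -/
def hodgeStar {k m : ℕ} (h : k + m = 4) (G : Matrix (Fin 4) (Fin 4) ℝ)
    (η : E4 [⋀^Fin k]→L[ℝ] ℝ) : E4 [⋀^Fin m]→L[ℝ] ℝ :=
  (√|G.det| / ((k ! : ℝ) * (m ! : ℝ))) •
    ∑ I : Fin k → Fin 4, ∑ J : Fin m → Fin 4,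
      (raise G η I * leviCivitaSymbol (Fin.append I J ∘ Fin.cast h.symm)) •
        wedge (fun j => (EuclideanSpace.proj (J j) : E4 →L[ℝ] ℝ))

/-- The vector `η♯` of a `1`-form `η`. -/
def sharp (G : Matrix (Fin 4) (Fin 4) ℝ) (η : E4 [⋀^Fin 1]→L[ℝ] ℝ) : E4 :=
  WithLp.toLp 2 fun i => raise G η ![i]

/-- The invariant `F² = F_{μν} F^{μν}` of a `2`-form. -/
def formSq (G : Matrix (Fin 4) (Fin 4) ℝ) (F : E4 [⋀^Fin 2]→L[ℝ] ℝ) : ℝ :=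
  ∑ I : Fin 2 → Fin 4, F (fun i => stdVec (I i)) * raise G F I

end Algebra

/-! ### Spacetimes -/

section Spacetime

variable {M : Type*} [TopologicalSpace M] [ChartedSpace E4 M]

/-- The tangent space of the four-dimensional manifold `M` at `p`. -/
abbrev TS (p : M) : Type := TangentSpace 𝓘(ℝ, E4) p

/-- `X` is a smooth vector field on `U`. -/
def SmoothField [IsManifold 𝓘(ℝ, E4) ∞ M] (U : Set M) (X : ∀ p : M, TS p) : Prop :=
  ContMDiffOn 𝓘(ℝ, E4) (𝓘(ℝ, E4).prod 𝓘(ℝ, E4)) ∞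
    (fun p => (⟨p, X p⟩ : TangentBundle 𝓘(ℝ, E4) M)) U

variable (M) in
/-- A smooth metric of signature `(-1, 1, 1, 1)`. -/
structure LorentzMetric [IsManifold 𝓘(ℝ, E4) ∞ M] where
  val : ∀ p : M, TS p →L[ℝ] TS p →L[ℝ] ℝ
  symm : ∀ (p : M) (v w : TS p), val p v w = val p w v
  signature : ∀ p : M, ∃ b : Module.Basis (Fin 4) ℝ (TS p), ∀ i j,
    val p (b i) (b j) = if i = j then (if i = 0 then -1 else 1) else 0
  contMDiff : ContMDiff 𝓘(ℝ, E4) (𝓘(ℝ, E4).prod 𝓘(ℝ, E4 →L[ℝ] E4 →L[ℝ] ℝ)) ∞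
    (fun p => Bundle.TotalSpace.mk' (E4 →L[ℝ] E4 →L[ℝ] ℝ)
      (E := fun p : M => TS p →L[ℝ] TS p →L[ℝ] ℝ) p (val p))

/-- Differential forms of degree `k` on `M` (without regularity). -/
abbrev DiffForm (M : Type*) [TopologicalSpace M] [ChartedSpace E4 M] (k : ℕ) : Type _ :=
  ∀ p : M, TS p [⋀^Fin k]→L[ℝ] ℝ

/-- The differential at `q` of the `i`-th coordinate function of the chart `e`. -/
def dCoord (e : OpenPartialHomeomorph M E4) (i : Fin 4) (q : M) : TS q →L[ℝ] ℝ :=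
  (EuclideanSpace.proj i : E4 →L[ℝ] ℝ) ∘L
    ((NormedSpace.fromTangentSpace (𝕜 := ℝ) (e q)) : TangentSpace 𝓘(ℝ, E4) (e q) →L[ℝ] E4) ∘L
      mfderiv 𝓘(ℝ, E4) 𝓘(ℝ, E4) e q

/-- The differential of the inverse of the chart `e` at the point `y` of its target. -/
def chartInvDeriv (e : OpenPartialHomeomorph M E4) (y : E4) : E4 →L[ℝ] TS (e.symm y) :=
  mfderiv 𝓘(ℝ, E4) 𝓘(ℝ, E4) e.symm y ∘L
    ((NormedSpace.fromTangentSpace (𝕜 := ℝ) y).symm : E4 →L[ℝ] TangentSpace 𝓘(ℝ, E4) y)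

/-- A differential form in the coordinates of the chart `e`. -/
def localForm {k : ℕ} (e : OpenPartialHomeomorph M E4) (F : DiffForm M k) (y : E4) :
    E4 [⋀^Fin k]→L[ℝ] ℝ :=
  (F (e.symm y)).compContinuousLinearMap (chartInvDeriv e y)

/-- `F` is a smooth form on `U`: its components in every chart are smooth. -/
def SmoothForm [IsManifold 𝓘(ℝ, E4) ∞ M] {k : ℕ} (U : Set M) (F : DiffForm M k) : Prop :=
  ∀ e ∈ IsManifold.maximalAtlas 𝓘(ℝ, E4) ∞ M,
    ContDiffOn ℝ ∞ (localForm e F) (e.target ∩ e.symm ⁻¹' U)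

/-- The kernel `{v | i_v F = 0}` of a `2`-form at `p`. -/
def kernelAt (F : DiffForm M 2) (p : M) : Set (TS p) := {v | ∀ w : TS p, F p ![v, w] = 0}

/-- The derivative `X f` of a function along a vector field. -/
def dirDeriv (X : ∀ p : M, TS p) (f : M → ℝ) (p : M) : ℝ :=
  NormedSpace.fromTangentSpace (f p) (mfderiv 𝓘(ℝ, E4) 𝓘(ℝ, ℝ) f p (X p))

/-- `e` is a chart adapted to the rank-two plane field `D`: its slices `x³ = const, x⁴ = const` are
connected and are integral manifolds of `D`. -/
def IsAdaptedChart [IsManifold 𝓘(ℝ, E4) ∞ M] (D : ∀ p : M, Submodule ℝ (TS p))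
    (e : OpenPartialHomeomorph M E4) : Prop :=
  e ∈ IsManifold.maximalAtlas 𝓘(ℝ, E4) ∞ M ∧
  (∀ q ∈ e.source, ∀ v : TS q, v ∈ D q ↔ dCoord e 2 q v = 0 ∧ dCoord e 3 q v = 0) ∧
  ∀ c d : ℝ, IsPreconnected {y : E4 | y ∈ e.target ∧ y 2 = c ∧ y 3 = d}

variable (M) in
/-- A smooth foliation of `M` by two-dimensional leaves, recorded by the tangent planes of the
leaves: about every point there is a chart whose slices `x³ = const, x⁴ = const` are tangent to
these planes. The leaves are the maximal connected integral manifolds of `tangent`. -/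
structure Foliation [IsManifold 𝓘(ℝ, E4) ∞ M] where
  tangent : ∀ p : M, Submodule ℝ (TS p)
  exists_chart : ∀ p : M, ∃ e : OpenPartialHomeomorph M E4, IsAdaptedChart tangent e ∧ p ∈ e.source

/-- The plane field spanned by two vector fields. -/
def spanField (X Y : ∀ p : M, TS p) (p : M) : Submodule ℝ (TS p) := Submodule.span ℝ {X p, Y p}

section Metric

variable [IsManifold 𝓘(ℝ, E4) ∞ M] (g : LorentzMetric M)

/-- The matrix of components `g_{ij}` of the metric in the chart `e`. -/
def gram (e : OpenPartialHomeomorph M E4) (y : E4) : Matrix (Fin 4) (Fin 4) ℝ :=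
  Matrix.of fun i j =>
    g.val (e.symm y) (chartInvDeriv e y (stdVec i)) (chartInvDeriv e y (stdVec j))

/-- The function `g(X, Y)`. -/
def pair (X Y : ∀ p : M, TS p) (p : M) : ℝ := g.val p (X p) (Y p)

/-- `g(∇_X Y, Z)` for the Levi-Civita connection `∇` of `g`, by the Koszul formula. -/
def gNabla (X Y Z : ∀ p : M, TS p) (p : M) : ℝ :=
  (dirDeriv X (pair g Y Z) p + dirDeriv Y (pair g Z X) p - dirDeriv Z (pair g X Y) p
    + pair g (mlieBracket 𝓘(ℝ, E4) X Y) Z p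
    - pair g (mlieBracket 𝓘(ℝ, E4) Y Z) X p
    + pair g (mlieBracket 𝓘(ℝ, E4) Z X) Y p) / 2

/-- `l` is a geodesic vector field on `U`: `∇_l l = 0`, that is, `g(∇_l l, Z) = 0` for every local
smooth vector field `Z`. -/
def IsGeodesicField (U : Set M) (l : ∀ p : M, TS p) : Prop :=
  ∀ V ⊆ U, IsOpen V → ∀ Z : ∀ p : M, TS p, SmoothField V Z → ∀ p ∈ V, gNabla g l l Z p = 0

/-- `(s, l, a, n)` is a null foliation adapted frame on `U` for the foliation with tangent
planes `D`; here `a` is the vector field `α♯`. The relation `α = 0 = l♭` on `D` and the linear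
independence of the four fields follow from the listed inner products. -/
structure IsAdaptedFrame (D : ∀ p : M, Submodule ℝ (TS p)) (U : Set M)
    (s l a n : ∀ p : M, TS p) : Prop where
  smooth_s : SmoothField U s
  smooth_l : SmoothField U l
  smooth_a : SmoothField U a
  smooth_n : SmoothField U n
  tangent_eq : ∀ p ∈ U, D p = spanField s l p
  ss : ∀ p ∈ U, pair g s s p = 1
  aa : ∀ p ∈ U, pair g a a p = 1
  ll : ∀ p ∈ U, pair g l l p = 0
  nn : ∀ p ∈ U, pair g n n p = 0
  ln : ∀ p ∈ U, pair g l n p = -1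
  sl : ∀ p ∈ U, pair g s l p = 0
  sa : ∀ p ∈ U, pair g s a p = 0
  sn : ∀ p ∈ U, pair g s n p = 0
  la : ∀ p ∈ U, pair g l a p = 0
  an : ∀ p ∈ U, pair g a n p = 0

/-- The null mean curvature `θ = (g(∇_s l, s) + g(∇_a l, a)) / 2`. -/
def nullMeanCurvature (s l a : ∀ p : M, TS p) (p : M) : ℝ :=
  (gNabla g s l s p + gNabla g a l a p) / 2

/-- A null foliation: the metric is degenerate on every tangent plane of the leaves. -/
def IsNullFoliation (𝓕 : Foliation M) : Prop :=
  ∀ p : M, ∃ v ∈ 𝓕.tangent p, v ≠ 0 ∧ ∀ w ∈ 𝓕.tangent p, g.val p v w = 0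

/-- A null field sheet foliation: a null foliation such that about every point there is a null
geodesic vector field `l` tangent to the leaves, part of an adapted frame, with respect to which
the foliation admits an equipartition of null mean curvature, `θ = g(∇_s l, s)`. -/
def IsNullFieldSheetFoliation (𝓕 : Foliation M) : Prop :=
  IsNullFoliation g 𝓕 ∧
  ∀ p : M, ∃ V : Set M, IsOpen V ∧ p ∈ V ∧ ∃ s l a n : ∀ q : M, TS q,
    IsAdaptedFrame g 𝓕.tangent V s l a n ∧ IsGeodesicField g V l ∧
    ∀ q ∈ V, nullMeanCurvature g s l a q = gNabla g s l s q

/-- The current `j = *d*F` in the coordinates of the chart `e`. -/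
def localCurrent (e : OpenPartialHomeomorph M E4) (F : DiffForm M 2) (y : E4) :
    E4 [⋀^Fin 1]→L[ℝ] ℝ :=
  hodgeStar (k := 3) (m := 1) rfl (gram g e y)
    (extDeriv (fun z => hodgeStar (k := 2) (m := 2) rfl (gram g e z) (localForm e F z)) y)

/-- `F` is a null force-free electromagnetic field on the open set `U`: it is smooth there, and in
every chart `dF = 0`, `i_{j♯} F = 0` for the current `j = *d*F`, and `F² = 0`. (`j` does not depend
on the orientation that enters the two Hodge stars.) -/
structure IsNullForceFree (U : Set M) (F : DiffForm M 2) : Prop where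
  smooth : SmoothForm U F
  closed : ∀ e ∈ IsManifold.maximalAtlas 𝓘(ℝ, E4) ∞ M, ∀ y ∈ e.target, e.symm y ∈ U →
    extDeriv (localForm e F) y = 0
  forceFree : ∀ e ∈ IsManifold.maximalAtlas 𝓘(ℝ, E4) ∞ M, ∀ y ∈ e.target, e.symm y ∈ U →
    ∀ v : E4, localForm e F y ![sharp (gram g e y) (localCurrent g e F y), v] = 0
  null : ∀ e ∈ IsManifold.maximalAtlas 𝓘(ℝ, E4) ∞ M, ∀ y ∈ e.target, e.symm y ∈ U →
    formSq (gram g e y) (localForm e F y) = 0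

/-- The `1`-form `X♭`. -/
def flat (X : ∀ p : M, TS p) (p : M) : TS p →L[ℝ] ℝ := g.val p (X p)

/-- The component `X♭_i` of `X♭` in the chart `e`, as a function on `e.source`. -/
def flatComp (e : OpenPartialHomeomorph M E4) (X : ∀ p : M, TS p) (i : Fin 4) (q : M) : ℝ :=
  flat g X (e.symm (e q)) (chartInvDeriv e (e q) (stdVec i))

/-- The factor `κ = (s♭₃ l♭₄ - s♭₄ l♭₃)⁻¹` between `dx³ ∧ dx⁴` and `s♭ ∧ l♭`. -/
def kappa (e : OpenPartialHomeomorph M E4) (s l : ∀ p : M, TS p) (q : M) : ℝ :=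
  (flatComp g e s 2 q * flatComp g e l 3 q - flatComp g e s 3 q * flatComp g e l 2 q)⁻¹

end Metric

/-- The values of the coordinate pair `(x³, x⁴)` on the domain of the chart `e`. -/
def leafSpace (e : OpenPartialHomeomorph M E4) : Set (ℝ × ℝ) :=
  (fun y : E4 => (y 2, y 3)) '' e.target

/-- The function `u(x³, x⁴)` on the domain of the chart `e`. -/
def leafFun (e : OpenPartialHomeomorph M E4) (u : ℝ × ℝ → ℝ) (q : M) : ℝ := u (e q 2, e q 3)

/-- The `2`-form `u(x³, x⁴) dx³ ∧ dx⁴` on the domain of the chart `e`. -/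
def adaptedForm (e : OpenPartialHomeomorph M E4) (u : ℝ × ℝ → ℝ) : DiffForm M 2 :=
  fun q => leafFun e u q • wedge ![dCoord e 2 q, dCoord e 3 q]

end Spacetime

end NullFF

end

noncomputable section

namespace NullFF

open scoped Topology

/-! ### Multilinear expansions in the coordinate space -/

/-! Write a for α♯. In an adapted chart a 2-form killed by a and l is a multiple f dx³ ∧ dx⁴, and it
is closed exactly when df vanishes along the slices. As the slices are connected, this says that f
is a function of x³ and x⁴ (`exists_leafFun`). Such a form has F² = 0, being a multiple of s♭ ∧ l♭.
What needs the geometry is that the force vanishes, and what needs analysis is that adapted charts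
exist.

Force. If a and l kill F, then s and l kill *F, and *F(a, n) = ±F(s, n) with a locally constant
sign: the Hodge star exchanges s and a. Suppose [s, l] = c s + q l and [a, l] = c a + t l with the
same c, and let k be the n-component of [l, n]. The invariant formula for d gives dF(s, l, n) =
-l(F(s, n)) + (k - c) F(s, n), and the same expression in *F(a, n) for d*F(a, l, n). Hence dF = 0
forces d*F(a, l, n) = 0, while d*F(s, a, l) = 0 is automatic. These two equations say that j♯ has no
component along s and n, so that F kills it (`force_free_of_brackets`).

Equal coefficients. [s, l] is tangent to the leaves and [a, l] lies in the span of a and l by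
involutivity. By the Koszul formula g(∇_X l, X) = g([X, l], X) for X = s, a, so equipartition of the
mean curvature is equality of the two values of c. It is given for some other adapted frame only.
Two such frames are related by l' = f l, s' = ±s + (…) l, a' = ±a + (…) l, and both quantities are
then multiplied by f (`equipartition_change`, `IsNullFieldSheetFoliation.exists_bracket_coeff`).

Charts. This is the Frobenius theorem. Locally the plane field is the graph of a map B, and its
leaves are the graphs of solutions of dY = B(x, Y). The equation is solved along the rays t ↦ t x,
all at once and smoothly in the data, by the implicit function theorem in a space of curves;
involutivity shows that the result solves the equation in all directions
(`exists_solution_of_integrable`). -/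

theorem sum_coord_smul_stdVec (x : E4) : ∑ i, x i • stdVec i = x := by
  ext j
  simp [stdVec, Finset.sum_apply, Pi.single_apply]

theorem form_expand {k : ℕ} (η : E4 [⋀^Fin k]→L[ℝ] ℝ) (v : Fin k → E4) :
    η v = ∑ K : Fin k → Fin 4, (∏ i, v i (K i)) * η (fun i => stdVec (K i)) := by
  conv_lhs => rw [show v = fun i => ∑ j, v i j • stdVec j from
    funext fun i => (sum_coord_smul_stdVec (v i)).symm]
  have h := η.toMultilinearMap.map_sum (fun i (j : Fin 4) => v i j • stdVec j)
  have h2 : η.toMultilinearMap (fun i => ∑ j, v i j • stdVec j)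
      = η (fun i => ∑ j, v i j • stdVec j) := rfl
  rw [← h2, h]
  refine Finset.sum_congr rfl fun K _ => ?_
  rw [MultilinearMap.map_smul_univ]
  rfl

theorem det_expand (x : Fin 4 → E4) :
    Matrix.det (Matrix.of fun i j => x i j)
      = ∑ K : Fin 4 → Fin 4, (∏ i, x i (K i)) * leviCivitaSymbol K := by
  have h := (Matrix.detRowAlternating (n := Fin 4) (R := ℝ)).toMultilinearMap.map_sum
    (fun i (j : Fin 4) => x i j • (fun l => if j = l then (1 : ℝ) else 0))
  have h0 : (fun i => ∑ j, x i j • (fun l => if j = l then (1 : ℝ) else 0))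
      = Matrix.of fun i j => x i j := by
    ext i l
    simp [Finset.sum_apply]
  rw [h0] at h
  refine h.trans (Finset.sum_congr rfl fun K _ => ?_)
  rw [MultilinearMap.map_smul_univ]
  rfl

/-- Any splitting of the inverse metric as Σ b_p ⊗ b'_p lets a contraction be carried out in the
frames b, b' in place of coordinates. Every metric expression below is evaluated in a null frame
this way. -/
theorem raise_eq_sum {k : ℕ} {G : Matrix (Fin 4) (Fin 4) ℝ} {b b' : Fin 4 → E4}
    (hG : ∀ i j, G⁻¹ i j = ∑ p, b p i * b' p j) (η : E4 [⋀^Fin k]→L[ℝ] ℝ) (I : Fin k → Fin 4) :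
    raise G η I
      = ∑ P : Fin k → Fin 4, (∏ i, b (P i) (I i)) * η (fun i => b' (P i)) := by
  simp only [raise, hG, Finset.prod_univ_sum, Fintype.piFinset_univ, Finset.sum_mul,
    Finset.prod_mul_distrib]
  rw [Finset.sum_comm]
  refine Finset.sum_congr rfl fun P _ => ?_
  rw [form_expand η fun i => b' (P i), Finset.mul_sum]
  exact Finset.sum_congr rfl fun K _ => by ring

theorem sum_append_levi {k m : ℕ} (h : k + m = 4) (x : Fin k → E4) (w : Fin m → E4) :
    ∑ I : Fin k → Fin 4, ∑ J : Fin m → Fin 4, (∏ i, x i (I i)) * ((∏ j, w j (J j)) *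
      leviCivitaSymbol (Fin.append I J ∘ Fin.cast h.symm))
      = Matrix.det (Matrix.of fun i j => (Fin.append x w ∘ Fin.cast h.symm) i j) := by
  rw [det_expand, ← Fintype.sum_prod_type']
  refine Fintype.sum_equiv ((Fin.appendEquiv k m).trans
    (Equiv.arrowCongr (finCongr h) (Equiv.refl _))) _ _ fun IJ => ?_
  obtain ⟨I, J⟩ := IJ
  have e : ((Fin.appendEquiv k m).trans (Equiv.arrowCongr (finCongr h) (Equiv.refl (Fin 4)))) (I, J)
      = Fin.append I J ∘ Fin.cast h.symm := rfl
  rw [e, ← mul_assoc]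
  congr 1
  rw [← Equiv.prod_comp (finCongr h), Fin.prod_univ_add]
  simp

theorem wedge_proj_apply {m : ℕ} (J : Fin m → Fin 4) (v : Fin m → E4) :
    wedge (fun j => (EuclideanSpace.proj (J j) : E4 →L[ℝ] ℝ)) v
      = ∑ σ : Equiv.Perm (Fin m), ((Equiv.Perm.sign σ : ℤ) : ℝ) * ∏ j, v (σ j) (J j) := by
  rw [wedge_apply, Matrix.det_apply']
  rfl

/-- Permuting the last m rows by σ is the row permutation id ⊕ σ, which has the sign of σ. -/
theorem det_append_perm {k m : ℕ} (h : k + m = 4) (x : Fin k → E4) (v : Fin m → E4)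
    (σ : Equiv.Perm (Fin m)) :
    Matrix.det (Matrix.of fun i j => (Fin.append x (v ∘ σ) ∘ Fin.cast h.symm) i j)
      = ((Equiv.Perm.sign σ : ℤ) : ℝ) *
        Matrix.det (Matrix.of fun i j => (Fin.append x v ∘ Fin.cast h.symm) i j) := by
  obtain rfl : m = 4 - k := by omega
  let τ : Equiv.Perm (Fin 4) := ((finSumFinEquiv.trans (finCongr h)).permCongr
    (Equiv.Perm.sumCongr (1 : Equiv.Perm (Fin k)) σ))
  have hs : Equiv.Perm.sign τ = Equiv.Perm.sign σ := by
    simp [τ, Equiv.Perm.sign_sumCongr]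
  rw [← hs, ← Matrix.det_permute]
  congr 1
  ext i j
  obtain ⟨i, rfl⟩ := (finSumFinEquiv.trans (finCongr h)).surjective i
  rcases i with i | i <;> simp [τ, Equiv.permCongr_apply]

theorem sum_rotate {α β γ : Type*} [Fintype α] [Fintype β] [Fintype γ] (f : α → β → γ → ℝ) :
    ∑ x, ∑ y, ∑ z, f x y z = ∑ z, ∑ x, ∑ y, f x y z := by
  rw [Finset.sum_comm]
  exact (Finset.sum_congr rfl fun x _ => Finset.sum_comm).trans Finset.sum_comm |>.trans
    (Finset.sum_congr rfl fun z _ => Finset.sum_comm)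

/-- Each permutation σ in the expansion of the wedge contributes its sign twice, once from the wedge
and once from reordering the rows of the determinant. The m! terms are therefore equal and cancel
the factor 1/m!. -/
theorem hodgeStar_apply {k m : ℕ} (h : k + m = 4) {G : Matrix (Fin 4) (Fin 4) ℝ}
    {b b' : Fin 4 → E4} (hG : ∀ i j, G⁻¹ i j = ∑ p, b p i * b' p j)
    (η : E4 [⋀^Fin k]→L[ℝ] ℝ) (v : Fin m → E4) :
    hodgeStar h G η v = √|G.det| / (k ! : ℝ) * ∑ P : Fin k → Fin 4, η (fun i => b' (P i)) *
      Matrix.det (Matrix.of fun i j =>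
        (Fin.append (fun i => b (P i)) v ∘ Fin.cast h.symm) i j) := by
  have key : ∀ P : Fin k → Fin 4, ∑ I : Fin k → Fin 4, ∑ J : Fin m → Fin 4,
      (∏ i, b (P i) (I i)) * (leviCivitaSymbol (Fin.append I J ∘ Fin.cast h.symm) *
        wedge (fun j => (EuclideanSpace.proj (J j) : E4 →L[ℝ] ℝ)) v)
      = (m ! : ℝ) * Matrix.det (Matrix.of fun i j =>
        (Fin.append (fun i => b (P i)) v ∘ Fin.cast h.symm) i j) := by
    intro P
    set d := Matrix.det (Matrix.of fun i j =>
        (Fin.append (fun i => b (P i)) v ∘ Fin.cast h.symm) i j)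
    have e : ∀ σ : Equiv.Perm (Fin m), ∑ I : Fin k → Fin 4, ∑ J : Fin m → Fin 4,
        (∏ i, b (P i) (I i)) * ((∏ j, v (σ j) (J j)) *
          leviCivitaSymbol (Fin.append I J ∘ Fin.cast h.symm))
        = ((Equiv.Perm.sign σ : ℤ) : ℝ) * d := fun σ =>
      (sum_append_levi h (fun i => b (P i)) (v ∘ σ)).trans (det_append_perm h _ v σ)
    calc _ = ∑ σ : Equiv.Perm (Fin m), ((Equiv.Perm.sign σ : ℤ) : ℝ) *
          ∑ I : Fin k → Fin 4, ∑ J : Fin m → Fin 4, (∏ i, b (P i) (I i)) *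
          ((∏ j, v (σ j) (J j)) * leviCivitaSymbol (Fin.append I J ∘ Fin.cast h.symm)) := by
          simp only [wedge_proj_apply, Finset.mul_sum]
          rw [sum_rotate]
          refine Finset.sum_congr rfl fun σ _ => Finset.sum_congr rfl fun I _ =>
            Finset.sum_congr rfl fun J _ => by ring
      _ = ∑ σ : Equiv.Perm (Fin m), d := by
          refine Finset.sum_congr rfl fun σ _ => ?_
          rw [e, ← mul_assoc]
          rcases Int.units_eq_one_or (Equiv.Perm.sign σ) with hσ | hσ <;> simp [hσ]
      _ = _ := by simp [Fintype.card_perm]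
  have hm : (m ! : ℝ) ≠ 0 := by positivity
  have hk : (k ! : ℝ) ≠ 0 := by positivity
  simp only [hodgeStar, ContinuousAlternatingMap.smul_apply, ContinuousAlternatingMap.sum_apply,
    smul_eq_mul, raise_eq_sum hG]
  have e2 : ∑ I : Fin k → Fin 4, ∑ J : Fin m → Fin 4,
      ((∑ P : Fin k → Fin 4, (∏ i, b (P i) (I i)) * η (fun i => b' (P i))) *
        leviCivitaSymbol (Fin.append I J ∘ Fin.cast h.symm)) *
        wedge (fun j => (EuclideanSpace.proj (J j) : E4 →L[ℝ] ℝ)) v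
      = ∑ P : Fin k → Fin 4, η (fun i => b' (P i)) * ∑ I : Fin k → Fin 4, ∑ J : Fin m → Fin 4,
      (∏ i, b (P i) (I i)) * (leviCivitaSymbol (Fin.append I J ∘ Fin.cast h.symm) *
        wedge (fun j => (EuclideanSpace.proj (J j) : E4 →L[ℝ] ℝ)) v) := by
    simp only [Finset.mul_sum, Finset.sum_mul]
    rw [sum_rotate]
    exact Finset.sum_congr rfl fun P _ => Finset.sum_congr rfl fun I _ =>
      Finset.sum_congr rfl fun J _ => by ring
  rw [e2]
  simp only [key]
  rw [Finset.mul_sum, Finset.mul_sum]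
  refine Finset.sum_congr rfl fun P _ => ?_
  field_simp

/-! ### Null frames -/

/-- The matrix of inner products of a null frame `(s, a, l, n)`. -/
def nullGram : Matrix (Fin 4) (Fin 4) ℝ := !![1, 0, 0, 0; 0, 1, 0, 0; 0, 0, 0, -1; 0, 0, -1, 0]

/-- The frame metrically dual to the null frame `(s, a, l, n)`. -/
def dualFrame (b : Fin 4 → E4) : Fin 4 → E4 := ![b 0, b 1, -b 3, -b 2]

/-- The matrix of a bilinear form on the coordinate space. -/
def bilinMatrix (β : E4 →L[ℝ] E4 →L[ℝ] ℝ) : Matrix (Fin 4) (Fin 4) ℝ :=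
  Matrix.of fun i j => β (stdVec i) (stdVec j)

/-- `b = (s, a, l, n)` is a null frame for the bilinear form `β`. -/
def IsNullFrame (β : E4 →L[ℝ] E4 →L[ℝ] ℝ) (b : Fin 4 → E4) : Prop :=
  ∀ i j, β (b i) (b j) = nullGram i j

/-- The matrix whose rows are the vectors of a frame. -/
def frameMatrix (b : Fin 4 → E4) : Matrix (Fin 4) (Fin 4) ℝ := Matrix.of fun i j => b i j

theorem nullGram_sq : nullGram * nullGram = 1 := by
  ext i j
  fin_cases i <;> fin_cases j <;> simp [nullGram, Matrix.mul_apply, Fin.sum_univ_four]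

theorem nullGram_det : nullGram.det = -1 := by
  simp [nullGram, Matrix.det_succ_row_zero, Fin.sum_univ_succ, Fin.succAbove]

theorem frameMatrix_mul_bilinMatrix (β : E4 →L[ℝ] E4 →L[ℝ] ℝ) (b : Fin 4 → E4) :
    frameMatrix b * bilinMatrix β * (frameMatrix b)ᵀ = Matrix.of fun i j => β (b i) (b j) := by
  ext p q
  conv_rhs => rw [Matrix.of_apply, ← sum_coord_smul_stdVec (b p), ← sum_coord_smul_stdVec (b q)]
  simp only [map_sum, map_smul, sum_apply, smul_apply,
    Matrix.mul_apply, Matrix.transpose_apply, frameMatrix, bilinMatrix, Matrix.of_apply,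
    smul_eq_mul, Finset.sum_mul, Finset.mul_sum]
  exact Finset.sum_congr rfl fun i _ => Finset.sum_congr rfl fun j _ => by ring

namespace IsNullFrame

variable {β : E4 →L[ℝ] E4 →L[ℝ] ℝ} {b : Fin 4 → E4}

theorem mul_mul (h : IsNullFrame β b) :
    frameMatrix b * bilinMatrix β * (frameMatrix b)ᵀ = nullGram := by
  rw [frameMatrix_mul_bilinMatrix]
  ext i j
  exact h i j

/-- With B the frame matrix, G the metric and N = `nullGram`, the relations B G Bᵀ = N and N² = 1
give G⁻¹ = Bᵀ N B, and the rows of N B are the dual frame. -/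
theorem inv_apply (h : IsNullFrame β b) (i j : Fin 4) :
    (bilinMatrix β)⁻¹ i j = ∑ p, b p i * dualFrame b p j := by
  have h1 : (nullGram * frameMatrix b * bilinMatrix β) * (frameMatrix b)ᵀ = 1 := by
    rw [Matrix.mul_assoc, Matrix.mul_assoc, ← Matrix.mul_assoc (frameMatrix b), h.mul_mul,
      nullGram_sq]
  have h2 : (frameMatrix b)ᵀ * (nullGram * frameMatrix b) * bilinMatrix β = 1 := by
    rw [Matrix.mul_assoc]
    exact mul_eq_one_comm.1 h1
  rw [Matrix.inv_eq_left_inv h2]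
  simp [Matrix.mul_apply, Fin.sum_univ_four, nullGram, frameMatrix, dualFrame, Matrix.vecHead,
    Matrix.vecTail]

theorem det_mul (h : IsNullFrame β b) :
    (bilinMatrix β).det * (frameMatrix b).det ^ 2 = -1 := by
  have := congrArg Matrix.det h.mul_mul
  rw [Matrix.det_mul, Matrix.det_mul, Matrix.det_transpose, nullGram_det] at this
  linarith

theorem det_ne_zero (h : IsNullFrame β b) : (frameMatrix b).det ≠ 0 := fun h0 => by
  have := h.det_mul
  simp [h0] at this

theorem sqrt_det (h : IsNullFrame β b) :
    √|(bilinMatrix β).det| = |(frameMatrix b).det|⁻¹ := by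
  have h0 := h.det_ne_zero
  have h1 : |(bilinMatrix β).det| = (|(frameMatrix b).det|⁻¹) ^ 2 := by
    have : |(bilinMatrix β).det| * |(frameMatrix b).det| ^ 2 = 1 := by
      rw [← abs_pow, ← abs_mul, h.det_mul]
      simp
    rw [inv_pow]
    exact eq_inv_of_mul_eq_one_left this
  rw [h1, Real.sqrt_sq (by positivity)]

end IsNullFrame

/-! ### Hodge duals and contractions of forms killed by α♯ and l -/

theorem sum_fin_two_fun {f : (Fin 2 → Fin 4) → ℝ} : ∑ P, f P = ∑ i, ∑ j, f ![i, j] := by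
  rw [← Fintype.sum_prod_type', ← (finTwoArrowEquiv (Fin 4)).symm.sum_comp]
  exact Finset.sum_congr rfl fun P _ => rfl

theorem form_swap (η : E4 [⋀^Fin 2]→L[ℝ] ℝ) (v w : E4) : η ![v, w] = -η ![w, v] := by
  have := η.toAlternatingMap.map_swap ![w, v] (i := 0) (j := 1) (by decide)
  have e : ![w, v] ∘ ⇑(Equiv.swap (0 : Fin 2) 1) = ![v, w] := by
    ext i : 1
    fin_cases i <;> rfl
  rw [e] at this
  exact this

theorem form_self (η : E4 [⋀^Fin 2]→L[ℝ] ℝ) (v : E4) : η ![v, v] = 0 :=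
  η.map_eq_zero_of_eq ![v, v] (i := 0) (j := 1) rfl (by decide)

theorem form_add_left (η : E4 [⋀^Fin 2]→L[ℝ] ℝ) (v v' w : E4) :
    η ![v + v', w] = η ![v, w] + η ![v', w] :=
  η.toAlternatingMap.map_vecCons_add ![w] v v'

theorem form_smul_left (η : E4 [⋀^Fin 2]→L[ℝ] ℝ) (c : ℝ) (v w : E4) :
    η ![c • v, w] = c * η ![v, w] :=
  η.toAlternatingMap.map_vecCons_smul ![w] c v

theorem form_neg_left (η : E4 [⋀^Fin 2]→L[ℝ] ℝ) (v w : E4) : η ![-v, w] = -η ![v, w] := by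
  have := form_smul_left η (-1) v w
  simpa using this

theorem form_neg_right (η : E4 [⋀^Fin 2]→L[ℝ] ℝ) (v w : E4) : η ![v, -w] = -η ![v, w] := by
  rw [form_swap, form_neg_left, form_swap η v w]

/-- The covolume `det (x, y, v, w)` used for Hodge duals of `2`-forms. -/
def det4 (x y v w : E4) : ℝ := (frameMatrix ![x, y, v, w]).det

/-- Among pairs of dual vectors only (s, -n) and its swap survive: all others repeat a vector or
contain a or l. The two terms cancel the 2!, and the sign comes from -n. The covolume det(s, l, ·,
·) makes it visible that s and l kill the dual. -/
theorem hodgeStar_two {β : E4 →L[ℝ] E4 →L[ℝ] ℝ} {b : Fin 4 → E4} (hb : IsNullFrame β b)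
    {η : E4 [⋀^Fin 2]→L[ℝ] ℝ} (h1 : ∀ w, η ![b 1, w] = 0) (h2 : ∀ w, η ![b 2, w] = 0)
    (v : Fin 2 → E4) :
    hodgeStar (k := 2) (m := 2) rfl (bilinMatrix β) η v
      = -(|(frameMatrix b).det|⁻¹ * η ![b 0, b 3] * det4 (b 0) (b 2) (v 0) (v 1)) := by
  have h1' : ∀ w, η ![w, b 1] = 0 := fun w => by rw [form_swap, h1, neg_zero]
  have h2' : ∀ w, η ![w, b 2] = 0 := fun w => by rw [form_swap, h2, neg_zero]
  have e : ∀ i j, (fun k => dualFrame b (![i, j] k)) = ![dualFrame b i, dualFrame b j] := by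
    intro i j
    ext k : 1
    fin_cases k <;> rfl
  have e2 : ∀ i j, (Matrix.of fun k l => (Fin.append (fun m => b (![i, j] m)) v ∘
      Fin.cast (rfl : 2 + 2 = 4).symm) k l).det = det4 (b i) (b j) (v 0) (v 1) := by
    intro i j
    unfold det4 frameMatrix
    congr 2
    ext k l
    fin_cases k <;> rfl
  have e3 : det4 (b 2) (b 0) (v 0) (v 1) = - det4 (b 0) (b 2) (v 0) (v 1) := by
    unfold det4
    have := Matrix.det_permute (Equiv.swap (0 : Fin 4) 1) (frameMatrix ![b 0, b 2, v 0, v 1])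
    rw [Equiv.Perm.sign_swap (by decide)] at this
    simp only [Units.val_neg, Units.val_one, Int.cast_neg, Int.cast_one, neg_mul, one_mul] at this
    rw [← this]
    congr 1
    ext k l
    fin_cases k <;> rfl
  rw [hodgeStar_apply rfl hb.inv_apply, hb.sqrt_det, sum_fin_two_fun]
  simp only [e, e2, Fin.sum_univ_four]
  simp [dualFrame, form_neg_left, form_neg_right, h1, h2, h1', h2', form_self, e3,
    form_swap η (b 3) (b 0)]
  ring

/-- The square pairs each value of the form on two frame vectors with its value on the two dual
ones. Only the values on s and n can be nonzero, and the vector dual to n is -l, so every product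
has a vanishing factor. -/
theorem formSq_eq_zero {β : E4 →L[ℝ] E4 →L[ℝ] ℝ} {b : Fin 4 → E4} (hb : IsNullFrame β b)
    {η : E4 [⋀^Fin 2]→L[ℝ] ℝ} (h1 : ∀ w, η ![b 1, w] = 0) (h2 : ∀ w, η ![b 2, w] = 0) :
    formSq (bilinMatrix β) η = 0 := by
  have h1' : ∀ w, η ![w, b 1] = 0 := fun w => by rw [form_swap, h1, neg_zero]
  have h2' : ∀ w, η ![w, b 2] = 0 := fun w => by rw [form_swap, h2, neg_zero]
  have e : ∀ (c : Fin 4 → E4) (i j), (fun k => c (![i, j] k)) = ![c i, c j] := by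
    intro c i j
    ext k : 1
    fin_cases k <;> rfl
  have : formSq (bilinMatrix β) η
      = ∑ P : Fin 2 → Fin 4, η (fun i => b (P i)) * η (fun i => dualFrame b (P i)) := by
    simp only [formSq, raise_eq_sum hb.inv_apply, Finset.mul_sum]
    rw [Finset.sum_comm]
    refine Finset.sum_congr rfl fun P _ => ?_
    rw [form_expand η fun i => b (P i), Finset.sum_mul]
    exact Finset.sum_congr rfl fun K _ => by ring
  rw [this, sum_fin_two_fun]
  simp only [e, Fin.sum_univ_four]
  simp [dualFrame, form_neg_left, form_neg_right, h1, h2, h1', h2', form_self]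

theorem form_three_eq_zero {Ω : E4 [⋀^Fin 3]→L[ℝ] ℝ} {c : Fin 4 → E4} {r : Fin 4}
    (h : Ω (fun i => c (r.succAbove i)) = 0) {P : Fin 3 → Fin 4} (hP : ∀ i, P i ≠ r) :
    Ω (fun i => c (P i)) = 0 := by
  by_cases hi : Function.Injective P
  · choose q hq using fun i => Fin.exists_succAbove_eq (hP i)
    have hqi : Function.Injective q := fun i j hij => hi (by rw [← hq, ← hq, hij])
    let σ : Equiv.Perm (Fin 3) := Equiv.ofBijective q (Finite.injective_iff_bijective.1 hqi)
    have e : (fun i => c (P i)) = (fun i => c (r.succAbove i)) ∘ σ := by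
      ext i : 1
      simp [σ, hq]
    rw [e]
    have := Ω.toAlternatingMap.map_perm (fun i => c (r.succAbove i)) σ
    refine this.trans ?_
    rw [show Ω.toAlternatingMap (fun i => c (r.succAbove i)) = 0 from h, smul_zero]
  · refine Ω.map_eq_zero_of_not_injective _ fun h' => hi fun i j hij => h' ?_
    simp [hij]

/-- In the frame expansion a triple of indices containing r produces a determinant with the row `b
r` twice, and a triple avoiding r evaluates Ω on vectors where it vanishes. -/
theorem hodgeStar_three_eq_zero {β : E4 →L[ℝ] E4 →L[ℝ] ℝ} {b : Fin 4 → E4} (hb : IsNullFrame β b)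
    {Ω : E4 [⋀^Fin 3]→L[ℝ] ℝ} {r : Fin 4} (h : Ω (fun i => dualFrame b (r.succAbove i)) = 0) :
    hodgeStar (k := 3) (m := 1) rfl (bilinMatrix β) Ω ![b r] = 0 := by
  rw [hodgeStar_apply rfl hb.inv_apply]
  refine mul_eq_zero_of_right _ (Finset.sum_eq_zero fun P _ => ?_)
  by_cases hP : ∀ i, P i ≠ r
  · rw [form_three_eq_zero h hP, zero_mul]
  · push Not at hP
    obtain ⟨i, hi⟩ := hP
    refine mul_eq_zero_of_right _ (Matrix.det_zero_of_row_eq (i := Fin.castSucc i)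
      (j := Fin.last 3) (Fin.castSucc_lt_last i).ne ?_)
    ext j
    have h1 : Fin.append (fun i => b (P i)) ![b r] (Fin.castAdd 1 i) = b (P i) := by simp
    have h2 : Fin.append (fun i => b (P i)) ![b r] (Fin.natAdd 3 0) = b r :=
      Fin.append_right _ _ 0
    exact congrArg (fun x : E4 => x j) (h1.trans (by rw [hi]) |>.trans h2.symm)

theorem form_three_neg (Ω : E4 [⋀^Fin 3]→L[ℝ] ℝ) (c : Fin 3 → ℝ) (x : Fin 3 → E4)
    (h : Ω x = 0) : Ω (fun i => c i • x i) = 0 :=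
  (Ω.toMultilinearMap.map_smul_univ c x).trans
    (by rw [show Ω.toMultilinearMap x = 0 from h, smul_zero])

theorem form_one_neg (τ : E4 [⋀^Fin 1]→L[ℝ] ℝ) (x : E4) (h : τ ![x] = 0) : τ ![-x] = 0 := by
  have h1 : ![-x] = fun i : Fin 1 => (-1 : ℝ) • (![x] : Fin 1 → E4) i := by
    ext i : 1
    fin_cases i
    simp
  rw [h1]
  exact (τ.toMultilinearMap.map_smul_univ _ _).trans
    (by rw [show τ.toMultilinearMap ![x] = 0 from h, smul_zero])

theorem form_three_swap (Ω : E4 [⋀^Fin 3]→L[ℝ] ℝ) (x y z : E4) (h : Ω ![x, y, z] = 0) :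
    Ω ![x, z, y] = 0 := by
  have := Ω.toAlternatingMap.map_swap ![x, y, z] (i := 1) (j := 2) (by decide)
  have e : ![x, y, z] ∘ ⇑(Equiv.swap (1 : Fin 3) 2) = ![x, z, y] := by
    ext i : 1
    fin_cases i <;> rfl
  rw [e] at this
  exact this.trans (neg_eq_zero.2 h)

/-- The vector τ♯ is Σ τ(dual of b_p) b_p, and η kills its components along a and l. The components
along s and n are τ(s) and -τ(l). With τ = *Ω these vanish because Ω vanishes on the dual triples
complementary to s and l, which are (a, n, l) and (s, a, l) up to sign. -/
theorem sharp_mem_ker {β : E4 →L[ℝ] E4 →L[ℝ] ℝ} {b : Fin 4 → E4} (hb : IsNullFrame β b)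
    {η : E4 [⋀^Fin 2]→L[ℝ] ℝ} (h1 : ∀ w, η ![b 1, w] = 0) (h2 : ∀ w, η ![b 2, w] = 0)
    {Ω : E4 [⋀^Fin 3]→L[ℝ] ℝ} (h012 : Ω ![b 0, b 1, b 2] = 0) (h123 : Ω ![b 1, b 2, b 3] = 0)
    (v : E4) :
    η ![sharp (bilinMatrix β) (hodgeStar (k := 3) (m := 1) rfl (bilinMatrix β) Ω), v] = 0 := by
  set τ := hodgeStar (k := 3) (m := 1) rfl (bilinMatrix β) Ω
  have e0 : τ ![b 0] = 0 := by
    refine hodgeStar_three_eq_zero hb ?_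
    have : (fun i => dualFrame b ((0 : Fin 4).succAbove i)) =
        fun i => ![(1 : ℝ), -1, -1] i • (![b 1, b 3, b 2] : Fin 3 → E4) i := by
      ext i : 1
      fin_cases i <;> simp [dualFrame, Fin.succAbove]
    rw [this]
    exact form_three_neg Ω _ _ (form_three_swap Ω _ _ _ h123)
  have e2 : τ ![b 2] = 0 := by
    refine hodgeStar_three_eq_zero hb ?_
    have : (fun i => dualFrame b ((2 : Fin 4).succAbove i)) =
        fun i => ![(1 : ℝ), 1, -1] i • (![b 0, b 1, b 2] : Fin 3 → E4) i := by
      ext i : 1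
      fin_cases i <;> simp [dualFrame, Fin.succAbove]
    rw [this]
    exact form_three_neg Ω _ _ h012
  have e : sharp (bilinMatrix β) τ = ∑ p, τ ![dualFrame b p] • b p := by
    ext i
    simp only [sharp, raise_eq_sum hb.inv_apply]
    rw [← (Equiv.funUnique (Fin 1) (Fin 4)).symm.sum_comp]
    simp only [WithLp.ofLp_sum, Finset.sum_apply, smul_eq_mul, WithLp.ofLp_smul, Pi.smul_apply]
    refine Finset.sum_congr rfl fun p _ => ?_
    have e1 : (fun i : Fin 1 => dualFrame b ((Equiv.funUnique (Fin 1) (Fin 4)).symm p i))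
        = ![dualFrame b p] := by
      ext i : 1
      fin_cases i
      rfl
    rw [e1, mul_comm]
    simp
  have e3 : τ ![-b 2] = 0 := form_one_neg τ _ e2
  rw [e, Fin.sum_univ_four]
  simp only [form_add_left, form_smul_left, h1, h2]
  simp [dualFrame, e0, e3]

/-! ### Regularity of form-valued maps from that of their values -/

theorem form_eq_sum_wedge {k : ℕ} (η : E4 [⋀^Fin k]→L[ℝ] ℝ) :
    η = ∑ I : Fin k → Fin 4, ((k ! : ℝ)⁻¹ * η (fun i => stdVec (I i))) •
      wedge (fun j => (EuclideanSpace.proj (I j) : E4 →L[ℝ] ℝ)) := by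
  ext v
  simp only [ContinuousAlternatingMap.sum_apply, ContinuousAlternatingMap.smul_apply, smul_eq_mul,
    wedge_proj_apply, Finset.mul_sum]
  rw [Finset.sum_comm]
  have e : ∀ σ : Equiv.Perm (Fin k), ∑ I : Fin k → Fin 4,
      (k ! : ℝ)⁻¹ * η (fun i => stdVec (I i)) *
        (((Equiv.Perm.sign σ : ℤ) : ℝ) * ∏ j, v (σ j) (I j)) = (k ! : ℝ)⁻¹ * η v := by
    intro σ
    have h1 : η (v ∘ σ) = ((Equiv.Perm.sign σ : ℤ) : ℝ) * η v := by
      refine (η.toAlternatingMap.map_perm v σ).trans ?_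
      rw [Units.smul_def, zsmul_eq_mul]
      rfl
    have h2 := form_expand η (v ∘ σ)
    calc _ = (k ! : ℝ)⁻¹ * (((Equiv.Perm.sign σ : ℤ) : ℝ) *
          ∑ I : Fin k → Fin 4, (∏ j, (v ∘ σ) j (I j)) * η (fun i => stdVec (I i))) := by
          rw [Finset.mul_sum, Finset.mul_sum]
          exact Finset.sum_congr rfl fun I _ => by simp only [Function.comp_apply]; ring
      _ = _ := by
          rw [← h2, h1]
          rcases Int.units_eq_one_or (Equiv.Perm.sign σ) with hσ | hσ <;> simp [hσ]
  rw [Finset.sum_congr rfl fun σ _ => e σ, Finset.sum_const, Finset.card_univ, Fintype.card_perm,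
    Fintype.card_fin, nsmul_eq_mul, ← mul_assoc, mul_inv_cancel₀ (by positivity), one_mul]

theorem contDiffWithinAt_form {V : Type*} [NormedAddCommGroup V] [NormedSpace ℝ V] {k : ℕ}
    {n : WithTop ℕ∞} {η : V → E4 [⋀^Fin k]→L[ℝ] ℝ} {s : Set V} {x : V}
    (h : ∀ v, ContDiffWithinAt ℝ n (fun z => η z v) s x) : ContDiffWithinAt ℝ n η s x := by
  have e : η = fun z => ∑ I : Fin k → Fin 4, ((k ! : ℝ)⁻¹ * η z (fun i => stdVec (I i))) •
      wedge (fun j => (EuclideanSpace.proj (I j) : E4 →L[ℝ] ℝ)) :=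
    funext fun z => form_eq_sum_wedge (η z)
  rw [e]
  exact ContDiffWithinAt.sum fun I _ => (contDiffWithinAt_const.mul (h _)).smul_const _

theorem differentiableAt_form {V : Type*} [NormedAddCommGroup V] [NormedSpace ℝ V] {k : ℕ}
    {η : V → E4 [⋀^Fin k]→L[ℝ] ℝ} {x : V}
    (h : ∀ v, DifferentiableAt ℝ (fun z => η z v) x) : DifferentiableAt ℝ η x := by
  have e : η = fun z => ∑ I : Fin k → Fin 4, ((k ! : ℝ)⁻¹ * η z (fun i => stdVec (I i))) •
      wedge (fun j => (EuclideanSpace.proj (I j) : E4 →L[ℝ] ℝ)) :=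
    funext fun z => form_eq_sum_wedge (η z)
  rw [e]
  exact DifferentiableAt.fun_sum fun I _ => ((h _).const_mul _).smul_const _

/-! ### The force-free condition in coordinates -/

section Coordinates

open Filter Topology

theorem extDeriv_two_apply {η : E4 → E4 [⋀^Fin 2]→L[ℝ] ℝ} {X Y Z : E4 → E4} {x : E4}
    (hη : DifferentiableAt ℝ η x) (hX : DifferentiableAt ℝ X x) (hY : DifferentiableAt ℝ Y x)
    (hZ : DifferentiableAt ℝ Z x) :
    extDeriv η x ![X x, Y x, Z x] =
      fderiv ℝ (fun z => η z ![Y z, Z z]) x (X x) - fderiv ℝ (fun z => η z ![X z, Z z]) x (Y x)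
      + fderiv ℝ (fun z => η z ![X z, Y z]) x (Z x)
      - η x ![lieBracket ℝ X Y x, Z x] + η x ![lieBracket ℝ X Z x, Y x]
      - η x ![lieBracket ℝ Y Z x, X x] := by
  have h : extDeriv η x (fun i : Fin 3 => (![X, Y, Z] : Fin 3 → E4 → E4) i x) =
      (∑ i : Fin 3, (-1) ^ i.val • fderiv ℝ (fun z => η z
        (i.removeNth fun k => (![X, Y, Z] : Fin 3 → E4 → E4) k z)) x
          ((![X, Y, Z] : Fin 3 → E4 → E4) i x)) -
      ∑ i : Fin 2, ∑ j ∈ Finset.Ici i, (-1) ^ (i.val + j.val) • η x (Matrix.vecCons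
        (lieBracket ℝ ((![X, Y, Z] : Fin 3 → E4 → E4) i.castSucc)
          ((![X, Y, Z] : Fin 3 → E4 → E4) j.succ) x)
        (j.removeNth (i.castSucc.removeNth fun k => (![X, Y, Z] : Fin 3 → E4 → E4) k x))) :=
    extDeriv_apply_vectorField (V := ![X, Y, Z]) hη (by intro i; fin_cases i <;> assumption)
  have e : (fun i : Fin 3 => (![X, Y, Z] : Fin 3 → E4 → E4) i x) = ![X x, Y x, Z x] := by
    ext i : 1
    fin_cases i <;> rfl
  have e0 : ∀ z, (0 : Fin 3).removeNth (fun i => (![X, Y, Z] : Fin 3 → E4 → E4) i z)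
      = ![Y z, Z z] := by
    intro z
    ext i : 1
    fin_cases i <;> rfl
  have e1 : ∀ z, (1 : Fin 3).removeNth (fun i => (![X, Y, Z] : Fin 3 → E4 → E4) i z)
      = ![X z, Z z] := by
    intro z
    ext i : 1
    fin_cases i <;> rfl
  have e2 : ∀ z, (2 : Fin 3).removeNth (fun i => (![X, Y, Z] : Fin 3 → E4 → E4) i z)
      = ![X z, Y z] := by
    intro z
    ext i : 1
    fin_cases i <;> rfl
  rw [e] at h
  rw [h]
  have hI : Finset.Ici (0 : Fin 2) = {0, 1} := by decide
  have hI1 : Finset.Ici (1 : Fin 2) = {1} := by decide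
  have c0 : Fin.castSucc (0 : Fin 2) = 0 := rfl
  have c1 : Fin.castSucc (1 : Fin 2) = 1 := rfl
  have s0 : Fin.succ (0 : Fin 2) = 1 := rfl
  have s1 : Fin.succ (1 : Fin 2) = 2 := rfl
  have r0 : (0 : Fin 2).removeNth ((0 : Fin 3).removeNth ![X x, Y x, Z x]) = ![Z x] := by
    ext i : 1
    fin_cases i
    rfl
  have r1 : (1 : Fin 2).removeNth ((0 : Fin 3).removeNth ![X x, Y x, Z x]) = ![Y x] := by
    ext i : 1
    fin_cases i
    rfl
  have r2 : (1 : Fin 2).removeNth ((1 : Fin 3).removeNth ![X x, Y x, Z x]) = ![X x] := by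
    ext i : 1
    fin_cases i
    rfl
  have v0 : (![X, Y, Z] : Fin 3 → E4 → E4) 0 = X := rfl
  have v1 : (![X, Y, Z] : Fin 3 → E4 → E4) 1 = Y := rfl
  have v2 : (![X, Y, Z] : Fin 3 → E4 → E4) 2 = Z := rfl
  simp only [Fin.sum_univ_three, Fin.sum_univ_two, hI, hI1, Finset.sum_singleton,
    Finset.sum_pair (show (0 : Fin 2) ≠ 1 by decide), c0, c1, s0, s1, e0, e1, e2, r0, r1, r2,
    v0, v1, v2]
  simp
  ring

/-- Since η kills L, only one derivative term of the invariant formula survives, the bracket [B, N]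
drops out, and [B, L] enters through its component p along B. The lemma serves both F with B = s and
*F with B = α♯, so that the two equations can be compared. -/
theorem extDeriv_of_invariant {η : E4 → E4 [⋀^Fin 2]→L[ℝ] ℝ} {B L N : E4 → E4} {x : E4}
    (hη : DifferentiableAt ℝ η x) (hB : DifferentiableAt ℝ B x) (hL : DifferentiableAt ℝ L x)
    (hN : DifferentiableAt ℝ N x) (hk : ∀ᶠ z in 𝓝 x, ∀ w, η z ![L z, w] = 0) {p t c : ℝ}
    (hBL : lieBracket ℝ B L x = p • B x + t • L x)
    (hc : η x ![lieBracket ℝ L N x, B x] = c * η x ![N x, B x]) :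
    extDeriv η x ![B x, L x, N x] = -fderiv ℝ (fun z => η z ![B z, N z]) x (L x)
      + (c - p) * η x ![B x, N x] := by
  have h1 : (fun z => η z ![L z, N z]) =ᶠ[𝓝 x] fun _ => 0 := hk.mono fun z hz => hz _
  have h2 : (fun z => η z ![B z, L z]) =ᶠ[𝓝 x] fun _ => 0 :=
    hk.mono fun z hz => (form_swap _ _ _).trans (by rw [hz, neg_zero])
  have hx := hk.self_of_nhds
  rw [extDeriv_two_apply hη hB hL hN, h1.fderiv_eq, h2.fderiv_eq, hBL, hc,
    form_swap _ (lieBracket ℝ B N x), hx, form_add_left, form_smul_left, form_smul_left, hx,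
    form_swap _ (N x)]
  simp
  ring

theorem differentiableAt_det {V : Type*} [NormedAddCommGroup V] [NormedSpace ℝ V]
    {b : Fin 4 → V → E4} {x : V} (hb : ∀ i, DifferentiableAt ℝ (b i) x) :
    DifferentiableAt ℝ (fun z => (frameMatrix fun i => b i z).det) x := by
  simp only [Matrix.det_apply', frameMatrix, Matrix.of_apply]
  refine DifferentiableAt.fun_sum fun σ _ => DifferentiableAt.const_mul ?_ _
  have h : ∀ i, DifferentiableAt ℝ (fun z => b (σ i) z i) x := fun i =>
    (EuclideanSpace.proj i : E4 →L[ℝ] ℝ).differentiableAt.comp x (hb (σ i))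
  exact (HasFDerivAt.finsetProd fun i _ => (h i).hasFDerivAt).differentiableAt

theorem det4_swap (x y v w : E4) : det4 x y v w = -det4 x v y w := by
  have := Matrix.det_permute (Equiv.swap (1 : Fin 4) 2) (frameMatrix ![x, v, y, w])
  rw [Equiv.Perm.sign_swap (by decide)] at this
  simp only [Units.val_neg, Units.val_one, Int.cast_neg, Int.cast_one, neg_mul, one_mul] at this
  unfold det4
  rw [← this]
  congr 1
  ext k l
  fin_cases k <;> rfl

theorem det4_eq_zero {x y v w : E4} (h : v = x ∨ v = y) : det4 x y v w = 0 := by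
  rcases h with rfl | rfl
  · exact Matrix.det_zero_of_row_eq (i := 0) (j := 2) (by decide) rfl
  · exact Matrix.det_zero_of_row_eq (i := 1) (j := 2) (by decide) rfl

theorem frame_span {b : Fin 4 → E4} (h : (frameMatrix b).det ≠ 0) (x : E4) :
    ∃ c : Fin 4 → ℝ, x = ∑ i, c i • b i := by
  have hu : IsUnit (frameMatrix b).det := isUnit_iff_ne_zero.2 h
  refine ⟨Matrix.vecMul x.ofLp (frameMatrix b)⁻¹, ?_⟩
  ext j
  have h1 : Matrix.vecMul (Matrix.vecMul x.ofLp (frameMatrix b)⁻¹) (frameMatrix b) = x.ofLp := by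
    rw [Matrix.vecMul_vecMul, Matrix.nonsing_inv_mul _ hu, Matrix.vecMul_one]
  have h2 := congrFun h1 j
  simp only [Matrix.vecMul, dotProduct] at h2
  rw [← h2]
  simp [frameMatrix, Matrix.vecMul, dotProduct]

end Coordinates

section Coordinates

open Filter Topology

theorem differentiableAt_form_apply {η : E4 → E4 [⋀^Fin 2]→L[ℝ] ℝ} {X Y : E4 → E4} {x : E4}
    (hη : DifferentiableAt ℝ η x) (hX : DifferentiableAt ℝ X x) (hY : DifferentiableAt ℝ Y x) :
    DifferentiableAt ℝ (fun z => η z ![X z, Y z]) x := by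
  have e : (fun z => η z ![X z, Y z])
      = fun z => η z (fun i => (![X, Y] : Fin 2 → E4 → E4) i z) := by
    ext z
    congr 1
    ext i : 1
    fin_cases i <;> rfl
  rw [e]
  refine (hη.hasFDerivAt.continuousAlternatingMap_apply
    (g' := fun i => fderiv ℝ ((![X, Y] : Fin 2 → E4 → E4) i) x) fun i => ?_).differentiableAt
  fin_cases i
  · exact hX.hasFDerivAt
  · exact hY.hasFDerivAt

theorem det4_frame (c : Fin 4 → E4) : det4 (c 0) (c 1) (c 2) (c 3) = (frameMatrix c).det := by
  have e : ![c 0, c 1, c 2, c 3] = c := by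
    ext i : 1
    fin_cases i <;> rfl
  rw [det4, e]

theorem differentiableAt_det4 {X Y Z T : E4 → E4} {x : E4} (hX : DifferentiableAt ℝ X x)
    (hY : DifferentiableAt ℝ Y x) (hZ : DifferentiableAt ℝ Z x) (hT : DifferentiableAt ℝ T x) :
    DifferentiableAt ℝ (fun z => det4 (X z) (Y z) (Z z) (T z)) x := by
  have h := differentiableAt_det (b := ![X, Y, Z, T]) (x := x) (by
    intro i
    fin_cases i <;> assumption)
  simp only [← det4_frame] at h
  exact h

/-- The pointwise formula `hodgeStar_two`, turned into a statement about germs so that it can be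
differentiated. -/
theorem hodgeStar_local {β : E4 → E4 →L[ℝ] E4 →L[ℝ] ℝ} {b : Fin 4 → E4 → E4}
    {η : E4 → E4 [⋀^Fin 2]→L[ℝ] ℝ} {x : E4}
    (hb : ∀ᶠ z in 𝓝 x, IsNullFrame (β z) (fun i => b i z))
    (hbd : ∀ i, DifferentiableAt ℝ (b i) x) (hη : DifferentiableAt ℝ η x)
    (h1 : ∀ᶠ z in 𝓝 x, ∀ w, η z ![b 1 z, w] = 0) (h2 : ∀ᶠ z in 𝓝 x, ∀ w, η z ![b 2 z, w] = 0) :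
    ∃ H : E4 → E4 [⋀^Fin 2]→L[ℝ] ℝ,
      (fun z => hodgeStar (k := 2) (m := 2) rfl (bilinMatrix (β z)) (η z)) = H ∧
      DifferentiableAt ℝ H x ∧ (∀ᶠ z in 𝓝 x, ∀ w, H z ![b 0 z, w] = 0) ∧
      (∀ᶠ z in 𝓝 x, ∀ w, H z ![b 2 z, w] = 0) ∧
      ∃ ε : ℝ, ∀ᶠ z in 𝓝 x, H z ![b 1 z, b 3 z] = ε * η z ![b 0 z, b 3 z] := by
  obtain ⟨H, hH⟩ : ∃ H : E4 → E4 [⋀^Fin 2]→L[ℝ] ℝ,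
      (fun z => hodgeStar (k := 2) (m := 2) rfl (bilinMatrix (β z)) (η z)) = H := ⟨_, rfl⟩
  refine ⟨H, hH, ?_⟩
  set D : E4 → ℝ := fun z => (frameMatrix fun i => b i z).det with hD
  have hDd : DifferentiableAt ℝ D x := differentiableAt_det hbd
  have hD0 : D x ≠ 0 := hb.self_of_nhds.det_ne_zero
  have hHz : ∀ᶠ z in 𝓝 x, ∀ w, H z w
      = -(|D z|⁻¹ * η z ![b 0 z, b 3 z] * det4 (b 0 z) (b 2 z) (w 0) (w 1)) := by
    filter_upwards [hb, h1, h2] with z hz h1z h2z w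
    rw [← hH]
    exact hodgeStar_two hz h1z h2z w
  have hη0 : DifferentiableAt ℝ (fun z => η z ![b 0 z, b 3 z]) x :=
    differentiableAt_form_apply hη (hbd 0) (hbd 3)
  have hHd : DifferentiableAt ℝ H x := by
    refine differentiableAt_form fun w => ?_
    have hw : DifferentiableAt ℝ
        (fun z => -(|D z|⁻¹ * η z ![b 0 z, b 3 z] * det4 (b 0 z) (b 2 z) (w 0) (w 1))) x := by
      refine (((hDd.abs hD0).inv (abs_ne_zero.2 hD0)).mul hη0 |>.mul ?_).neg
      exact differentiableAt_det4 (hbd 0) (hbd 2) (differentiableAt_const _)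
        (differentiableAt_const _)
    exact hw.congr_of_eventuallyEq (hHz.mono fun z hz => hz w)
  have hH0 : ∀ᶠ z in 𝓝 x, ∀ w, H z ![b 0 z, w] = 0 := hHz.mono fun z hz w => by
    refine (hz _).trans ?_
    rw [det4_eq_zero (by simp), mul_zero, neg_zero]
  have hH2 : ∀ᶠ z in 𝓝 x, ∀ w, H z ![b 2 z, w] = 0 := hHz.mono fun z hz w => by
    refine (hz _).trans ?_
    rw [det4_eq_zero (by simp), mul_zero, neg_zero]
  refine ⟨hHd, hH0, hH2, ?_⟩
  have hε0 : ∃ ε : ℝ, ∀ᶠ z in 𝓝 x, H z ![b 1 z, b 3 z] = ε * η z ![b 0 z, b 3 z] := by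
    have hdet : ∀ z, det4 (b 0 z) (b 2 z) (b 1 z) (b 3 z) = -D z := by
      intro z
      rw [det4_swap, det4_frame fun i => b i z]
    -- The number ε is the sign of the frame determinant D, which is constant near x by continuity;
    -- as a constant it passes through derivatives.
    rcases lt_or_gt_of_ne hD0 with h0 | h0
    · refine ⟨-1, ?_⟩
      filter_upwards [hHz, hDd.continuousAt.eventually_lt_const h0] with z hz hDz
      rw [hz]
      have hne := hDz.ne
      simp only [Matrix.cons_val_zero, Matrix.cons_val_one, hdet, abs_of_neg hDz]
      field_simp
    · refine ⟨1, ?_⟩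
      filter_upwards [hHz, hDd.continuousAt.eventually_const_lt h0] with z hz hDz
      rw [hz]
      simp only [Matrix.cons_val_zero, Matrix.cons_val_one, hdet, abs_of_pos hDz]
      field_simp
  exact hε0

/-- The heart of the argument: because p is the same in both brackets, the equation satisfied by
η(s, n) along l is also the one satisfied by *η(a, n), and the latter is ε η(s, n). So d*η(a, l, n)
= ε dη(s, l, n) = 0. -/
theorem force_free_of_brackets {β : E4 → E4 →L[ℝ] E4 →L[ℝ] ℝ} {b : Fin 4 → E4 → E4}
    {η : E4 → E4 [⋀^Fin 2]→L[ℝ] ℝ} {x : E4}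
    (hb : ∀ᶠ z in 𝓝 x, IsNullFrame (β z) (fun i => b i z))
    (hbd : ∀ i, DifferentiableAt ℝ (b i) x) (hη : DifferentiableAt ℝ η x)
    (h1 : ∀ᶠ z in 𝓝 x, ∀ w, η z ![b 1 z, w] = 0) (h2 : ∀ᶠ z in 𝓝 x, ∀ w, η z ![b 2 z, w] = 0)
    (hd : extDeriv η x = 0) {p q t : ℝ}
    (hSL : lieBracket ℝ (b 0) (b 2) x = p • b 0 x + q • b 2 x)
    (hAL : lieBracket ℝ (b 1) (b 2) x = p • b 1 x + t • b 2 x) (v : E4) :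
    η x ![sharp (bilinMatrix (β x)) (hodgeStar (k := 3) (m := 1) rfl (bilinMatrix (β x))
      (extDeriv (fun z => hodgeStar (k := 2) (m := 2) rfl (bilinMatrix (β z)) (η z)) x)), v]
      = 0 := by
  obtain ⟨H, hH, hHd, hH0, hH2, ε, hε⟩ := hodgeStar_local hb hbd hη h1 h2
  have hη0 : DifferentiableAt ℝ (fun z => η z ![b 0 z, b 3 z]) x :=
    differentiableAt_form_apply hη (hbd 0) (hbd 3)
  rw [hH]
  -- The coefficient `c 3` is the n-component of [l, n]. It is the only component that matters in
  -- η([l, n], s), where a and l are killed, and also in *η([l, n], a), where s and l are killed;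
  -- hence the same constant in `k1` and `k2`.
  obtain ⟨c, hc⟩ := frame_span hb.self_of_nhds.det_ne_zero (lieBracket ℝ (b 2) (b 3) x)
  have h1x := h1.self_of_nhds
  have h2x := h2.self_of_nhds
  have hH0x := hH0.self_of_nhds
  have hH2x := hH2.self_of_nhds
  have k1 := extDeriv_of_invariant hη (hbd 0) (hbd 2) (hbd 3) h2 hSL (c := c 3) (by
    rw [hc]
    simp only [Fin.sum_univ_four, form_add_left, form_smul_left, h1x, h2x, form_self]
    ring)
  have k2 := extDeriv_of_invariant hHd (hbd 1) (hbd 2) (hbd 3) hH2 hAL (c := c 3) (by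
    rw [hc]
    simp only [Fin.sum_univ_four, form_add_left, form_smul_left, hH0x, hH2x, form_self]
    ring)
  refine sharp_mem_ker hb.self_of_nhds h1x h2x ?_ ?_ v
  · have z1 : (fun z => H z ![b 1 z, b 2 z]) =ᶠ[𝓝 x] fun _ => 0 :=
      hH2.mono fun z hz => (form_swap _ _ _).trans (by rw [hz, neg_zero])
    have z2 : (fun z => H z ![b 0 z, b 2 z]) =ᶠ[𝓝 x] fun _ => 0 := hH0.mono fun z hz => hz _
    have z3 : (fun z => H z ![b 0 z, b 1 z]) =ᶠ[𝓝 x] fun _ => 0 := hH0.mono fun z hz => hz _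
    rw [extDeriv_two_apply hHd (hbd 0) (hbd 1) (hbd 2), z1.fderiv_eq, z2.fderiv_eq, z3.fderiv_eq,
      hSL, hAL, form_swap _ (lieBracket ℝ (b 0) (b 1) x), form_swap _ (_ + _) (b 0 x)]
    simp only [form_add_left, form_smul_left, hH0x, hH2x]
    simp
  · rw [k2, hε.self_of_nhds, (show (fun z => H z ![b 1 z, b 3 z]) =ᶠ[𝓝 x] _ from hε).fderiv_eq,
      fderiv_const_mul hη0]
    rw [hd] at k1
    simp only [ContinuousAlternatingMap.coe_zero, Pi.zero_apply] at k1
    simp only [smul_apply, smul_eq_mul]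
    linear_combination -ε * k1

end Coordinates

/-! ### Smoothness of superposition operators -/

section Nemytskii

open Filter Topology

universe u

variable {K : Type*} [TopologicalSpace K] [CompactSpace K]
  {V F : Type u} [NormedAddCommGroup V] [NormedSpace ℝ V] [NormedAddCommGroup F] [NormedSpace ℝ F]

/-- Pointwise application of a continuous family of linear maps. -/
def pointwiseApply (K V F : Type*) [TopologicalSpace K] [CompactSpace K] [NormedAddCommGroup V]
    [NormedSpace ℝ V] [NormedAddCommGroup F] [NormedSpace ℝ F] :
    C(K, V →L[ℝ] F) →L[ℝ] C(K, V) →L[ℝ] C(K, F) :=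
  LinearMap.mkContinuous₂
    (LinearMap.mk₂ ℝ (fun (A : C(K, V →L[ℝ] F)) (h : C(K, V)) =>
      (⟨fun t => A t (h t), by fun_prop⟩ : C(K, F)))
      (fun _ _ _ => by ext; simp) (fun _ _ _ => by ext; simp) (fun _ _ _ => by ext; simp)
      (fun _ _ _ => by ext; simp)) 1 (fun A h => by
        rw [one_mul]
        refine (ContinuousMap.norm_le _ (by positivity)).2 fun t => ?_
        exact (A t).le_of_opNorm_le_of_le (A.norm_coe_le_norm t) (h.norm_coe_le_norm t))

@[simp]
theorem pointwiseApply_apply (A : C(K, V →L[ℝ] F)) (h : C(K, V)) (t : K) :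
    pointwiseApply K V F A h t = A t (h t) := rfl

/-- The derivative f' is uniformly continuous near the compact range of γ, so the mean value
inequality bounds the remainder by ε‖h t‖ simultaneously for all t. -/
theorem hasFDerivAt_comp_continuousMap (f : C(V, F)) (f' : C(V, V →L[ℝ] F))
    (hf : ∀ y, HasFDerivAt f (f' y) y) (γ : C(K, V)) :
    HasFDerivAt (fun γ : C(K, V) => f.comp γ) (pointwiseApply K V F (f'.comp γ)) γ := by
  rw [hasFDerivAt_iff_isLittleO_nhds_zero, Asymptotics.isLittleO_iff]
  intro ε hε
  have hc : IsCompact (range γ) := isCompact_range γ.continuous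
  have hu := hc.uniformContinuousAt_of_continuousAt f' (fun a _ => f'.continuous.continuousAt)
    (Metric.dist_mem_uniformity hε)
  obtain ⟨δ, hδ, hball⟩ := Metric.mem_uniformity_dist.1 hu
  filter_upwards [Metric.ball_mem_nhds (0 : C(K, V)) hδ] with h hh
  have hhδ : ‖h‖ < δ := by simpa using hh
  refine (ContinuousMap.norm_le _ (by positivity)).2 fun t => ?_
  have hht : ‖h t‖ < δ := (h.norm_coe_le_norm t).trans_lt hhδ
  have key : ‖f (γ t + h t) - f (γ t) - f' (γ t) (γ t + h t - γ t)‖ ≤ ε * ‖γ t + h t - γ t‖ :=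
    (convex_ball (γ t) δ).norm_image_sub_le_of_norm_hasFDerivWithin_le' (f' := f')
    (fun y _ => (hf y).hasFDerivWithinAt) (fun y hy => by
      have := hball (a := γ t) (b := y) (by rwa [dist_comm, ← Metric.mem_ball]) ⟨t, rfl⟩
      rw [← dist_eq_norm, dist_comm]
      exact (show dist (f' (γ t)) (f' y) < ε from this).le) (Metric.mem_ball_self hδ)
    (by simpa using hht)
  rw [add_sub_cancel_left] at key
  exact key.trans (by gcongr; exact h.norm_coe_le_norm t)

/-- Induction on n: the derivative is the superposition operator of f' followed by a continuous
linear map. The target of f' is a space of linear maps, so F must vary in the induction, and V and F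
share a universe for this. -/
theorem contDiff_comp_continuousMap (n : ℕ) :
    ∀ {F : Type u} [NormedAddCommGroup F] [NormedSpace ℝ F] (f : C(V, F)), ContDiff ℝ ∞ f →
      ContDiff ℝ n (fun γ : C(K, V) => f.comp γ) := by
  induction n with
  | zero =>
    intro F _ _ f _
    exact contDiff_zero.2 f.continuous_postcomp
  | succ n ih =>
    intro F _ _ f hf
    have hf' : ContDiff ℝ ∞ (fderiv ℝ f) := hf.fderiv_right (by simp)
    let f' : C(V, V →L[ℝ] F) := ⟨fderiv ℝ f, hf'.continuous⟩
    have h0 : ContDiff ℝ n (fun γ : C(K, V) => f'.comp γ) := ih f' hf'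
    have h1 : ContDiff ℝ n (fun A : C(K, V →L[ℝ] F) => pointwiseApply K V F A) :=
      ContinuousLinearMap.contDiff _
    refine contDiff_succ_iff_hasFDerivAt.2 ⟨_, h1.comp h0, fun γ => ?_⟩
    exact hasFDerivAt_comp_continuousMap f _
      (fun y => (hf.differentiable (by simp) y).hasFDerivAt) γ

end Nemytskii

/-! ### Solutions of total differential equations -/

section Frobenius

open Filter Topology unitInterval

variable {E Z : Type} [NormedAddCommGroup E] [NormedSpace ℝ E] [NormedAddCommGroup Z]
  [NormedSpace ℝ Z]

/-- The primitive vanishing at `0` of a continuous curve. -/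
def primitive [CompleteSpace Z] : C(I, Z) →L[ℝ] C(I, Z) :=
  LinearMap.mkContinuous
    { toFun := fun γ => ⟨fun t => ∫ τ in (0 : ℝ)..t, IccExtend zero_le_one γ τ,
        (intervalIntegral.continuous_primitive
          (fun a b => (γ.continuous.Icc_extend' (h := zero_le_one)).intervalIntegrable a b) 0).comp
          continuous_subtype_val⟩
      map_add' := fun γ δ => by
        ext t
        exact intervalIntegral.integral_add
          ((γ.continuous.Icc_extend' (h := zero_le_one)).intervalIntegrable _ _)
          ((δ.continuous.Icc_extend' (h := zero_le_one)).intervalIntegrable _ _)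
      map_smul' := fun c γ => by
        ext t
        exact intervalIntegral.integral_smul c _ } 1 (fun γ => by
      refine (ContinuousMap.norm_le _ (by positivity)).2 fun t => ?_
      have h := intervalIntegral.norm_integral_le_of_norm_le_const (a := (0 : ℝ)) (b := t)
        (f := IccExtend zero_le_one γ) (C := ‖γ‖) (fun τ _ => γ.norm_coe_le_norm _)
      refine h.trans ?_
      rw [sub_zero, abs_of_nonneg t.2.1, one_mul]
      exact mul_le_of_le_one_right (norm_nonneg _) t.2.2)

theorem hasDerivAt_primitive [CompleteSpace Z] (γ : C(I, Z)) (t : ℝ) :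
    HasDerivAt (fun t : ℝ => ∫ τ in (0 : ℝ)..t, IccExtend zero_le_one γ τ)
      (IccExtend zero_le_one γ t) t :=
  intervalIntegral.integral_hasDerivAt_right
    ((γ.continuous.Icc_extend' (h := zero_le_one)).intervalIntegrable _ _)
    ((γ.continuous.Icc_extend' (h := zero_le_one)).stronglyMeasurableAtFilter _ _)
    (γ.continuous.Icc_extend' (h := zero_le_one)).continuousAt

/-- The curve `t ↦ (t x, γ t, x)`. -/
def rayCurve (E Z : Type) [NormedAddCommGroup E] [NormedSpace ℝ E] [NormedAddCommGroup Z]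
    [NormedSpace ℝ Z] : E × C(I, Z) →L[ℝ] C(I, (E × Z) × E) :=
  LinearMap.mkContinuous
    { toFun := fun p => ⟨fun t => (((t : ℝ) • p.1, p.2 t), p.1), by fun_prop⟩
      map_add' := fun p q => by
        ext t <;> simp
      map_smul' := fun c p => by
        exact ContinuousMap.ext fun t =>
          Prod.ext (Prod.ext (smul_comm (t : ℝ) c p.1) rfl) rfl } 1 (fun p => by
      refine (ContinuousMap.norm_le _ (by positivity)).2 fun t => ?_
      rw [one_mul]
      refine norm_prod_le_iff.2 ⟨norm_prod_le_iff.2 ⟨?_, ?_⟩, norm_fst_le p⟩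
      · refine (norm_smul_le _ _).trans ((mul_le_of_le_one_left (norm_nonneg _) ?_).trans
          (norm_fst_le p))
        rw [Real.norm_of_nonneg t.2.1]
        exact t.2.2
      · exact (p.2.norm_coe_le_norm t).trans (norm_snd_le p))

@[simp]
theorem rayCurve_apply (p : E × C(I, Z)) (t : I) :
    rayCurve E Z p t = (((t : ℝ) • p.1, p.2 t), p.1) := rfl

/-- The constant curve. -/
def constCurve (Z : Type) [NormedAddCommGroup Z] [NormedSpace ℝ Z] : Z →L[ℝ] C(I, Z) :=
  LinearMap.mkContinuous
    { toFun := fun z => ContinuousMap.const I z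
      map_add' := fun _ _ => rfl
      map_smul' := fun _ _ => rfl } 1 (fun z => by
      rw [one_mul]
      exact (ContinuousMap.norm_le _ (norm_nonneg _)).2 fun t => le_rfl)

/-- The defect of `γ` as a solution of `γ(t) = z + ∫₀ᵗ B(τ x, γ(τ)) x dτ`. -/
def rayDefect [CompleteSpace Z] (f : C((E × Z) × E, Z)) (p : (E × Z) × C(I, Z)) : C(I, Z) :=
  p.2 - constCurve Z p.1.2 - primitive (f.comp (rayCurve E Z (p.1.1, p.2)))

theorem contDiff_rayDefect [CompleteSpace Z] {f : C((E × Z) × E, Z)} (hf : ContDiff ℝ ∞ f) :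
    ContDiff ℝ ∞ (rayDefect f) := by
  refine contDiff_infty.2 fun n => ?_
  have h1 : ContDiff ℝ n (fun p : (E × Z) × C(I, Z) => rayCurve E Z (p.1.1, p.2)) :=
    (rayCurve E Z).contDiff.comp (by fun_prop)
  have h2 := (primitive (Z := Z)).contDiff.comp ((contDiff_comp_continuousMap n f hf).comp h1)
  have h3 : ContDiff ℝ n (fun p : (E × Z) × C(I, Z) => constCurve Z p.1.2) :=
    (constCurve Z).contDiff.comp (by fun_prop)
  exact (contDiff_snd.sub h3).sub h2

theorem hasFDerivAt_rayDefect [CompleteSpace Z] {f : C((E × Z) × E, Z)}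
    (f' : C((E × Z) × E, (E × Z) × E →L[ℝ] Z)) (hf' : ∀ y, HasFDerivAt f (f' y) y)
    (p : (E × Z) × C(I, Z)) :
    ∃ D : (E × Z) × C(I, Z) →L[ℝ] C(I, Z), HasFDerivAt (rayDefect f) D p ∧
      ∀ v, D v = v.2 - constCurve Z v.1.2 - primitive (pointwiseApply I _ _
        (f'.comp (rayCurve E Z (p.1.1, p.2))) (rayCurve E Z (v.1.1, v.2))) := by
  let P : (E × Z) × C(I, Z) →L[ℝ] C(I, (E × Z) × E) := (rayCurve E Z).comp
    (((ContinuousLinearMap.fst ℝ E Z).comp (ContinuousLinearMap.fst ℝ (E × Z) C(I, Z))).prod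
      (ContinuousLinearMap.snd ℝ (E × Z) C(I, Z)))
  let Cc : (E × Z) × C(I, Z) →L[ℝ] C(I, Z) := (constCurve Z).comp
    ((ContinuousLinearMap.snd ℝ E Z).comp (ContinuousLinearMap.fst ℝ (E × Z) C(I, Z)))
  have h1 := (hasFDerivAt_comp_continuousMap f f' hf' (P p)).comp p P.hasFDerivAt
  have h2 := (primitive (Z := Z)).hasFDerivAt.comp p h1
  exact ⟨_, ((ContinuousLinearMap.snd ℝ (E × Z) C(I, Z)).hasFDerivAt.sub Cc.hasFDerivAt).sub h2,
    fun v => rfl⟩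

theorem continuous_norm_mul {P Q : Type*} [NormedAddCommGroup P] [NormedSpace ℝ P]
    [NormedAddCommGroup Q] [NormedSpace ℝ Q] {T : P → P →L[ℝ] Q} (hT : Continuous T) (c : ℝ) :
    Continuous fun q => ‖T q‖ * c :=
  hT.norm.mul continuous_const

/-- Here Δ is the variation of the curve G when x moves in the direction v. Integrability makes the
inhomogeneous terms cancel in the derivative of W(t) = Δ(t) - t B(t x, G t) v, leaving W' = B'(0, W)
x. As W(0) = 0 and the coefficient is bounded on [0, 1], a Gronwall estimate gives W = 0. -/
theorem eq_of_linear_variation {G Δ : ℝ → Z} {B : E × Z → E →L[ℝ] Z}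
    {B' : E × Z → E × Z →L[ℝ] E →L[ℝ] Z} (hB : ∀ p, HasFDerivAt B (B' p) p) (hB' : Continuous B')
    {x v : E} (hG : ∀ t ∈ Icc (0 : ℝ) 1, HasDerivAt G (B (t • x, G t) x) t)
    (hint : ∀ t ∈ Icc (0 : ℝ) 1,
      B' (t • x, G t) (x, B (t • x, G t) x) v = B' (t • x, G t) (v, B (t • x, G t) v) x)
    (hΔ : ∀ t ∈ Icc (0 : ℝ) 1,
      HasDerivAt Δ (B' (t • x, G t) (t • v, Δ t) x + B (t • x, G t) v) t) (hΔ0 : Δ 0 = 0) :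
    Δ 1 = B (x, G 1) v := by
  have hq : ∀ t ∈ Icc (0 : ℝ) 1, HasDerivAt (fun t : ℝ => (t • x, G t))
      (x, B (t • x, G t) x) t := fun t ht => by
    have := ((hasDerivAt_id t).smul_const x).prodMk (hG t ht)
    simpa using this
  have hBq : ∀ t ∈ Icc (0 : ℝ) 1, HasDerivAt (fun t : ℝ => B (t • x, G t) v)
      (B' (t • x, G t) (x, B (t • x, G t) x) v) t := fun t ht =>
    ((hB _).comp_hasDerivAt t (hq t ht)).clm_apply (hasDerivAt_const t v) |>.congr_deriv (by simp)
  have hW : ∀ t ∈ Icc (0 : ℝ) 1, HasDerivAt (fun t : ℝ => Δ t - t • B (t • x, G t) v)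
      (B' (t • x, G t) (0, Δ t - t • B (t • x, G t) v) x) t := fun t ht => by
    refine ((hΔ t ht).sub ((hasDerivAt_id t).smul (hBq t ht))).congr_deriv ?_
    have e : ((0 : E), Δ t - t • B (t • x, G t) v)
        = (t • v, Δ t) - t • (v, B (t • x, G t) v) := by
      ext <;> simp
    rw [e, map_sub, map_smul, sub_apply, smul_apply, ← hint t ht]
    simp only [id_eq, one_smul]
    abel
  have hcont : ContinuousOn (fun t : ℝ => ‖B' (t • x, G t)‖ * ‖x‖) (Icc 0 1) := fun t ht => by
    have h : Continuous (fun q : E × Z => ‖B' q‖ * ‖x‖) :=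
      continuous_norm_mul (P := E × Z) (Q := E →L[ℝ] Z) hB' ‖x‖
    exact (ContinuousAt.comp (g := fun q : E × Z => ‖B' q‖ * ‖x‖) h.continuousAt
      (hq t ht).continuousAt).continuousWithinAt
  obtain ⟨C, hC⟩ := isCompact_Icc.bddAbove_image hcont
  have := eq_zero_of_abs_deriv_le_mul_abs_self_of_eq_zero_right (a := (0 : ℝ)) (b := 1) (K := C)
    (f := fun t : ℝ => Δ t - t • B (t • x, G t) v)
    (fun t ht => (hW t ht).continuousAt.continuousWithinAt)
    (fun t ht => (hW t ⟨ht.1, ht.2.le⟩).hasDerivWithinAt) (by simp [hΔ0]) (fun t ht => by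
      have ht' : t ∈ Icc (0 : ℝ) 1 := ⟨ht.1, ht.2.le⟩
      have h1 : ‖B' (t • x, G t)‖ * ‖x‖ ≤ C := hC ⟨t, ht', rfl⟩
      set w := Δ t - t • B (t • x, G t) v
      calc _ ≤ ‖B' (t • x, G t) (0, w)‖ * ‖x‖ := ContinuousLinearMap.le_opNorm _ _
        _ ≤ ‖B' (t • x, G t)‖ * ‖((0 : E), w)‖ * ‖x‖ := by
          gcongr
          exact ContinuousLinearMap.le_opNorm _ _
        _ = (‖B' (t • x, G t)‖ * ‖x‖) * ‖w‖ := by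
          rw [Prod.norm_mk, norm_zero, max_eq_right (norm_nonneg _)]
          ring
        _ ≤ C * ‖w‖ := by gcongr) 1 (by simp)
  simpa [sub_eq_zero] using this

/-- For order ∞, smoothness at a point does not spread to a neighbourhood, since the neighbourhood
may shrink with the order. The implicit function theorem is therefore applied afresh at each nearby
point of the graph, and local uniqueness identifies the new implicit function with the old one. -/
theorem eventually_contDiffAt_implicitFunction {E₁ E₂ F : Type*} [NormedAddCommGroup E₁]
    [NormedSpace ℝ E₁] [CompleteSpace E₁] [NormedAddCommGroup E₂] [NormedSpace ℝ E₂]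
    [CompleteSpace E₂] [NormedAddCommGroup F] [NormedSpace ℝ F] [CompleteSpace F]
    {f : E₁ × E₂ → F} {u : E₁ × E₂} (hf : ContDiff ℝ ∞ f) (hne : (∞ : WithTop ℕ∞) ≠ 0)
    (hinv : (fderiv ℝ f u ∘L .inr ℝ E₁ E₂).IsInvertible) :
    ∀ᶠ p in 𝓝 u.1, ContDiffAt ℝ ∞ (hf.contDiffAt.implicitFunction hne hinv) p := by
  set ψ := hf.contDiffAt.implicitFunction hne hinv with hψ
  have hψs : ContDiffAt ℝ ∞ ψ u.1 := hf.contDiffAt.contDiffAt_implicitFunction hne hinv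
  have hψ0 : ψ u.1 = u.2 := hf.contDiffAt.implicitFunction_apply_self hne hinv
  have huniq : ∀ᶠ q in 𝓝 u, f q = f u ↔ ψ q.1 = q.2 :=
    hf.contDiffAt.eventually_apply_eq_iff_implicitFunction hne hinv
  have hinv' : ∀ᶠ q in 𝓝 u, (fderiv ℝ f q ∘L .inr ℝ E₁ E₂).IsInvertible := by
    have hc : Continuous fun q => fderiv ℝ f q ∘L .inr ℝ E₁ E₂ :=
      (hf.continuous_fderiv hne).clm_comp continuous_const
    obtain ⟨T, hT⟩ := hinv
    have h1 : ∀ᶠ D in 𝓝 (fderiv ℝ f u ∘L .inr ℝ E₁ E₂), ContinuousLinearMap.IsInvertible D := by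
      rw [← hT]
      exact ContinuousLinearEquiv.nhds T
    exact hc.continuousAt.eventually h1
  have htend : Tendsto (fun p => (p, ψ p)) (𝓝 u.1) (𝓝 u) := by
    have : Tendsto (fun p => (p, ψ p)) (𝓝 u.1) (𝓝 (u.1, ψ u.1)) :=
      continuousAt_id.prodMk hψs.continuousAt
    rwa [hψ0] at this
  filter_upwards [htend.eventually hinv', htend.eventually huniq.eventually_nhds] with p h1 h2
  have hq : f (p, ψ p) = f u := h2.self_of_nhds.2 rfl
  set θ := (hf.contDiffAt (x := (p, ψ p))).implicitFunction hne h1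
  have hθ : ContDiffAt ℝ ∞ θ p := (hf.contDiffAt (x := (p, ψ p))).contDiffAt_implicitFunction hne h1
  have hθ0 : θ p = ψ p := (hf.contDiffAt (x := (p, ψ p))).implicitFunction_apply_self hne h1
  have hθe : ∀ᶠ p' in 𝓝 p, f (p', θ p') = f (p, ψ p) :=
    (hf.contDiffAt (x := (p, ψ p))).eventually_apply_implicitFunction hne h1
  have htend' : Tendsto (fun p' => (p', θ p')) (𝓝 p) (𝓝 (p, ψ p)) := by
    have : Tendsto (fun p' => (p', θ p')) (𝓝 p) (𝓝 (p, θ p)) :=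
      continuousAt_id.prodMk hθ.continuousAt
    rwa [hθ0] at this
  refine hθ.congr_of_eventuallyEq ?_
  filter_upwards [hθe, htend'.eventually h2] with p' h3 h4
  exact h4.1 (h3.trans hq)

/-- Let γ solve γ' = B(t x, γ) x with γ(0) = z, and put Y(x, z) = γ(1). The zeros of `rayDefect` are
these curves, so the implicit function theorem in C([0, 1], Z) yields γ as a smooth function of (x,
z). Differentiating in x gives the linear variation equation, and `eq_of_linear_variation` evaluates
its solution at t = 1. -/
theorem exists_solution_of_integrable [CompleteSpace E] [CompleteSpace Z] {B : E × Z → E →L[ℝ] Z}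
    (hB : ContDiff ℝ ∞ B) (hint : ∀ᶠ p in 𝓝 (0 : E × Z), ∀ v w : E,
      fderiv ℝ B p (v, B p v) w = fderiv ℝ B p (w, B p w) v) :
    ∃ Y : E × Z → Z, (∀ᶠ p in 𝓝 (0 : E × Z), ContDiffAt ℝ ∞ Y p) ∧
      (∀ᶠ z in 𝓝 (0 : Z), Y (0, z) = z) ∧
      ∀ᶠ p in 𝓝 (0 : E × Z), ∀ v, fderiv ℝ Y p (v, 0) = B (p.1, Y p) v := by
  have hBd : ∀ p, HasFDerivAt B (fderiv ℝ B p) p := fun p =>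
    (hB.differentiable (by simp) p).hasFDerivAt
  have hB'c : Continuous (fderiv ℝ B) := hB.continuous_fderiv (by simp)
  have hfs : ContDiff ℝ ∞ (fun q : (E × Z) × E => B q.1 q.2) := by fun_prop
  let f : C((E × Z) × E, Z) := ⟨fun q => B q.1 q.2, hfs.continuous⟩
  let f' : C((E × Z) × E, (E × Z) × E →L[ℝ] Z) :=
    ⟨fderiv ℝ (fun q : (E × Z) × E => B q.1 q.2), hfs.continuous_fderiv (by simp)⟩
  have hf' : ∀ q, HasFDerivAt f (f' q) q := fun q => (hfs.differentiable (by simp) q).hasFDerivAt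
  have hf'_apply : ∀ q u : (E × Z) × E, f' q u = fderiv ℝ B q.1 u.1 q.2 + B q.1 u.2 := by
    intro q u
    have h1 : HasFDerivAt (fun q : (E × Z) × E => B q.1)
        ((fderiv ℝ B q.1).comp (ContinuousLinearMap.fst ℝ (E × Z) E)) q :=
      (hBd q.1).comp q hasFDerivAt_fst
    have h2 := h1.clm_apply (hasFDerivAt_snd (𝕜 := ℝ) (p := q))
    rw [(hf' q).unique h2]
    simp [add_comm]
  have hH : ContDiffAt ℝ ∞ (rayDefect f) (0 : (E × Z) × C(I, Z)) :=
    (contDiff_rayDefect (f := f) hfs).contDiffAt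
  obtain ⟨D, hD, hDv⟩ := hasFDerivAt_rayDefect f' hf' (0 : (E × Z) × C(I, Z))
  -- At x = 0 the integrand B(0, γ) 0 vanishes for every γ, so the partial derivative of the defect
  -- in γ is the identity.
  have hinv : (fderiv ℝ (rayDefect f) (0 : (E × Z) × C(I, Z)) ∘L
      ContinuousLinearMap.inr ℝ (E × Z) C(I, Z)).IsInvertible := by
    have e : fderiv ℝ (rayDefect f) (0 : (E × Z) × C(I, Z)) ∘L
        ContinuousLinearMap.inr ℝ (E × Z) C(I, Z) = ContinuousLinearMap.id ℝ _ := by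
      rw [hD.fderiv]
      refine ContinuousLinearMap.ext fun δ => ?_
      have h0 : pointwiseApply I _ _ (f'.comp (rayCurve E Z ((0 : E), (0 : C(I, Z)))))
          (rayCurve E Z ((0 : E), δ)) = 0 := by
        ext t
        rw [pointwiseApply_apply, ContinuousMap.comp_apply, hf'_apply]
        simp
      refine (hDv _).trans ?_
      have h1 : primitive (Z := Z) (pointwiseApply I _ _ (f'.comp (rayCurve E Z
        ((0 : E), (0 : C(I, Z))))) (rayCurve E Z ((0 : E), δ))) = 0 := by rw [h0, map_zero]
      refine (congrArg₂ (· - ·) (congrArg (δ - ·) ((constCurve Z).map_zero)) h1).trans ?_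
      simp
    rw [e]
    exact ⟨ContinuousLinearEquiv.refl ℝ _, rfl⟩
  have hne : (∞ : WithTop ℕ∞) ≠ 0 := by simp
  set ψ := hH.implicitFunction hne hinv with hψ
  have hψs : ContDiffAt ℝ ∞ ψ (0 : E × Z) := hH.contDiffAt_implicitFunction hne hinv
  have hψ0 : ψ 0 = 0 := hH.implicitFunction_apply_self hne hinv
  have hf0 : ∀ γ : C(I, Z), f.comp (rayCurve E Z ((0 : E), γ)) = 0 := fun γ => by
    ext t
    simp [f]
  have hzero : rayDefect f (0 : (E × Z) × C(I, Z)) = 0 := by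
    have h1 : (0 : C(I, Z)) - constCurve Z 0 - primitive (f.comp (rayCurve E Z ((0 : E), 0)))
        = 0 := by
      rw [hf0, map_zero, map_zero, sub_zero, sub_zero]
    exact h1
  have hψe : ∀ᶠ p in 𝓝 (0 : E × Z), rayDefect f (p, ψ p) = 0 := by
    have := hH.eventually_apply_implicitFunction hne hinv
    rw [hzero] at this
    exact this
  let ev : C(I, Z) →L[ℝ] Z := ContinuousMap.evalCLM ℝ (1 : I)
  have hψs' : ∀ᶠ p in 𝓝 (0 : E × Z), ContDiffAt ℝ ∞ ψ p :=
    eventually_contDiffAt_implicitFunction (u := (0 : (E × Z) × C(I, Z)))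
      (contDiff_rayDefect (f := f) hfs) hne hinv
  refine ⟨fun p => ψ p 1, hψs'.mono fun p hp => ev.contDiff.contDiffAt.comp _ hp, ?_, ?_⟩
  · have hc : Tendsto (fun z : Z => ((0 : E), z)) (𝓝 0) (𝓝 (0 : E × Z)) := by
      have : Continuous (fun z : Z => ((0 : E), z)) := by fun_prop
      exact this.tendsto 0
    filter_upwards [hc.eventually hψe] with z hz
    have h1 : ψ (0, z) - constCurve Z z
        - primitive (f.comp (rayCurve E Z ((0 : E), ψ (0, z)))) = 0 := hz
    rw [hf0, map_zero, sub_zero, sub_eq_zero] at h1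
    rw [h1]
    rfl
  · obtain ⟨ε, hε, hball⟩ := Metric.eventually_nhds_iff_ball.1 hint
    -- This keeps the whole curve t ↦ (t x, γ t) inside the ball where integrability is available.
    have hsmall : ∀ᶠ p in 𝓝 (0 : E × Z), ‖ψ p‖ < ε :=
      Tendsto.eventually_lt_const (by simpa [hψ0] using hε) hψs.continuousAt.norm
    have hdiff : ∀ᶠ p in 𝓝 (0 : E × Z), DifferentiableAt ℝ ψ p :=
      hψs'.mono fun p hp => hp.differentiableAt hne
    filter_upwards [hψe.eventually_nhds, hsmall, hdiff, Metric.ball_mem_nhds (0 : E × Z) hε]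
      with p hp hps hpd hpε v
    obtain ⟨x, z⟩ := p
    have hx : ‖x‖ < ε := (norm_fst_le (x, z)).trans_lt (by simpa using hpε)
    set γ := ψ (x, z) with hγ
    set δ := fderiv ℝ ψ (x, z) (v, 0) with hδ
    obtain ⟨D', hD', hD'v⟩ := hasFDerivAt_rayDefect f' hf' ((x, z), γ)
    -- Differentiating the identity rayDefect(p, ψ p) = 0 in the direction (v, 0) gives the
    -- integrated variation equation.
    have hδeq : δ = primitive (pointwiseApply I _ _ (f'.comp (rayCurve E Z (x, γ)))
        (rayCurve E Z (v, δ))) := by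
      have h1 : HasFDerivAt (fun p => rayDefect f (p, ψ p))
          (D'.comp ((ContinuousLinearMap.id ℝ _).prod (fderiv ℝ ψ (x, z)))) (x, z) :=
        HasFDerivAt.comp (g := rayDefect f) (x, z) hD'
          ((hasFDerivAt_id (𝕜 := ℝ) (x, z)).prodMk hpd.hasFDerivAt)
      have h2 : HasFDerivAt (fun p => rayDefect f (p, ψ p)) 0 (x, z) :=
        (hasFDerivAt_const (𝕜 := ℝ) (0 : C(I, Z)) (x, z)).congr_of_eventuallyEq hp
      have h3 : D' ((v, 0), δ) = 0 := 
        congrArg (fun T : E × Z →L[ℝ] C(I, Z) => T (v, 0)) (h1.unique h2)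
      have h4 : δ - constCurve Z 0 - primitive (pointwiseApply I _ _
          (f'.comp (rayCurve E Z (x, γ))) (rayCurve E Z (v, δ))) = 0 := (hD'v _).symm.trans h3
      rw [map_zero, sub_zero] at h4
      exact sub_eq_zero.1 h4
    have hγeq : γ = constCurve Z z + primitive (f.comp (rayCurve E Z (x, γ))) := by
      have h1 : γ - constCurve Z z - primitive (f.comp (rayCurve E Z (x, γ))) = 0 :=
        hp.self_of_nhds
      rw [sub_sub, sub_eq_zero] at h1
      exact h1
    let G : ℝ → Z := fun t => z + ∫ τ in (0 : ℝ)..t,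
      IccExtend zero_le_one (f.comp (rayCurve E Z (x, γ))) τ
    let Δ : ℝ → Z := fun t => ∫ τ in (0 : ℝ)..t, IccExtend zero_le_one
      (pointwiseApply I _ _ (f'.comp (rayCurve E Z (x, γ))) (rayCurve E Z (v, δ))) τ
    have hGγ : ∀ t (ht : t ∈ Icc (0 : ℝ) 1), γ ⟨t, ht⟩ = G t := fun t ht =>
      congrArg (fun c : C(I, Z) => c ⟨t, ht⟩) hγeq
    have hΔδ : ∀ t (ht : t ∈ Icc (0 : ℝ) 1), δ ⟨t, ht⟩ = Δ t := fun t ht =>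
      congrArg (fun c : C(I, Z) => c ⟨t, ht⟩) hδeq
    have key := eq_of_linear_variation (G := G) (Δ := Δ) hBd hB'c (x := x) (v := v)
      (fun t ht => by
        refine ((hasDerivAt_primitive _ t).const_add z).congr_deriv ?_
        rw [IccExtend_of_mem _ _ ht, ← hGγ t ht]
        rfl)
      (fun t ht => by
        refine hball _ ?_ x v
        rw [mem_ball_zero_iff, Prod.norm_def, max_lt_iff, ← hGγ t ht]
        refine ⟨?_, (γ.norm_coe_le_norm _).trans_lt hps⟩
        refine (norm_smul_le t x).trans_lt (lt_of_le_of_lt ?_ hx)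
        refine mul_le_of_le_one_left (norm_nonneg _) ?_
        rw [Real.norm_of_nonneg ht.1]
        exact ht.2)
      (fun t ht => by
        refine (hasDerivAt_primitive _ t).congr_deriv ?_
        rw [IccExtend_of_mem _ _ ht, ← hGγ t ht, ← hΔδ t ht]
        exact hf'_apply _ _)
      (intervalIntegral.integral_same)
    have hY : fderiv ℝ (fun p => ψ p 1) (x, z) (v, 0) = δ 1 := by
      have := (ev.hasFDerivAt.comp (x, z) hpd.hasFDerivAt).fderiv
      exact congrArg (fun T : E × Z →L[ℝ] Z => T (v, 0)) this
    rw [hY]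
    have h1 : (1 : ℝ) ∈ Icc (0 : ℝ) 1 := by simp
    exact (hΔδ 1 h1).trans (key.trans (by rw [← hGγ 1 h1]; rfl))

end Frobenius

/-! ### Flattening an involutive plane field -/

section Flattening

open Filter Topology

/-- A cut-off makes a germ global: the superposition operators above require B on the whole space,
while the plane field is a graph only near the origin. -/
theorem exists_contDiff_eventuallyEq {V F : Type*} [NormedAddCommGroup V] [NormedSpace ℝ V]
    [FiniteDimensional ℝ V] [NormedAddCommGroup F] [NormedSpace ℝ F] {f : V → F} {x : V}
    (hf : ∀ᶠ p in 𝓝 x, ContDiffAt ℝ ∞ f p) :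
    ∃ h : V → F, ContDiff ℝ ∞ h ∧ h =ᶠ[𝓝 x] f := by
  obtain ⟨r, hr, hball⟩ := Metric.eventually_nhds_iff_ball.1 hf
  let χ : ContDiffBump x := ⟨r / 3, r / 2, by positivity, by linarith⟩
  refine ⟨fun p => χ p • f p, contDiff_iff_contDiffAt.2 fun p => ?_, ?_⟩
  · by_cases hp : p ∈ Metric.ball x r
    · exact χ.contDiff.contDiffAt.smul (hball p hp)
    · have h0 : (fun p => χ p • f p) =ᶠ[𝓝 p] fun _ => 0 := by
        have : p ∈ (Metric.closedBall x (r / 2))ᶜ := by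
          simp only [Metric.mem_ball, not_lt] at hp
          simp only [mem_compl_iff, Metric.mem_closedBall, not_le]
          linarith
        filter_upwards [Metric.isClosed_closedBall.isOpen_compl.mem_nhds this] with q hq
        rw [χ.zero_of_le_dist (by simpa using (le_of_lt (by simpa using hq))), zero_smul]
      exact contDiffAt_const.congr_of_eventuallyEq h0
  · filter_upwards [χ.eventuallyEq_one] with p hp
    rw [hp, Pi.one_apply, one_smul]

/-- The map `(c, d) ↦ c v + d w`. -/
def combo {V : Type*} [NormedAddCommGroup V] [NormedSpace ℝ V] (v w : V) : ℝ × ℝ →L[ℝ] V :=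
  (ContinuousLinearMap.fst ℝ ℝ ℝ).smulRight v + (ContinuousLinearMap.snd ℝ ℝ ℝ).smulRight w

theorem combo_apply {V : Type*} [NormedAddCommGroup V] [NormedSpace ℝ V] (v w : V) (c : ℝ × ℝ) :
    combo v w c = c.1 • v + c.2 • w := rfl

theorem contDiffAt_combo {V P : Type*} [NormedAddCommGroup V] [NormedSpace ℝ V]
    [NormedAddCommGroup P] [NormedSpace ℝ P] {X Y : P → V} {p : P} (hX : ContDiffAt ℝ ∞ X p)
    (hY : ContDiffAt ℝ ∞ Y p) : ContDiffAt ℝ ∞ (fun p => combo (X p) (Y p)) p :=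
  (contDiffAt_const.smulRight hX).add (contDiffAt_const.smulRight hY)

/-- Differentiate the graph relations A₂ = B A₁ and L₂ = B L₁. Since [A, L] also lies in the graph,
the terms with derivatives of A₁ and L₁ cancel, leaving B'(A) L₁ = B'(L) A₁. The general identity
follows by bilinearity, as (v, B v) = c A + d L when v = c A₁ + d L₁. -/
theorem fderiv_symm_of_involutive {E Z : Type*} [NormedAddCommGroup E] [NormedSpace ℝ E]
    [NormedAddCommGroup Z] [NormedSpace ℝ Z] {A L : E × Z → E × Z} {B : E × Z → E →L[ℝ] Z}
    {p : E × Z} (hA : DifferentiableAt ℝ A p) (hL : DifferentiableAt ℝ L p)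
    (hB : DifferentiableAt ℝ B p) (hAB : ∀ᶠ q in 𝓝 p, (A q).2 = B q (A q).1)
    (hLB : ∀ᶠ q in 𝓝 p, (L q).2 = B q (L q).1)
    (hinv : lieBracket ℝ A L p ∈ Submodule.span ℝ {A p, L p})
    (hspan : ∀ v : E, ∃ c d : ℝ, v = c • (A p).1 + d • (L p).1) (v w : E) :
    fderiv ℝ B p (v, B p v) w = fderiv ℝ B p (w, B p w) v := by
  have hd : ∀ {X : E × Z → E × Z}, DifferentiableAt ℝ X p → (∀ᶠ q in 𝓝 p, (X q).2 = B q (X q).1) →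
      ∀ u, (fderiv ℝ X p u).2 = fderiv ℝ B p u (X p).1 + B p (fderiv ℝ X p u).1 := by
    intro X hX hXB u
    have h1 : HasFDerivAt (fun q => (X q).1)
        ((ContinuousLinearMap.fst ℝ E Z).comp (fderiv ℝ X p)) p := hX.hasFDerivAt.fst
    have h2 : HasFDerivAt (fun q => (X q).2)
        ((ContinuousLinearMap.snd ℝ E Z).comp (fderiv ℝ X p)) p := hX.hasFDerivAt.snd
    have h3 := (hB.hasFDerivAt.clm_apply h1).congr_of_eventuallyEq hXB
    have h4 := congrArg (fun T : E × Z →L[ℝ] Z => T u) (h2.unique h3)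
    simpa [add_comm] using h4
  have hbr : (lieBracket ℝ A L p).2 = B p (lieBracket ℝ A L p).1 := by
    obtain ⟨c, d, h⟩ := Submodule.mem_span_pair.1 hinv
    rw [← h]
    simp [hAB.self_of_nhds, hLB.self_of_nhds]
  have key : fderiv ℝ B p (A p) (L p).1 = fderiv ℝ B p (L p) (A p).1 := by
    have h1 := hd hA hAB (L p)
    have h2 := hd hL hLB (A p)
    rw [lieBracket_eq] at hbr
    simp only [Prod.snd_sub, Prod.fst_sub, map_sub, h1, h2] at hbr
    have : fderiv ℝ B p (A p) (L p).1 - fderiv ℝ B p (L p) (A p).1 = 0 := by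
      rw [← sub_eq_zero] at hbr
      rw [← hbr]
      abel
    exact sub_eq_zero.1 this
  have hA2 : ((A p).1, B p (A p).1) = A p := Prod.ext rfl hAB.self_of_nhds.symm
  have hL2 : ((L p).1, B p (L p).1) = L p := Prod.ext rfl hLB.self_of_nhds.symm
  have hlift : ∀ c d : ℝ, ((c • (A p).1 + d • (L p).1 : E), B p (c • (A p).1 + d • (L p).1))
      = c • A p + d • L p := by
    intro c d
    rw [← hA2, ← hL2]
    simp
  obtain ⟨c, d, rfl⟩ := hspan v
  obtain ⟨c', d', rfl⟩ := hspan w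
  rw [hlift, hlift]
  simp only [map_add, map_smul, add_apply, smul_apply, key]
  module

/-- Near 0 the first components of A and L still form a basis, so their span is the graph of B = QZ
∘ QE⁻¹, where QE and QZ send coefficients to first and second components. Involutivity is then
integrability of B. -/
theorem exists_leaf_graph {A L : (ℝ × ℝ) × (ℝ × ℝ) → (ℝ × ℝ) × (ℝ × ℝ)}
    (hA0 : A 0 = ((1, 0), 0)) (hL0 : L 0 = ((0, 1), 0))
    (hA : ∀ᶠ p in 𝓝 0, ContDiffAt ℝ ∞ A p) (hL : ∀ᶠ p in 𝓝 0, ContDiffAt ℝ ∞ L p)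
    (hinv : ∀ᶠ p in 𝓝 0, lieBracket ℝ A L p ∈ Submodule.span ℝ {A p, L p}) :
    ∃ Y : (ℝ × ℝ) × (ℝ × ℝ) → ℝ × ℝ, (∀ᶠ p in 𝓝 0, ContDiffAt ℝ ∞ Y p) ∧
      (∀ᶠ z in 𝓝 0, Y (0, z) = z) ∧
      ∀ᶠ p in 𝓝 0, ∀ v, (v, fderiv ℝ Y p (v, 0)) ∈
        Submodule.span ℝ {A (p.1, Y p), L (p.1, Y p)} := by
  let QE : (ℝ × ℝ) × (ℝ × ℝ) → ℝ × ℝ →L[ℝ] ℝ × ℝ := fun p => combo (A p).1 (L p).1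
  let QZ : (ℝ × ℝ) × (ℝ × ℝ) → ℝ × ℝ →L[ℝ] ℝ × ℝ := fun p => combo (A p).2 (L p).2
  have hQE0 : QE 0 = ContinuousLinearMap.id ℝ _ := by
    ext <;> simp [QE, combo_apply, hA0, hL0]
  have hQE : ∀ᶠ p in 𝓝 0, ContDiffAt ℝ ∞ QE p := by
    filter_upwards [hA, hL] with p hAp hLp
    exact contDiffAt_combo hAp.fst hLp.fst
  have hQZ : ∀ᶠ p in 𝓝 0, ContDiffAt ℝ ∞ QZ p := by
    filter_upwards [hA, hL] with p hAp hLp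
    exact contDiffAt_combo hAp.snd hLp.snd
  have hQi : ∀ᶠ p in 𝓝 0, (QE p).IsInvertible := by
    have h1 : ∀ᶠ T in 𝓝 (QE 0), ContinuousLinearMap.IsInvertible T := by
      rw [hQE0]
      exact ContinuousLinearEquiv.nhds (ContinuousLinearEquiv.refl ℝ (ℝ × ℝ))
    exact hQE.self_of_nhds.continuousAt.eventually h1
  let B0 : (ℝ × ℝ) × (ℝ × ℝ) → ℝ × ℝ →L[ℝ] ℝ × ℝ := fun p => (QZ p).comp (QE p).inverse
  have hB0 : ∀ᶠ p in 𝓝 0, ContDiffAt ℝ ∞ B0 p := by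
    filter_upwards [hQE, hQZ, hQi] with p h1 h2 h3
    exact h2.clm_comp (h3.contDiffAt_map_inverse.comp p h1)
  obtain ⟨B, hB, hBB0⟩ := exists_contDiff_eventuallyEq hB0
  have hBQ : ∀ᶠ p in 𝓝 0, ∀ c, QZ p c = B p (QE p c) := by
    filter_upwards [hBB0, hQi] with p h1 h2 c
    rw [h1]
    obtain ⟨T, hT⟩ := h2
    simp [B0, ← hT]
  have hAB : ∀ᶠ p in 𝓝 0, (A p).2 = B p (A p).1 := hBQ.mono fun p hp => by
    simpa [QE, QZ, combo_apply] using hp (1, 0)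
  have hLB : ∀ᶠ p in 𝓝 0, (L p).2 = B p (L p).1 := hBQ.mono fun p hp => by
    simpa [QE, QZ, combo_apply] using hp (0, 1)
  have hspan : ∀ᶠ p in 𝓝 0, ∀ v : ℝ × ℝ, ∃ c d : ℝ, v = c • (A p).1 + d • (L p).1 := by
    filter_upwards [hQi] with p ⟨T, hT⟩ v
    refine ⟨(T.symm v).1, (T.symm v).2, ?_⟩
    have : QE p (T.symm v) = v := by rw [← hT]; simp
    exact this.symm
  have hint : ∀ᶠ p in 𝓝 0, ∀ v w, fderiv ℝ B p (v, B p v) w = fderiv ℝ B p (w, B p w) v := by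
    filter_upwards [hA, hL, hAB.eventually_nhds, hLB.eventually_nhds, hinv, hspan]
      with p h1 h2 h3 h4 h5 h6
    exact fderiv_symm_of_involutive (h1.differentiableAt (by simp)) (h2.differentiableAt (by simp))
      (hB.differentiable (by simp) p) h3 h4 h5 h6
  obtain ⟨Y, hY, hY0, hYB⟩ := exists_solution_of_integrable hB hint
  refine ⟨Y, hY, hY0, ?_⟩
  have hYz : Y 0 = 0 := hY0.self_of_nhds
  have hq : Tendsto (fun p : (ℝ × ℝ) × (ℝ × ℝ) => (p.1, Y p)) (𝓝 0) (𝓝 0) := by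
    have := (continuousAt_fst (p := (0 : (ℝ × ℝ) × (ℝ × ℝ)))).prodMk hY.self_of_nhds.continuousAt
    have h2 : Tendsto (fun p : (ℝ × ℝ) × (ℝ × ℝ) => (p.1, Y p)) (𝓝 0) (𝓝 (0, Y 0)) := this
    rwa [hYz] at h2
  filter_upwards [hYB, hq.eventually hAB, hq.eventually hLB, hq.eventually hspan]
    with p h1 h2 h3 h4 v
  rw [h1]
  obtain ⟨c, d, rfl⟩ := h4 v
  refine Submodule.mem_span_pair.2 ⟨c, d, Prod.ext rfl ?_⟩
  simp [h2, h3]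

/-- The splitting of the four coordinates into two pairs. -/
def splitCoord : E4 ≃L[ℝ] (ℝ × ℝ) × (ℝ × ℝ) :=
  LinearEquiv.toContinuousLinearEquiv
    { toFun := fun w => ((w 0, w 1), (w 2, w 3))
      map_add' := fun _ _ => rfl
      map_smul' := fun _ _ => rfl
      invFun := fun p => WithLp.toLp 2 ![p.1.1, p.1.2, p.2.1, p.2.2]
      left_inv := fun w => by
        ext i
        fin_cases i <;> rfl
      right_inv := fun _ => rfl }

theorem splitCoord_apply (w : E4) : splitCoord w = ((w 0, w 1), (w 2, w 3)) := rfl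

/-- The linear automorphism of the coordinate space taking the standard basis to a given one. -/
def basisEquiv (c : Module.Basis (Fin 4) ℝ E4) : E4 ≃L[ℝ] E4 :=
  ((EuclideanSpace.basisFun (Fin 4) ℝ).toBasis.equiv c (Equiv.refl _)).toContinuousLinearEquiv

theorem basisEquiv_stdVec (c : Module.Basis (Fin 4) ℝ E4) (i : Fin 4) :
    basisEquiv c (stdVec i) = c i := by
  have h := (EuclideanSpace.basisFun (Fin 4) ℝ).toBasis.equiv_apply i c (Equiv.refl _)
  rw [OrthonormalBasis.coe_toBasis, EuclideanSpace.basisFun_apply] at h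
  exact h

theorem lieBracket_comp_affine {V V' : Type*} [NormedAddCommGroup V] [NormedSpace ℝ V]
    [NormedAddCommGroup V'] [NormedSpace ℝ V'] (Λ : V' ≃L[ℝ] V) (y : V) {A L : V → V} {p : V'}
    (hA : DifferentiableAt ℝ A (y + Λ p)) (hL : DifferentiableAt ℝ L (y + Λ p)) :
    lieBracket ℝ (fun p => Λ.symm (A (y + Λ p))) (fun p => Λ.symm (L (y + Λ p))) p
      = Λ.symm (lieBracket ℝ A L (y + Λ p)) := by
  have h : ∀ {X : V → V}, DifferentiableAt ℝ X (y + Λ p) → ∀ v,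
      fderiv ℝ (fun p => Λ.symm (X (y + Λ p))) p v = Λ.symm (fderiv ℝ X (y + Λ p) (Λ v)) := by
    intro X hX v
    have h1 : HasFDerivAt (fun p => y + Λ p) (Λ : V' →L[ℝ] V) p := Λ.hasFDerivAt.const_add y
    have h2 := Λ.symm.hasFDerivAt.comp p (hX.hasFDerivAt.comp p h1)
    exact congrArg (fun T : V' →L[ℝ] V' => T v) h2.fderiv
  rw [lieBracket_eq, lieBracket_eq]
  simp [h hA, h hL]

/-- Affine coordinates Λ at y bring A(y), L(y) to the first two axes, and the leaves become graphs
of Y(·, z). The map Θ sends (x, z) to the point of the leaf labelled z above x. Its derivative at 0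
is injective because Y(0, z) = z. -/
theorem exists_flat_parametrization {A L : E4 → E4} {y : E4} (c : Module.Basis (Fin 4) ℝ E4)
    (hcA : c 0 = A y) (hcL : c 1 = L y) (hA : ∀ᶠ z in 𝓝 y, ContDiffAt ℝ ∞ A z)
    (hL : ∀ᶠ z in 𝓝 y, ContDiffAt ℝ ∞ L z)
    (hinv : ∀ᶠ z in 𝓝 y, lieBracket ℝ A L z ∈ Submodule.span ℝ {A z, L z}) :
    ∃ Θ : E4 → E4, (∀ᶠ w in 𝓝 0, ContDiffAt ℝ ∞ Θ w) ∧ Θ 0 = y ∧ (fderiv ℝ Θ 0).IsInvertible ∧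
      ∀ᶠ w in 𝓝 0, ∀ v : E4, v 2 = 0 → v 3 = 0 →
        fderiv ℝ Θ w v ∈ Submodule.span ℝ {A (Θ w), L (Θ w)} := by
  let Λ : ((ℝ × ℝ) × (ℝ × ℝ)) ≃L[ℝ] E4 := splitCoord.symm.trans (basisEquiv c)
  have ht : Tendsto (fun p => y + Λ p) (𝓝 0) (𝓝 y) := by
    have : Continuous fun p => y + Λ p := by fun_prop
    simpa using this.tendsto 0
  have hsm : ∀ {X : E4 → E4}, (∀ᶠ z in 𝓝 y, ContDiffAt ℝ ∞ X z) →
      ∀ᶠ p in 𝓝 0, ContDiffAt ℝ ∞ (fun p => Λ.symm (X (y + Λ p))) p := by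
    intro X hX
    filter_upwards [ht.eventually hX] with p hp
    exact Λ.symm.contDiff.contDiffAt.comp p
      (hp.comp p (contDiffAt_const.add Λ.contDiff.contDiffAt))
  have h0 : Λ.symm (A y) = ((1, 0), 0) := by
    rw [ContinuousLinearEquiv.symm_apply_eq, ← hcA, ← basisEquiv_stdVec]
    simp only [Λ, ContinuousLinearEquiv.trans_apply]
    congr 1
    rw [ContinuousLinearEquiv.eq_symm_apply]
    simp [splitCoord_apply]
  have h1 : Λ.symm (L y) = ((0, 1), 0) := by
    rw [ContinuousLinearEquiv.symm_apply_eq, ← hcL, ← basisEquiv_stdVec]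
    simp only [Λ, ContinuousLinearEquiv.trans_apply]
    congr 1
    rw [ContinuousLinearEquiv.eq_symm_apply]
    simp [splitCoord_apply]
  obtain ⟨Y, hY, hY0, hYs⟩ := exists_leaf_graph (A := fun p => Λ.symm (A (y + Λ p)))
    (L := fun p => Λ.symm (L (y + Λ p))) (by simpa using h0) (by simpa using h1) (hsm hA) (hsm hL)
    (by
      filter_upwards [ht.eventually hA, ht.eventually hL, ht.eventually hinv] with p h2 h3 h4
      rw [lieBracket_comp_affine Λ y (h2.differentiableAt (by simp))
          (h3.differentiableAt (by simp))]
      obtain ⟨a, b, h⟩ := Submodule.mem_span_pair.1 h4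
      rw [← h]
      exact Submodule.mem_span_pair.2 ⟨a, b, by simp⟩)
  have hYz : Y 0 = 0 := hY0.self_of_nhds
  have hs : Tendsto splitCoord (𝓝 0) (𝓝 0) := by simpa using splitCoord.continuous.tendsto 0
  have hΘd : ∀ w, DifferentiableAt ℝ Y (splitCoord w) → ∀ v,
      fderiv ℝ (fun w => y + Λ ((splitCoord w).1, Y (splitCoord w))) w v
        = Λ ((splitCoord v).1, fderiv ℝ Y (splitCoord w) (splitCoord v)) := by
    intro w hw v
    have e1 : HasFDerivAt (fun w => splitCoord w) (splitCoord : E4 →L[ℝ] _) w :=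
      splitCoord.hasFDerivAt
    have e2 := (Λ.hasFDerivAt.comp w (e1.fst.prodMk (hw.hasFDerivAt.comp w e1))).const_add y
    exact congrArg (fun T : E4 →L[ℝ] E4 => T v) e2.fderiv
  refine ⟨fun w => y + Λ ((splitCoord w).1, Y (splitCoord w)), ?_, ?_, ?_, ?_⟩
  · filter_upwards [hs.eventually hY] with w hw
    have e1 : ContDiffAt ℝ ∞ (fun w => splitCoord w) w := splitCoord.contDiff.contDiffAt
    exact contDiffAt_const.add
      (Λ.contDiff.contDiffAt.comp w (e1.fst.prodMk (ContDiffAt.comp w hw e1)))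
  · simp [hYz]
  · have hd0 : DifferentiableAt ℝ Y 0 := hY.self_of_nhds.differentiableAt (by simp)
    have hs0 : splitCoord (0 : E4) = 0 := map_zero _
    have hζ : ∀ ζ : ℝ × ℝ, fderiv ℝ Y 0 (0, ζ) = ζ := by
      intro ζ
      have e1 : HasFDerivAt (fun z : ℝ × ℝ => ((0 : ℝ × ℝ), z))
          (ContinuousLinearMap.inr ℝ (ℝ × ℝ) (ℝ × ℝ)) 0 :=
        (ContinuousLinearMap.inr ℝ (ℝ × ℝ) (ℝ × ℝ)).hasFDerivAt
      have e2 : HasFDerivAt (fun z : ℝ × ℝ => Y (0, z))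
          ((fderiv ℝ Y 0).comp (ContinuousLinearMap.inr ℝ (ℝ × ℝ) (ℝ × ℝ))) 0 :=
        HasFDerivAt.comp (g := Y) 0 hd0.hasFDerivAt e1
      have e3 : HasFDerivAt (fun z : ℝ × ℝ => Y (0, z)) (ContinuousLinearMap.id ℝ (ℝ × ℝ)) 0 :=
        (hasFDerivAt_id (𝕜 := ℝ) (0 : ℝ × ℝ)).congr_of_eventuallyEq hY0
      exact congrArg (fun T : ℝ × ℝ →L[ℝ] ℝ × ℝ => T ζ) (e2.unique e3)
    set D := fderiv ℝ (fun w => y + Λ ((splitCoord w).1, Y (splitCoord w))) 0 with hD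
    have hinj : Function.Injective D.toLinearMap := by
      rw [← LinearMap.ker_eq_bot, LinearMap.ker_eq_bot']
      intro v hv
      have e : Λ ((splitCoord v).1, fderiv ℝ Y 0 (splitCoord v)) = 0 := by
        rw [← hs0, ← hΘd 0 (by rw [hs0]; exact hd0) v]
        exact hv
      have e' := (map_eq_zero_iff _ Λ.injective).1 e
      have e1 : (splitCoord v).1 = 0 := congrArg Prod.fst e'
      have e2 : fderiv ℝ Y 0 (splitCoord v) = 0 := congrArg Prod.snd e'
      have e3 : splitCoord v = (0, (splitCoord v).2) := Prod.ext e1 rfl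
      rw [e3, hζ] at e2
      rw [e2] at e3
      exact (map_eq_zero_iff _ splitCoord.injective).1 e3
    exact ⟨(LinearEquiv.ofInjectiveEndo D.toLinearMap hinj).toContinuousLinearEquiv, by ext; rfl⟩
  · filter_upwards [hs.eventually hY, hs.eventually hYs] with w h2 h3 v hv2 hv3
    have e : splitCoord v = ((v 0, v 1), 0) := by rw [splitCoord_apply, hv2, hv3]; rfl
    rw [hΘd w (h2.differentiableAt (by simp)), e]
    obtain ⟨a, b, h⟩ := Submodule.mem_span_pair.1 (h3 (v 0, v 1))
    refine Submodule.mem_span_pair.2 ⟨a, b, ?_⟩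
    rw [← h]
    simp

theorem exists_flat_homeomorph {A L : E4 → E4} {y : E4} (c : Module.Basis (Fin 4) ℝ E4)
    (hcA : c 0 = A y) (hcL : c 1 = L y) (hA : ∀ᶠ z in 𝓝 y, ContDiffAt ℝ ∞ A z)
    (hL : ∀ᶠ z in 𝓝 y, ContDiffAt ℝ ∞ L z)
    (hinv : ∀ᶠ z in 𝓝 y, lieBracket ℝ A L z ∈ Submodule.span ℝ {A z, L z})
    {U : Set E4} (hU : U ∈ 𝓝 y) :
    ∃ Θ : OpenPartialHomeomorph E4 E4, Convex ℝ Θ.source ∧ 0 ∈ Θ.source ∧ Θ 0 = y ∧ Θ.target ⊆ U ∧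
      ContDiffOn ℝ ∞ Θ Θ.source ∧ ContDiffOn ℝ ∞ Θ.symm Θ.target ∧
      ∀ w ∈ Θ.source, ∀ v : E4, v 2 = 0 → v 3 = 0 →
        fderiv ℝ Θ w v ∈ Submodule.span ℝ {A (Θ w), L (Θ w)} := by
  obtain ⟨Θ, hΘ, hΘ0, ⟨T, hT⟩, hΘs⟩ := exists_flat_parametrization c hcA hcL hA hL hinv
  have hΘ00 : ContDiffAt ℝ ∞ Θ 0 := hΘ.self_of_nhds
  have hder : HasFDerivAt Θ (T : E4 →L[ℝ] E4) 0 := by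
    rw [hT]
    exact (hΘ00.differentiableAt (by simp)).hasFDerivAt
  have hne : (∞ : WithTop ℕ∞) ≠ 0 := by simp
  let Θ₀ := hΘ00.toOpenPartialHomeomorph Θ hder hne
  -- Invertibility near 0, not only at 0, is what makes the inverse smooth to order ∞ at every point
  -- of the target. The ball chosen below is convex, which will give connected slices.
  have hinv : ∀ᶠ w in 𝓝 0, (fderiv ℝ Θ w).IsInvertible := by
    have h1 : ∀ᶠ D in 𝓝 (fderiv ℝ Θ 0), ContinuousLinearMap.IsInvertible D := by
      rw [← hT]
      exact ContinuousLinearEquiv.nhds T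
    have h2 : ContinuousAt (fderiv ℝ Θ) 0 :=
      (hΘ00.fderiv_right (m := 0) (by simp)).continuousAt
    exact h2.eventually h1
  have hsrc : Θ₀.source ∈ 𝓝 (0 : E4) :=
    Θ₀.open_source.mem_nhds (hΘ00.mem_toOpenPartialHomeomorph_source hder hne)
  have hpre : Θ ⁻¹' U ∈ 𝓝 (0 : E4) := hΘ00.continuousAt.preimage_mem_nhds (by rwa [hΘ0])
  obtain ⟨r, hr, hball⟩ := Metric.mem_nhds_iff.1 (inter_mem (inter_mem hsrc hpre)
    (inter_mem hΘ (inter_mem hinv hΘs)))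
  have hsource : (Θ₀.restrOpen (Metric.ball 0 r) Metric.isOpen_ball).source = Metric.ball 0 r := by
    rw [OpenPartialHomeomorph.restrOpen_source]
    exact inter_eq_right.2 fun w hw => (hball hw).1.1
  refine ⟨Θ₀.restrOpen (Metric.ball 0 r) Metric.isOpen_ball, ?_, ?_, hΘ0, ?_, ?_, ?_, ?_⟩
  · rw [hsource]
    exact convex_ball _ _
  · rw [hsource]
    exact Metric.mem_ball_self hr
  · intro z hz
    have h1 := (Θ₀.restrOpen (Metric.ball 0 r) Metric.isOpen_ball).map_target hz
    rw [hsource] at h1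
    have h2 := (hball h1).1.2
    have h3 := (Θ₀.restrOpen (Metric.ball 0 r) Metric.isOpen_ball).right_inv hz
    rw [← h3]
    exact h2
  · rw [hsource]
    intro w hw
    have hc : ContDiffAt ℝ ∞ Θ w := (hball hw).2.1
    exact hc.contDiffWithinAt
  · intro z hz
    have h1 := (Θ₀.restrOpen (Metric.ball 0 r) Metric.isOpen_ball).map_target hz
    rw [hsource] at h1
    have hc : ContDiffAt ℝ ∞ Θ (Θ₀.symm z) := (hball h1).2.1
    obtain ⟨T', hT'⟩ := (hball h1).2.2.1
    refine ((Θ₀.restrOpen (Metric.ball 0 r) Metric.isOpen_ball).contDiffAt_symm hz (f₀' := T') ?_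
      hc).contDiffWithinAt
    rw [hT']
    exact (hc.differentiableAt hne).hasFDerivAt
  · rw [hsource]
    exact fun w hw => (hball hw).2.2.2

end Flattening

/-! ### Fields, metrics and forms in a chart -/

section Dictionary

variable {M : Type*} [TopologicalSpace M] [ChartedSpace E4 M]
  {e : OpenPartialHomeomorph M E4}

/-- The differential of the chart `e` at `q`, with values in the coordinate space. -/
def chartDeriv (e : OpenPartialHomeomorph M E4) (q : M) : TS q →L[ℝ] E4 :=
  ((NormedSpace.fromTangentSpace (𝕜 := ℝ) (e q)) : TangentSpace 𝓘(ℝ, E4) (e q) →L[ℝ] E4) ∘L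
    mfderiv 𝓘(ℝ, E4) 𝓘(ℝ, E4) e q

/-- The vector field `X` in the coordinates of the chart `e`. -/
def coordField (e : OpenPartialHomeomorph M E4) (X : ∀ p : M, TS p) (y : E4) : E4 :=
  chartDeriv e (e.symm y) (X (e.symm y))

theorem mdifferentiableAt_chart (he : e ∈ IsManifold.maximalAtlas 𝓘(ℝ, E4) ∞ M) {q : M}
    (hq : q ∈ e.source) : MDifferentiableAt 𝓘(ℝ, E4) 𝓘(ℝ, E4) e q :=
  (contMDiffAt_of_mem_maximalAtlas he hq).mdifferentiableAt (by simp)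

theorem mdifferentiableAt_chart_symm (he : e ∈ IsManifold.maximalAtlas 𝓘(ℝ, E4) ∞ M) {y : E4}
    (hy : y ∈ e.target) : MDifferentiableAt 𝓘(ℝ, E4) 𝓘(ℝ, E4) e.symm y :=
  (contMDiffAt_symm_of_mem_maximalAtlas he hy).mdifferentiableAt (by simp)

theorem dCoord_apply (i : Fin 4) (q : M) (v : TS q) : dCoord e i q v = chartDeriv e q v i := rfl

theorem localForm_apply {k : ℕ} (F : DiffForm M k) (y : E4) (v : Fin k → E4) :
    localForm e F y v = F (e.symm y) (fun i => chartInvDeriv e y (v i)) := rfl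

theorem localForm_two (F : DiffForm M 2) (y v w : E4) :
    localForm e F y ![v, w] = F (e.symm y) ![chartInvDeriv e y v, chartInvDeriv e y w] := by
  rw [localForm_apply]
  congr 1
  ext i
  fin_cases i <;> rfl

theorem chartDeriv_chartInvDeriv (he : e ∈ IsManifold.maximalAtlas 𝓘(ℝ, E4) ∞ M) {y : E4}
    (hy : y ∈ e.target) (v : E4) : chartDeriv e (e.symm y) (chartInvDeriv e y v) = v := by
  have h1 := mdifferentiableAt_chart he (e.map_target hy)
  have h2 := mdifferentiableAt_chart_symm he hy
  have h3 : mfderiv 𝓘(ℝ, E4) 𝓘(ℝ, E4) (e ∘ e.symm) y =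
      mfderiv 𝓘(ℝ, E4) 𝓘(ℝ, E4) id y := by
    apply Filter.EventuallyEq.mfderiv_eq
    filter_upwards [e.open_target.mem_nhds hy] with z hz using e.right_inv hz
  rw [mfderiv_comp y h1 h2, mfderiv_id] at h3
  exact congrArg (fun T : E4 →L[ℝ] E4 => T v) h3

/-- The other composition is the identity, and a one-sided inverse between spaces of the same finite
dimension is two-sided. -/
theorem chartInvDeriv_chartDeriv (he : e ∈ IsManifold.maximalAtlas 𝓘(ℝ, E4) ∞ M) {y : E4}
    (hy : y ∈ e.target) (v : TS (e.symm y)) :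
    chartInvDeriv e y (chartDeriv e (e.symm y) v) = v := by
  have hinj : Function.Injective (chartInvDeriv e y : E4 →ₗ[ℝ] TS (e.symm y)) :=
    Function.LeftInverse.injective (g := chartDeriv e (e.symm y))
      (chartDeriv_chartInvDeriv he hy)
  have hsurj : Function.Surjective (chartInvDeriv e y : E4 →ₗ[ℝ] TS (e.symm y)) :=
    (LinearMap.injective_iff_surjective (K := ℝ) (V := E4)
      (f := (chartInvDeriv e y : E4 →ₗ[ℝ] TS (e.symm y)))).1 hinj
  obtain ⟨w, rfl⟩ := hsurj v
  exact congrArg (chartInvDeriv e y) (chartDeriv_chartInvDeriv he hy w)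

theorem chartInvDeriv_coordField (he : e ∈ IsManifold.maximalAtlas 𝓘(ℝ, E4) ∞ M) {y : E4}
    (hy : y ∈ e.target) (X : ∀ p : M, TS p) :
    chartInvDeriv e y (coordField e X y) = X (e.symm y) :=
  chartInvDeriv_chartDeriv he hy _

theorem dCoord_chartInvDeriv (he : e ∈ IsManifold.maximalAtlas 𝓘(ℝ, E4) ∞ M) {y : E4}
    (hy : y ∈ e.target) (i : Fin 4) (v : E4) :
    dCoord e i (e.symm y) (chartInvDeriv e y v) = v i := by
  rw [dCoord_apply, chartDeriv_chartInvDeriv he hy]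

theorem isInvertible_mfderiv_symm (he : e ∈ IsManifold.maximalAtlas 𝓘(ℝ, E4) ∞ M) {y : E4}
    (hy : y ∈ e.target) : (mfderiv 𝓘(ℝ, E4) 𝓘(ℝ, E4) e.symm y).IsInvertible :=
  ⟨ContinuousLinearEquiv.equivOfInverse (chartInvDeriv e y) (chartDeriv e (e.symm y))
    (chartDeriv_chartInvDeriv he hy) (chartInvDeriv_chartDeriv he hy), rfl⟩

/-- This identifies the coordinate expression of a field with its pullback under the inverse chart,
so that smoothness and naturality of the bracket carry over from pullbacks. -/
theorem mpullback_symm (he : e ∈ IsManifold.maximalAtlas 𝓘(ℝ, E4) ∞ M) {y : E4}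
    (hy : y ∈ e.target) (X : ∀ p : M, TS p) :
    mpullback 𝓘(ℝ, E4) 𝓘(ℝ, E4) e.symm X y = coordField e X y := by
  rw [mpullback_apply]
  have h := (isInvertible_mfderiv_symm he hy)
  have h1 : mfderiv 𝓘(ℝ, E4) 𝓘(ℝ, E4) e.symm y (coordField e X y) = X (e.symm y) :=
    chartInvDeriv_coordField he hy X
  rw [← h1]
  exact h.inverse_apply_self _

theorem mpullback_symm_eventuallyEq (he : e ∈ IsManifold.maximalAtlas 𝓘(ℝ, E4) ∞ M) {y : E4}
    (hy : y ∈ e.target) (X : ∀ p : M, TS p) :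
    (mpullback 𝓘(ℝ, E4) 𝓘(ℝ, E4) e.symm X : E4 → E4) =ᶠ[𝓝 y] coordField e X := by
  filter_upwards [e.open_target.mem_nhds hy] with z hz using mpullback_symm he hz X

theorem localForm_coordField (he : e ∈ IsManifold.maximalAtlas 𝓘(ℝ, E4) ∞ M) {F : DiffForm M 2}
    {X : ∀ p : M, TS p} {y : E4} (hy : y ∈ e.target) (hX : X (e.symm y) ∈ kernelAt F (e.symm y))
    (w : E4) : localForm e F y ![coordField e X y, w] = 0 := by
  rw [localForm_two, chartInvDeriv_coordField he hy]
  exact hX _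

variable [IsManifold 𝓘(ℝ, E4) ∞ M]

theorem contDiffAt_coordField (he : e ∈ IsManifold.maximalAtlas 𝓘(ℝ, E4) ∞ M) {U : Set M}
    (hU : IsOpen U) {X : ∀ p : M, TS p} (hX : SmoothField U X) {y : E4} (hy : y ∈ e.target)
    (hyU : e.symm y ∈ U) : ContDiffAt ℝ ∞ (coordField e X) y := by
  have : IsManifold 𝓘(ℝ, E4) 1 M := IsManifold.of_le (n := ∞) (by simp)
  have h := ContMDiffAt.mpullback_vectorField_preimage (m := ∞) (n := ∞)
    (hX.contMDiffAt (hU.mem_nhds hyU))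
    (contMDiffAt_symm_of_mem_maximalAtlas he hy) (isInvertible_mfderiv_symm he hy) (by simp)
  exact (contMDiffAt_vectorSpace_iff_contDiffAt.1 h).congr_of_eventuallyEq
    (mpullback_symm_eventuallyEq he hy X).symm

theorem lieBracket_coordField (he : e ∈ IsManifold.maximalAtlas 𝓘(ℝ, E4) ∞ M) {U : Set M}
    (hU : IsOpen U) {X Y : ∀ p : M, TS p} (hX : SmoothField U X) (hY : SmoothField U Y) {y : E4}
    (hy : y ∈ e.target) (hyU : e.symm y ∈ U) :
    lieBracket ℝ (coordField e X) (coordField e Y) y =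
      coordField e (mlieBracket 𝓘(ℝ, E4) X Y) y := by
  have : IsManifold 𝓘(ℝ, E4) (minSmoothness ℝ 3) M := IsManifold.of_le (n := ∞) (by
    rw [minSmoothness_of_isRCLikeNormedField]
    exact WithTop.coe_le_coe.2 (le_top : (3 : ℕ∞) ≤ ⊤))
  have h := mpullback_mlieBracket (n := ∞)
    ((hX.contMDiffAt (hU.mem_nhds hyU)).mdifferentiableAt (by simp))
    ((hY.contMDiffAt (hU.mem_nhds hyU)).mdifferentiableAt (by simp))
    (contMDiffAt_symm_of_mem_maximalAtlas he hy) (by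
      rw [minSmoothness_of_isRCLikeNormedField]
      exact WithTop.coe_le_coe.2 (le_top : (2 : ℕ∞) ≤ ⊤))
  rw [← mlieBracketWithin_univ (V := mpullback _ _ _ _), mlieBracketWithin_eq_lieBracketWithin,
    mpullback_symm he hy] at h
  have h1 := ((mpullback_symm_eventuallyEq he hy X).lieBracket_vectorField_eq (𝕜 := ℝ)
    (mpullback_symm_eventuallyEq he hy Y)).symm
  exact h1.trans ((congrFun lieBracketWithin_univ.symm y).trans h.symm)

/-- The metric in the coordinates of the chart `e`. -/
def coordMetric (g : LorentzMetric M) (e : OpenPartialHomeomorph M E4) (y : E4) :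
    E4 →L[ℝ] E4 →L[ℝ] ℝ :=
  ContinuousLinearMap.bilinearComp (E := E4) (F := E4) (g.val (e.symm y))
    (chartInvDeriv e y) (chartInvDeriv e y)

theorem coordMetric_apply (g : LorentzMetric M) (y v w : E4) :
    coordMetric g e y v w = g.val (e.symm y) (chartInvDeriv e y v) (chartInvDeriv e y w) := rfl

theorem coordMetric_coordField (he : e ∈ IsManifold.maximalAtlas 𝓘(ℝ, E4) ∞ M)
    (g : LorentzMetric M) {y : E4} (hy : y ∈ e.target) (X Y : ∀ p : M, TS p) :
    coordMetric g e y (coordField e X y) (coordField e Y y) = pair g X Y (e.symm y) := by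
  rw [coordMetric_apply, chartInvDeriv_coordField he hy, chartInvDeriv_coordField he hy, pair]

end Dictionary

/-! ### Change of chart -/

section ChangeOfChart

/-- The values of the pulled-back form are polynomial in the components of the form and of the
linear map. -/
theorem contDiffAt_pullback_form {V : Type*} [NormedAddCommGroup V] [NormedSpace ℝ V] {k : ℕ}
    {n : WithTop ℕ∞} {η : V → E4 [⋀^Fin k]→L[ℝ] ℝ} {T : V → E4 →L[ℝ] E4} {x : V}
    (hη : ContDiffAt ℝ n η x) (hT : ContDiffAt ℝ n T x) :
    ContDiffAt ℝ n (fun z => (η z).compContinuousLinearMap (T z)) x := by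
  refine contDiffWithinAt_form (s := univ) fun v => contDiffWithinAt_univ.2 ?_
  have e : (fun z => (η z).compContinuousLinearMap (T z) v) = fun z =>
      ∑ K : Fin k → Fin 4, (∏ i, T z (v i) (K i)) * η z (fun i => stdVec (K i)) :=
    funext fun z => form_expand (η z) fun i => T z (v i)
  have hv : ∀ K : Fin k → Fin 4, ContDiffAt ℝ n (fun z => η z (fun i => stdVec (K i))) x :=
    fun K => (ContinuousAlternatingMap.apply ℝ E4 ℝ fun i => stdVec (K i)).contDiff.contDiffAt.comp
      x hη
  have hc : ∀ w j, ContDiffAt ℝ n (fun z => T z w j) x := fun w j =>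
    (EuclideanSpace.proj j : E4 →L[ℝ] ℝ).contDiff.contDiffAt.comp x (hT.clm_apply contDiffAt_const)
  rw [e]
  exact ContDiffAt.sum fun K _ => (contDiffAt_prod fun i _ => hc (v i) (K i)).mul (hv K)

variable {M : Type*} [TopologicalSpace M] [ChartedSpace E4 M]
  {e e' : OpenPartialHomeomorph M E4}

theorem contDiffAt_transition (he : e ∈ IsManifold.maximalAtlas 𝓘(ℝ, E4) ∞ M)
    (he' : e' ∈ IsManifold.maximalAtlas 𝓘(ℝ, E4) ∞ M) {y : E4} (hy : y ∈ e'.target)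
    (hye : e'.symm y ∈ e.source) : ContDiffAt ℝ ∞ (e ∘ e'.symm) y :=
  contMDiffAt_iff_contDiffAt.1 ((contMDiffAt_of_mem_maximalAtlas he hye).comp y
    (contMDiffAt_symm_of_mem_maximalAtlas he' hy))

theorem fderiv_transition (he : e ∈ IsManifold.maximalAtlas 𝓘(ℝ, E4) ∞ M)
    (he' : e' ∈ IsManifold.maximalAtlas 𝓘(ℝ, E4) ∞ M) {y : E4} (hy : y ∈ e'.target)
    (hye : e'.symm y ∈ e.source) (v : E4) :
    fderiv ℝ (e ∘ e'.symm) y v = chartDeriv e (e'.symm y) (chartInvDeriv e' y v) := by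
  have h := mfderiv_comp y (mdifferentiableAt_chart he hye) (mdifferentiableAt_chart_symm he' hy)
  rw [mfderiv_eq_fderiv] at h
  exact congrArg (fun T : E4 →L[ℝ] E4 => T v) h

theorem localForm_chartDeriv (he : e ∈ IsManifold.maximalAtlas 𝓘(ℝ, E4) ∞ M) {k : ℕ}
    (F : DiffForm M k) {q : M} (hq : q ∈ e.source) (w : Fin k → TS q) :
    localForm e F (e q) (fun i => chartDeriv e q (w i)) = F q w := by
  obtain ⟨z, hz, rfl⟩ : ∃ z ∈ e.target, e.symm z = q := ⟨e q, e.map_source hq, e.left_inv hq⟩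
  -- The base point e (e.symm z) is generalised to y before being replaced by z, because the tangent
  -- spaces involved depend on it.
  have h : ∀ y, y = z → localForm e F y (fun i => chartDeriv e (e.symm z) (w i))
      = F (e.symm z) w := by
    rintro y rfl
    rw [localForm_apply]
    congr 1
    ext i : 1
    exact chartInvDeriv_chartDeriv he hz _
  exact h _ (e.right_inv hz)

theorem localForm_change (he : e ∈ IsManifold.maximalAtlas 𝓘(ℝ, E4) ∞ M)
    (he' : e' ∈ IsManifold.maximalAtlas 𝓘(ℝ, E4) ∞ M) {k : ℕ} (F : DiffForm M k) {y : E4}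
    (hy : y ∈ e'.target) (hye : e'.symm y ∈ e.source) :
    localForm e' F y = (localForm e F ((e ∘ e'.symm) y)).compContinuousLinearMap
      (fderiv ℝ (e ∘ e'.symm) y) := by
  ext v
  rw [localForm_apply, ← localForm_chartDeriv he F hye]
  exact congrArg _ (funext fun i => (fderiv_transition he he' hy hye (v i)).symm)

theorem localForm_change_eventuallyEq (he : e ∈ IsManifold.maximalAtlas 𝓘(ℝ, E4) ∞ M)
    (he' : e' ∈ IsManifold.maximalAtlas 𝓘(ℝ, E4) ∞ M) {k : ℕ} (F : DiffForm M k) {y : E4}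
    (hy : y ∈ e'.target) (hye : e'.symm y ∈ e.source) :
    localForm e' F =ᶠ[𝓝 y] fun z => (localForm e F ((e ∘ e'.symm) z)).compContinuousLinearMap
      (fderiv ℝ (e ∘ e'.symm) z) := by
  filter_upwards [e'.open_target.mem_nhds hy,
    (e'.symm.continuousAt hy).preimage_mem_nhds (e.open_source.mem_nhds hye)] with z hz hze
    using localForm_change he he' F hz hze

/-- A form which is smooth in one chart is smooth on the domain of this chart. -/
theorem contDiffAt_localForm (he : e ∈ IsManifold.maximalAtlas 𝓘(ℝ, E4) ∞ M)
    (he' : e' ∈ IsManifold.maximalAtlas 𝓘(ℝ, E4) ∞ M) {k : ℕ} {F : DiffForm M k}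
    (hF : ContDiffOn ℝ ∞ (localForm e F) e.target) {y : E4} (hy : y ∈ e'.target)
    (hye : e'.symm y ∈ e.source) : ContDiffAt ℝ ∞ (localForm e' F) y := by
  have h := contDiffAt_transition he he' hy hye
  refine ContDiffAt.congr_of_eventuallyEq ?_ (localForm_change_eventuallyEq he he' F hy hye)
  have h1 : ContDiffAt ℝ ∞ (localForm e F) ((e ∘ e'.symm) y) :=
    hF.contDiffAt (e.open_target.mem_nhds (e.map_source hye))
  exact contDiffAt_pullback_form (h1.comp y h) (h.fderiv_right (by simp))

/-- A form which is closed in one chart is closed on the domain of this chart. -/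
theorem extDeriv_localForm (he : e ∈ IsManifold.maximalAtlas 𝓘(ℝ, E4) ∞ M)
    (he' : e' ∈ IsManifold.maximalAtlas 𝓘(ℝ, E4) ∞ M) {k : ℕ} {F : DiffForm M k}
    (hF : ContDiffOn ℝ ∞ (localForm e F) e.target)
    (hd : ∀ y ∈ e.target, extDeriv (localForm e F) y = 0) {y : E4} (hy : y ∈ e'.target)
    (hye : e'.symm y ∈ e.source) : extDeriv (localForm e' F) y = 0 := by
  have h1 : ContDiffAt ℝ ∞ (localForm e F) ((e ∘ e'.symm) y) :=
    hF.contDiffAt (e.open_target.mem_nhds (e.map_source hye))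
  rw [(localForm_change_eventuallyEq he he' F hy hye).extDeriv_eq,
    extDeriv_pullback (h1.differentiableAt (by simp))
      (contDiffAt_transition he he' hy hye) (by
        rw [minSmoothness_of_isRCLikeNormedField]
        exact WithTop.coe_le_coe.2 (le_top : (2 : ℕ∞) ≤ ⊤)),
    show extDeriv (localForm e F) ((e ∘ e'.symm) y) = 0 from hd _ (e.map_source hye)]
  rfl

end ChangeOfChart

/-! ### The form u(x³, x⁴) dx³ ∧ dx⁴: smoothness and closedness -/

section AdaptedForm

/-- The `2`-form `dx³ ∧ dx⁴` on the coordinate space. -/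
def leafWedge : E4 [⋀^Fin 2]→L[ℝ] ℝ :=
  wedge ![(EuclideanSpace.proj 2 : E4 →L[ℝ] ℝ), (EuclideanSpace.proj 3 : E4 →L[ℝ] ℝ)]

theorem leafWedge_apply (v w : E4) : leafWedge ![v, w] = v 2 * w 3 - v 3 * w 2 := by
  rw [leafWedge, wedge_two_apply]
  rfl

theorem extDeriv_smul_leafWedge {f : E4 → ℝ} {x : E4} (hf : DifferentiableAt ℝ f x)
    (v : Fin 3 → E4) :
    extDeriv (fun z => f z • leafWedge) x v =
      fderiv ℝ f x (v 0) * (v 1 2 * v 2 3 - v 1 3 * v 2 2)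
      - fderiv ℝ f x (v 1) * (v 0 2 * v 2 3 - v 0 3 * v 2 2)
      + fderiv ℝ f x (v 2) * (v 0 2 * v 1 3 - v 0 3 * v 1 2) := by
  have h : fderiv ℝ (fun z => f z • leafWedge) x = (fderiv ℝ f x).smulRight leafWedge :=
    HasFDerivAt.fderiv (hf.hasFDerivAt.smul_const leafWedge)
  have e : ∀ w : Fin 2 → E4, leafWedge w = w 0 2 * w 1 3 - w 0 3 * w 1 2 := by
    intro w
    rw [← leafWedge_apply]
    congr 1
    ext i : 1
    fin_cases i <;> rfl
  simp only [extDeriv, h, ContinuousAlternatingMap.alternatizeUncurryFin_apply,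
    ContinuousLinearMap.smulRight_apply, ContinuousAlternatingMap.smul_apply, e, smul_eq_mul]
  refine (Fin.sum_univ_three _).trans ?_
  simp [Fin.removeNth, Fin.succAbove]
  ring

variable {M : Type*} [TopologicalSpace M] {e : OpenPartialHomeomorph M E4}

theorem contDiffOn_leafFun {u : ℝ × ℝ → ℝ} (hu : ContDiffOn ℝ ∞ u (leafSpace e)) :
    ContDiffOn ℝ ∞ (fun y : E4 => u (y 2, y 3)) e.target := by
  have h : ContDiff ℝ ∞ fun y : E4 => (y 2, y 3) :=
    (EuclideanSpace.proj 2 : E4 →L[ℝ] ℝ).contDiff.prodMk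
      (EuclideanSpace.proj 3 : E4 →L[ℝ] ℝ).contDiff
  exact hu.comp h.contDiffOn fun y hy => mem_image_of_mem _ hy

variable [ChartedSpace E4 M]

theorem localForm_adaptedForm (he : e ∈ IsManifold.maximalAtlas 𝓘(ℝ, E4) ∞ M) (u : ℝ × ℝ → ℝ)
    {y : E4} (hy : y ∈ e.target) :
    localForm e (adaptedForm e u) y = u (y 2, y 3) • leafWedge := by
  ext v
  rw [localForm_apply, adaptedForm, leafFun, e.right_inv hy, ContinuousAlternatingMap.smul_apply,
    ContinuousAlternatingMap.smul_apply, wedge_apply, leafWedge, wedge_apply]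
  simp only [Matrix.det_fin_two, Matrix.of_apply, Matrix.cons_val_zero, Matrix.cons_val_one,
    dCoord_chartInvDeriv he hy]
  rfl

theorem contDiffOn_localForm_adaptedForm (he : e ∈ IsManifold.maximalAtlas 𝓘(ℝ, E4) ∞ M)
    {u : ℝ × ℝ → ℝ} (hu : ContDiffOn ℝ ∞ u (leafSpace e)) :
    ContDiffOn ℝ ∞ (localForm e (adaptedForm e u)) e.target :=
  ((contDiffOn_leafFun hu).smul_const leafWedge).congr fun _ hy => localForm_adaptedForm he u hy

theorem extDeriv_localForm_adaptedForm (he : e ∈ IsManifold.maximalAtlas 𝓘(ℝ, E4) ∞ M)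
    {u : ℝ × ℝ → ℝ} (hu : ContDiffOn ℝ ∞ u (leafSpace e)) {y : E4} (hy : y ∈ e.target) :
    extDeriv (localForm e (adaptedForm e u)) y = 0 := by
  have hev : localForm e (adaptedForm e u) =ᶠ[𝓝 y] fun z => u (z 2, z 3) • leafWedge := by
    filter_upwards [e.open_target.mem_nhds hy] with z hz using localForm_adaptedForm he u hz
  have hdiff : DifferentiableAt ℝ (fun y : E4 => u (y 2, y 3)) y :=
    ((contDiffOn_leafFun hu).contDiffAt (e.open_target.mem_nhds hy)).differentiableAt (by simp)
  -- The function is constant along lines in these directions. Hence du is a combination of dx³ and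
  -- dx⁴, and du ∧ dx³ ∧ dx⁴ = 0.
  have h0 : ∀ v : E4, v 2 = 0 → v 3 = 0 → fderiv ℝ (fun y : E4 => u (y 2, y 3)) y v = 0 := by
    intro v h2 h3
    rw [← hdiff.lineDeriv_eq_fderiv, lineDeriv]
    simp [h2, h3]
  have hexp : ∀ v : E4, fderiv ℝ (fun y : E4 => u (y 2, y 3)) y v =
      v 2 * fderiv ℝ (fun y : E4 => u (y 2, y 3)) y (stdVec 2)
      + v 3 * fderiv ℝ (fun y : E4 => u (y 2, y 3)) y (stdVec 3) := by
    intro v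
    have h := h0 (v - v 2 • stdVec 2 - v 3 • stdVec 3) (by simp) (by simp)
    rw [map_sub, map_sub, map_smul, map_smul, smul_eq_mul, smul_eq_mul] at h
    linarith
  rw [hev.extDeriv_eq]
  ext v
  rw [extDeriv_smul_leafWedge hdiff, hexp (v 0), hexp (v 1), hexp (v 2)]
  change _ = (0 : ℝ)
  ring

end AdaptedForm

/-! ### Change of null frame -/

section FrameChange

/-- The coefficient of `v` along `b i` in the frame `b`, by Cramer's rule. -/
def frameCoeff (b : Fin 4 → E4) (i : Fin 4) (v : E4) : ℝ :=
  (frameMatrix (Function.update b i v)).det / (frameMatrix b).det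

theorem frameCoeff_sum {b : Fin 4 → E4} (hb : (frameMatrix b).det ≠ 0) (i : Fin 4)
    (c : Fin 4 → ℝ) : frameCoeff b i (∑ j, c j • b j) = c i := by
  have e : frameMatrix (Function.update b i (∑ j, c j • b j)) =
      (frameMatrix b).updateRow i (∑ j, c j • frameMatrix b j) := by
    ext k m
    by_cases h : k = i
    · subst h
      simp [frameMatrix, Finset.sum_apply]
    · simp [frameMatrix, h]
  rw [frameCoeff, e, Matrix.det_updateRow_sum, smul_eq_mul, mul_div_assoc, div_self hb, mul_one]

theorem frameCoeff_pair {b : Fin 4 → E4} (hb : (frameMatrix b).det ≠ 0) {i j : Fin 4} (hij : i ≠ j)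
    (x y : ℝ) :
    frameCoeff b i (x • b i + y • b j) = x ∧ frameCoeff b j (x • b i + y • b j) = y := by
  have e : x • b i + y • b j = ∑ k, (Pi.single i x + Pi.single j y : Fin 4 → ℝ) k • b k := by
    simp [add_smul, Finset.sum_add_distrib, Pi.single_apply, ite_smul]
  rw [e, frameCoeff_sum hb, frameCoeff_sum hb]
  simp [hij, hij.symm]

/-- The comparison of two null frames gives coefficients point by point. By Cramer's rule they are
quotients of determinants, hence differentiable, which the bracket computation needs. -/
theorem differentiableAt_frameCoeff {b : Fin 4 → E4 → E4} {V : E4 → E4} {x : E4}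
    (hb : ∀ i, DifferentiableAt ℝ (b i) x) (hV : DifferentiableAt ℝ V x)
    (h0 : (frameMatrix fun i => b i x).det ≠ 0) (i : Fin 4) :
    DifferentiableAt ℝ (fun z => frameCoeff (fun j => b j z) i (V z)) x := by
  have e : ∀ z, Function.update (fun j => b j z) i (V z) =
      fun j => (Function.update b i V : Fin 4 → E4 → E4) j z := by
    intro z
    ext j : 1
    by_cases h : j = i
    · subst h; simp
    · simp [h]
  have hu : ∀ j, DifferentiableAt ℝ ((Function.update b i V : Fin 4 → E4 → E4) j) x := by
    intro j
    by_cases h : j = i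
    · subst h; simpa using hV
    · simpa [h] using hb j
  have hquot : ∀ {N D : E4 → ℝ}, DifferentiableAt ℝ N x → DifferentiableAt ℝ D x → D x ≠ 0 →
      DifferentiableAt ℝ (fun z => N z / D z) x := fun hN hD h => hN.mul (hD.fun_inv h)
  simp only [frameCoeff, e]
  exact hquot (differentiableAt_det hu) (differentiableAt_det hb) h0

/-- In the span of s and l the null vectors are the multiples of l and the unit vectors are ±s plus
a multiple of l. A unit vector orthogonal to l' and s' has no n- and no s-component, hence is ±a
plus a multiple of l. -/
theorem IsNullFrame.change {β : E4 →L[ℝ] E4 →L[ℝ] ℝ} {b b' : Fin 4 → E4} (hb : IsNullFrame β b)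
    (hb' : IsNullFrame β b') (h0 : b' 0 ∈ Submodule.span ℝ {b 0, b 2})
    (h2 : b' 2 ∈ Submodule.span ℝ {b 0, b 2}) :
    ∃ f c h η ε : ℝ, f ≠ 0 ∧ η ^ 2 = 1 ∧ ε ^ 2 = 1 ∧ b' 2 = f • b 2 ∧ b' 0 = η • b 0 + c • b 2 ∧
      b' 1 = ε • b 1 + h • b 2 := by
  obtain ⟨d, f, hf⟩ := Submodule.mem_span_pair.1 h2
  obtain ⟨η, c, hc⟩ := Submodule.mem_span_pair.1 h0
  obtain ⟨k, hk⟩ := frame_span hb.det_ne_zero (b' 1)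
  rw [Fin.sum_univ_four] at hk
  have g00 : β (b 0) (b 0) = 1 := hb 0 0
  have g01 : β (b 0) (b 1) = 0 := hb 0 1
  have g02 : β (b 0) (b 2) = 0 := hb 0 2
  have g03 : β (b 0) (b 3) = 0 := hb 0 3
  have g10 : β (b 1) (b 0) = 0 := hb 1 0
  have g11 : β (b 1) (b 1) = 1 := hb 1 1
  have g12 : β (b 1) (b 2) = 0 := hb 1 2
  have g13 : β (b 1) (b 3) = 0 := hb 1 3
  have g20 : β (b 2) (b 0) = 0 := hb 2 0
  have g21 : β (b 2) (b 1) = 0 := hb 2 1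
  have g22 : β (b 2) (b 2) = 0 := hb 2 2
  have g23 : β (b 2) (b 3) = -1 := hb 2 3
  have g30 : β (b 3) (b 0) = 0 := hb 3 0
  have g31 : β (b 3) (b 1) = 0 := hb 3 1
  have g32 : β (b 3) (b 2) = -1 := hb 3 2
  have g33 : β (b 3) (b 3) = 0 := hb 3 3
  have r22 : β (b' 2) (b' 2) = 0 := hb' 2 2
  have r00 : β (b' 0) (b' 0) = 1 := hb' 0 0
  have r11 : β (b' 1) (b' 1) = 1 := hb' 1 1
  have r12 : β (b' 1) (b' 2) = 0 := hb' 1 2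
  have r10 : β (b' 1) (b' 0) = 0 := hb' 1 0
  have r23 : β (b' 2) (b' 3) = -1 := hb' 2 3
  rw [← hf] at r22 r12 r23
  rw [← hc] at r00 r10
  rw [hk] at r11 r12 r10
  simp only [map_add, map_smul, add_apply, smul_apply, smul_eq_mul, g00, g01, g02, g03, g10, g11,
    g12, g13, g20, g21, g22, g23, g30, g31, g32, g33] at r22 r00 r11 r12 r10
  have hd : d = 0 := by
    have : d * d = 0 := by linear_combination r22
    exact mul_self_eq_zero.1 this
  subst hd
  have hf0 : f ≠ 0 := by
    rintro rfl
    simp at r23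
  have hη : η ^ 2 = 1 := by linear_combination r00
  have hη0 : η ≠ 0 := by
    rintro rfl
    norm_num at hη
  have h3 : k 3 = 0 := by
    have : f * k 3 = 0 := by linear_combination -r12
    exact (mul_eq_zero.1 this).resolve_left hf0
  rw [h3] at r10 r11 hk
  have hk0 : k 0 = 0 := by
    have : η * k 0 = 0 := by linear_combination r10
    exact (mul_eq_zero.1 this).resolve_left hη0
  rw [hk0] at r11 hk
  refine ⟨f, c, k 2, η, k 1, hf0, hη, by linear_combination r11, ?_, hc.symm, ?_⟩
  · rw [← hf, zero_smul, zero_add]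
  · rw [hk, zero_smul, zero_smul, zero_add, add_zero]

/-- The sign η is locally constant, so [X', L'] is η f [X, L] plus a multiple of L. Pairing with X'
= η X + h L, everything involving L drops out and η² = 1 leaves the factor f. -/
theorem lieBracket_frame_change {β : E4 →L[ℝ] E4 →L[ℝ] ℝ} {X L X' L' : E4 → E4} {η h f : E4 → ℝ}
    {x : E4} (hX : DifferentiableAt ℝ X x) (hL : DifferentiableAt ℝ L x)
    (hη : DifferentiableAt ℝ η x) (hh : DifferentiableAt ℝ h x) (hf : DifferentiableAt ℝ f x)
    (hη1 : ∀ᶠ z in 𝓝 x, η z ^ 2 = 1) (hX' : X' =ᶠ[𝓝 x] fun z => η z • X z + h z • L z)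
    (hL' : L' =ᶠ[𝓝 x] fun z => f z • L z) (hLX : β (L x) (X x) = 0) (hLL : β (L x) (L x) = 0)
    (hXL : β (lieBracket ℝ X L x) (L x) = 0) :
    β (lieBracket ℝ X' L' x) (X' x) = f x * β (lieBracket ℝ X L x) (X x) := by
  have hη0 : fderiv ℝ η x = 0 := by
    have h1 : fderiv ℝ (fun z => η z ^ 2) x = 0 := by
      have h2 : (fun z => η z ^ 2) =ᶠ[𝓝 x] fun _ => 1 := hη1
      rw [h2.fderiv_eq]
      exact fderiv_const_apply _
    rw [(hη.hasFDerivAt.pow 2).fderiv] at h1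
    have h3 : η x ≠ 0 := by
      intro h0
      have := hη1.self_of_nhds
      norm_num [h0] at this
    have h4 : (2 * η x) • fderiv ℝ η x = 0 := by simpa using h1
    exact (smul_eq_zero.1 h4).resolve_left (mul_ne_zero two_ne_zero h3)
  have hb : lieBracket ℝ X' L' x = (η x * f x) • lieBracket ℝ X L x +
      (fderiv ℝ f x (X' x) - f x * fderiv ℝ h x (L x)) • L x := by
    rw [hX'.lieBracket_vectorField_eq (𝕜 := ℝ) hL', hX'.self_of_nhds]
    simp only [lieBracket]
    rw [((hη.hasFDerivAt.fun_smul hX.hasFDerivAt).fun_add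
        (hh.hasFDerivAt.fun_smul hL.hasFDerivAt)).fderiv,
      (hf.hasFDerivAt.fun_smul hL.hasFDerivAt).fderiv, hη0]
    simp only [add_apply, smul_apply, ContinuousLinearMap.smulRight_apply, map_add, map_smul,
      zero_apply, zero_smul]
    module
  have hη2 := hη1.self_of_nhds
  rw [hb, hX'.self_of_nhds]
  simp only [map_add, map_smul, add_apply, smul_apply, smul_eq_mul, hLX, hLL, hXL]
  linear_combination (f x * β (lieBracket ℝ X L x) (X x)) * hη2

/-- The equality of the two parts of the null mean curvature does not depend on the frame adapted
to the foliation. -/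
theorem equipartition_change {β : E4 → E4 →L[ℝ] E4 →L[ℝ] ℝ} {b b' : Fin 4 → E4 → E4} {x : E4}
    (hb : ∀ᶠ z in 𝓝 x, IsNullFrame (β z) fun i => b i z)
    (hb' : ∀ᶠ z in 𝓝 x, IsNullFrame (β z) fun i => b' i z)
    (hd : ∀ i, DifferentiableAt ℝ (b i) x) (hd' : ∀ i, DifferentiableAt ℝ (b' i) x)
    (h0 : ∀ᶠ z in 𝓝 x, b' 0 z ∈ Submodule.span ℝ {b 0 z, b 2 z})
    (h2 : ∀ᶠ z in 𝓝 x, b' 2 z ∈ Submodule.span ℝ {b 0 z, b 2 z})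
    (hSL : β x (lieBracket ℝ (b 0) (b 2) x) (b 2 x) = 0)
    (hAL : β x (lieBracket ℝ (b 1) (b 2) x) (b 2 x) = 0)
    (h : β x (lieBracket ℝ (b' 0) (b' 2) x) (b' 0 x) =
      β x (lieBracket ℝ (b' 1) (b' 2) x) (b' 1 x)) :
    β x (lieBracket ℝ (b 0) (b 2) x) (b 0 x) = β x (lieBracket ℝ (b 1) (b 2) x) (b 1 x) := by
  have hdet := hb.self_of_nhds.det_ne_zero
  have hk : ∀ i j, DifferentiableAt ℝ (fun z => frameCoeff (fun m => b m z) i (b' j z)) x :=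
    fun i j => differentiableAt_frameCoeff hd (hd' j) hdet i
  have key : ∀ᶠ z in 𝓝 x, frameCoeff (fun m => b m z) 2 (b' 2 z) ≠ 0 ∧
      frameCoeff (fun m => b m z) 0 (b' 0 z) ^ 2 = 1 ∧
      frameCoeff (fun m => b m z) 1 (b' 1 z) ^ 2 = 1 ∧
      b' 2 z = frameCoeff (fun m => b m z) 2 (b' 2 z) • b 2 z ∧
      b' 0 z = frameCoeff (fun m => b m z) 0 (b' 0 z) • b 0 z +
        frameCoeff (fun m => b m z) 2 (b' 0 z) • b 2 z ∧
      b' 1 z = frameCoeff (fun m => b m z) 1 (b' 1 z) • b 1 z +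
        frameCoeff (fun m => b m z) 2 (b' 1 z) • b 2 z := by
    filter_upwards [hb, hb', h0, h2] with z hz hz' hz0 hz2
    obtain ⟨f, c, k, η, ε, hf, hη, hε, e2, e0, e1⟩ := hz.change hz' hz0 hz2
    have hdz := hz.det_ne_zero
    have c2 : frameCoeff (fun m => b m z) 2 (b' 2 z) = f := by
      have := (frameCoeff_pair hdz (i := 0) (j := 2) (by decide) 0 f).2
      rwa [zero_smul, zero_add, ← e2] at this
    obtain ⟨c00, c02⟩ := frameCoeff_pair hdz (i := 0) (j := 2) (by decide) η c
    obtain ⟨c11, c12⟩ := frameCoeff_pair hdz (i := 1) (j := 2) (by decide) ε k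
    rw [← e0] at c00 c02
    rw [← e1] at c11 c12
    rw [c2, c00, c02, c11, c12]
    exact ⟨hf, hη, hε, e2, e0, e1⟩
  have hx := hb.self_of_nhds
  -- The pairs (s, l) and (a, l) acquire the same factor f, the coefficient in l' = f l, which is
  -- nonzero and cancels.
  have r0 := lieBracket_frame_change (β := β x) (hd 0) (hd 2) (hk 0 0) (hk 2 0) (hk 2 2)
    (key.mono fun z hz => hz.2.1) (key.mono fun z hz => hz.2.2.2.2.1)
    (key.mono fun z hz => hz.2.2.2.1) (hx 2 0) (hx 2 2) hSL
  have r1 := lieBracket_frame_change (β := β x) (hd 1) (hd 2) (hk 1 1) (hk 2 1) (hk 2 2)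
    (key.mono fun z hz => hz.2.2.1) (key.mono fun z hz => hz.2.2.2.2.2)
    (key.mono fun z hz => hz.2.2.2.1) (hx 2 1) (hx 2 2) hAL
  rw [r0, r1] at h
  exact mul_left_cancel₀ key.self_of_nhds.1 h

/-- A plane field contained in `{v | v 2 = v 3 = 0}` is closed under brackets. -/
theorem lieBracket_coord_eq_zero {X Y : E4 → E4} {x : E4} (hX : DifferentiableAt ℝ X x)
    (hY : DifferentiableAt ℝ Y x) {i : Fin 4} (hXi : ∀ᶠ z in 𝓝 x, X z i = 0)
    (hYi : ∀ᶠ z in 𝓝 x, Y z i = 0) : lieBracket ℝ X Y x i = 0 := by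
  have h : ∀ {Z : E4 → E4}, DifferentiableAt ℝ Z x → (∀ᶠ z in 𝓝 x, Z z i = 0) →
      ∀ v, fderiv ℝ Z x v i = 0 := by
    intro Z hZ hZi v
    have h1 := ((EuclideanSpace.proj i : E4 →L[ℝ] ℝ).hasFDerivAt.comp x hZ.hasFDerivAt).fderiv
    have h2 : (EuclideanSpace.proj i : E4 →L[ℝ] ℝ) ∘ Z =ᶠ[𝓝 x] fun _ => 0 := hZi
    rw [h2.fderiv_eq, fderiv_const_apply] at h1
    exact (congrArg (fun T : E4 →L[ℝ] ℝ => T v) h1).symm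
  rw [lieBracket, PiLp.sub_apply, h hX hXi, h hY hYi, sub_zero]

end FrameChange

/-! ### Null field sheet foliations -/

section AdaptedFrame

variable {M : Type*} [TopologicalSpace M]

theorem eventually_mem_target_inter {e : OpenPartialHomeomorph M E4} {W : Set M}
    (hW : IsOpen W) {y : E4} (hy : y ∈ e.target) (hyW : e.symm y ∈ W) :
    ∀ᶠ z in 𝓝 y, z ∈ e.target ∧ e.symm z ∈ W :=
  Filter.Eventually.and (e.open_target.mem_nhds hy)
    ((e.symm.continuousAt hy).preimage_mem_nhds (hW.mem_nhds hyW))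

variable [ChartedSpace E4 M]

theorem dirDeriv_of_eqOn_const {U : Set M} (hU : IsOpen U) {X : ∀ p : M, TS p} {f : M → ℝ} {c : ℝ}
    (hf : ∀ q ∈ U, f q = c) {p : M} (hp : p ∈ U) : dirDeriv X f p = 0 := by
  have h : HasMFDerivAt 𝓘(ℝ, E4) 𝓘(ℝ, ℝ) f p (0 : TS p →L[ℝ] TangentSpace 𝓘(ℝ, ℝ) (f p)) :=
    (hasMFDerivAt_const c p).congr_of_eventuallyEq
      (Filter.mem_of_superset (hU.mem_nhds hp) hf)
  rw [dirDeriv, h.mfderiv]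
  exact map_zero _

variable {e : OpenPartialHomeomorph M E4} {s l a n : ∀ p : M, TS p}

/-- The frame `(s, a, l, n)` in the coordinates of the chart `e`. -/
def coordFrame (e : OpenPartialHomeomorph M E4) (s l a n : ∀ p : M, TS p) : Fin 4 → E4 → E4 :=
  ![coordField e s, coordField e a, coordField e l, coordField e n]

theorem coordField_mem_span {X Y Z : ∀ p : M, TS p} {y : E4}
    (h : X (e.symm y) ∈ Submodule.span ℝ {Y (e.symm y), Z (e.symm y)}) :
    coordField e X y ∈ Submodule.span ℝ {coordField e Y y, coordField e Z y} := by
  obtain ⟨c, d, hcd⟩ := Submodule.mem_span_pair.1 h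
  refine Submodule.mem_span_pair.2 ⟨c, d, ?_⟩
  rw [coordField, coordField, coordField, ← hcd, map_add, map_smul, map_smul]

variable [IsManifold 𝓘(ℝ, E4) ∞ M] {g : LorentzMetric M} {D : ∀ p : M, Submodule ℝ (TS p)}
  {U : Set M}

theorem pair_comm (X Y : ∀ p : M, TS p) (p : M) : pair g X Y p = pair g Y X p := g.symm p _ _

theorem IsAdaptedFrame.isNullFrame (h : IsAdaptedFrame g D U s l a n)
    (he : e ∈ IsManifold.maximalAtlas 𝓘(ℝ, E4) ∞ M) {y : E4} (hy : y ∈ e.target)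
    (hyU : e.symm y ∈ U) : IsNullFrame (coordMetric g e y) fun i => coordFrame e s l a n i y := by
  have hc : ∀ X Y, coordMetric g e y (coordField e X y) (coordField e Y y)
    = pair g X Y (e.symm y) := coordMetric_coordField he g hy
  have hs : ∀ X Y, pair g X Y (e.symm y) = pair g Y X (e.symm y) := fun X Y => pair_comm X Y _
  intro i j
  fin_cases i <;> fin_cases j
  · exact (hc s s).trans (h.ss _ hyU)
  · exact (hc s a).trans (h.sa _ hyU)
  · exact (hc s l).trans (h.sl _ hyU)
  · exact (hc s n).trans (h.sn _ hyU)
  · exact (hc a s).trans ((hs a s).trans (h.sa _ hyU))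
  · exact (hc a a).trans (h.aa _ hyU)
  · exact (hc a l).trans ((hs a l).trans (h.la _ hyU))
  · exact (hc a n).trans (h.an _ hyU)
  · exact (hc l s).trans ((hs l s).trans (h.sl _ hyU))
  · exact (hc l a).trans (h.la _ hyU)
  · exact (hc l l).trans (h.ll _ hyU)
  · exact (hc l n).trans (h.ln _ hyU)
  · exact (hc n s).trans ((hs n s).trans (h.sn _ hyU))
  · exact (hc n a).trans ((hs n a).trans (h.an _ hyU))
  · exact (hc n l).trans ((hs n l).trans (h.ln _ hyU))
  · exact (hc n n).trans (h.nn _ hyU)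

theorem IsAdaptedFrame.contDiffAt (h : IsAdaptedFrame g D U s l a n) (hU : IsOpen U)
    (he : e ∈ IsManifold.maximalAtlas 𝓘(ℝ, E4) ∞ M) {y : E4} (hy : y ∈ e.target)
    (hyU : e.symm y ∈ U) (i : Fin 4) : ContDiffAt ℝ ∞ (coordFrame e s l a n i) y := by
  fin_cases i
  · exact contDiffAt_coordField he hU h.smooth_s hy hyU
  · exact contDiffAt_coordField he hU h.smooth_a hy hyU
  · exact contDiffAt_coordField he hU h.smooth_l hy hyU
  · exact contDiffAt_coordField he hU h.smooth_n hy hyU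

theorem IsAdaptedFrame.differentiableAt (h : IsAdaptedFrame g D U s l a n) (hU : IsOpen U)
    (he : e ∈ IsManifold.maximalAtlas 𝓘(ℝ, E4) ∞ M) {y : E4} (hy : y ∈ e.target)
    (hyU : e.symm y ∈ U) (i : Fin 4) : DifferentiableAt ℝ (coordFrame e s l a n i) y :=
  (h.contDiffAt hU he hy hyU i).differentiableAt (by simp)

/-- All inner products in the Koszul formula are constant, so only the bracket terms remain; [X, X]
= 0 and the other two are equal. -/
theorem gNabla_eq_pair_mlieBracket (hU : IsOpen U) {X l : ∀ p : M, TS p} {c : ℝ}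
    (hXX : ∀ q ∈ U, pair g X X q = c) (hXl : ∀ q ∈ U, pair g X l q = 0) {p : M} (hp : p ∈ U) :
    gNabla g X l X p = pair g (mlieBracket 𝓘(ℝ, E4) X l) X p := by
  have hlX : ∀ q ∈ U, pair g l X q = 0 := fun q hq => (pair_comm l X q).trans (hXl q hq)
  have h1 : pair g (mlieBracket 𝓘(ℝ, E4) l X) X p = -pair g (mlieBracket 𝓘(ℝ, E4) X l) X p := by
    rw [pair, pair, mlieBracket_swap_apply, map_neg, neg_apply]
  have h2 : pair g (mlieBracket 𝓘(ℝ, E4) X X) l p = 0 := by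
    rw [pair, mlieBracket_self]
    exact congrArg (fun T : TS p →L[ℝ] ℝ => T (l p)) (map_zero (g.val p))
  rw [gNabla, dirDeriv_of_eqOn_const hU hlX hp, dirDeriv_of_eqOn_const hU hXX hp,
    dirDeriv_of_eqOn_const hU hXl hp, h1, h2]
  ring

/-- The tangent planes of a foliation are closed under brackets. -/
theorem Foliation.mlieBracket_mem (𝓕 : Foliation M) (hU : IsOpen U) {X Y : ∀ p : M, TS p}
    (hX : SmoothField U X) (hY : SmoothField U Y) (hXT : ∀ q ∈ U, X q ∈ 𝓕.tangent q)
    (hYT : ∀ q ∈ U, Y q ∈ 𝓕.tangent q) {p : M} (hp : p ∈ U) :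
    mlieBracket 𝓘(ℝ, E4) X Y p ∈ 𝓕.tangent p := by
  obtain ⟨e, ⟨he, hT, -⟩, hpe⟩ := 𝓕.exists_chart p
  obtain ⟨y, hy, rfl⟩ : ∃ y ∈ e.target, e.symm y = p := ⟨e p, e.map_source hpe, e.left_inv hpe⟩
  have hev := eventually_mem_target_inter hU hy hp
  have hdX := (contDiffAt_coordField he hU hX hy hp).differentiableAt (by simp)
  have hdY := (contDiffAt_coordField he hU hY hy hp).differentiableAt (by simp)
  have hb := lieBracket_coordField he hU hX hY hy hp
  rw [hT _ hpe, dCoord_apply, dCoord_apply]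
  have hbi : ∀ i, chartDeriv e (e.symm y) (mlieBracket 𝓘(ℝ, E4) X Y (e.symm y)) i =
      lieBracket ℝ (coordField e X) (coordField e Y) y i := fun i => by rw [hb, coordField]
  rw [hbi, hbi]
  constructor
  · exact lieBracket_coord_eq_zero hdX hdY
      (hev.mono fun z hz => ((hT _ (e.map_target hz.1) _).1 (hXT _ hz.2)).1)
      (hev.mono fun z hz => ((hT _ (e.map_target hz.1) _).1 (hYT _ hz.2)).1)
  · exact lieBracket_coord_eq_zero hdX hdY
      (hev.mono fun z hz => ((hT _ (e.map_target hz.1) _).1 (hXT _ hz.2)).2)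
      (hev.mono fun z hz => ((hT _ (e.map_target hz.1) _).1 (hYT _ hz.2)).2)

/-- In a null field sheet foliation with `α♯` and `l` in involution, the brackets `[s, l]` and
`[α♯, l]` have the same component along `s` and `α♯` respectively. -/
theorem IsNullFieldSheetFoliation.exists_bracket_coeff {𝓕 : Foliation M}
    (h𝓕 : IsNullFieldSheetFoliation g 𝓕) (hU : IsOpen U)
    (h : IsAdaptedFrame g 𝓕.tangent U s l a n)
    (hinv : ∀ p ∈ U, mlieBracket 𝓘(ℝ, E4) a l p ∈ spanField a l p) {p : M} (hp : p ∈ U) :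
    ∃ c q t : ℝ, mlieBracket 𝓘(ℝ, E4) s l p = c • s p + q • l p ∧
      mlieBracket 𝓘(ℝ, E4) a l p = c • a p + t • l p := by
  obtain ⟨V, hV, hpV, s', l', a', n', h', -, hθ⟩ := h𝓕.2 p
  have hsT : ∀ q ∈ U, s q ∈ 𝓕.tangent q := fun q hq => by
    rw [h.tangent_eq q hq]; exact Submodule.subset_span (by simp)
  have hlT : ∀ q ∈ U, l q ∈ 𝓕.tangent q := fun q hq => by
    rw [h.tangent_eq q hq]; exact Submodule.subset_span (by simp)
  have hsl := 𝓕.mlieBracket_mem hU h.smooth_s h.smooth_l hsT hlT hp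
  rw [h.tangent_eq p hp] at hsl
  obtain ⟨c, q, hcq⟩ := Submodule.mem_span_pair.1 hsl
  obtain ⟨c', t, hct⟩ := Submodule.mem_span_pair.1 (hinv p hp)
  -- The mean curvature is the average of two terms, so it equals the first precisely when the two
  -- agree.
  have e1 : pair g (mlieBracket 𝓘(ℝ, E4) s' l') s' p =
      pair g (mlieBracket 𝓘(ℝ, E4) a' l') a' p := by
    have h1 := hθ p hpV
    rw [nullMeanCurvature, gNabla_eq_pair_mlieBracket hV h'.ss h'.sl hpV,
      gNabla_eq_pair_mlieBracket hV h'.aa (fun q hq => (pair_comm _ _ _).trans (h'.la q hq)) hpV]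
      at h1
    linarith
  obtain ⟨e, he, hpe⟩ : ∃ e ∈ IsManifold.maximalAtlas 𝓘(ℝ, E4) ∞ M, p ∈ e.source :=
    ⟨chartAt E4 p, IsManifold.chart_mem_maximalAtlas p, mem_chart_source E4 p⟩
  obtain ⟨y, hy, rfl⟩ : ∃ y ∈ e.target, e.symm y = p := ⟨e p, e.map_source hpe, e.left_inv hpe⟩
  have hevU := eventually_mem_target_inter hU hy hp
  have hevV := eventually_mem_target_inter hV hy hpV
  have hbs := lieBracket_coordField he hU h.smooth_s h.smooth_l hy hp
  have hba := lieBracket_coordField he hU h.smooth_a h.smooth_l hy hp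
  have hbs' := lieBracket_coordField he hV h'.smooth_s h'.smooth_l hy hpV
  have hba' := lieBracket_coordField he hV h'.smooth_a h'.smooth_l hy hpV
  have hnull := h.isNullFrame he hy hp
  have hs : coordField e (mlieBracket 𝓘(ℝ, E4) s l) y =
      c • coordField e s y + q • coordField e l y := by
    rw [coordField, coordField, coordField, ← hcq, map_add, map_smul, map_smul]
  have ha : coordField e (mlieBracket 𝓘(ℝ, E4) a l) y =
      c' • coordField e a y + t • coordField e l y := by
    rw [coordField, coordField, coordField, ← hct, map_add, map_smul, map_smul]
  have mss : coordMetric g e y (coordField e s y) (coordField e s y) = 1 := hnull 0 0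
  have maa : coordMetric g e y (coordField e a y) (coordField e a y) = 1 := hnull 1 1
  have msl : coordMetric g e y (coordField e s y) (coordField e l y) = 0 := hnull 0 2
  have mls : coordMetric g e y (coordField e l y) (coordField e s y) = 0 := hnull 2 0
  have mla : coordMetric g e y (coordField e l y) (coordField e a y) = 0 := hnull 2 1
  have mal : coordMetric g e y (coordField e a y) (coordField e l y) = 0 := hnull 1 2
  have mll : coordMetric g e y (coordField e l y) (coordField e l y) = 0 := hnull 2 2
  have key := equipartition_change (β := coordMetric g e) (b := coordFrame e s l a n)
    (b' := coordFrame e s' l' a' n') (x := y)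
    (hevU.mono fun z hz => h.isNullFrame he hz.1 hz.2)
    (hevV.mono fun z hz => h'.isNullFrame he hz.1 hz.2)
    (h.differentiableAt hU he hy hp) (h'.differentiableAt hV he hy hpV)
    (by
      filter_upwards [hevU, hevV] with z hzU hzV
      refine coordField_mem_span (X := s') (Y := s) (Z := l) ?_
      change _ ∈ spanField s l _
      rw [← h.tangent_eq _ hzU.2, h'.tangent_eq _ hzV.2]
      exact Submodule.subset_span (by simp))
    (by
      filter_upwards [hevU, hevV] with z hzU hzV
      refine coordField_mem_span (X := l') (Y := s) (Z := l) ?_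
      change _ ∈ spanField s l _
      rw [← h.tangent_eq _ hzU.2, h'.tangent_eq _ hzV.2]
      exact Submodule.subset_span (by simp))
    (by
      change coordMetric g e y (lieBracket ℝ (coordField e s) (coordField e l) y)
        (coordField e l y) = 0
      rw [hbs, hs]
      simp [msl, mll])
    (by
      change coordMetric g e y (lieBracket ℝ (coordField e a) (coordField e l) y)
        (coordField e l y) = 0
      rw [hba, ha]
      simp [mal, mll])
    (by
      change coordMetric g e y (lieBracket ℝ (coordField e s') (coordField e l') y)
        (coordField e s' y) = coordMetric g e y (lieBracket ℝ (coordField e a') (coordField e l') y)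
        (coordField e a' y)
      rw [hbs', hba', coordMetric_coordField he g hy, coordMetric_coordField he g hy, e1])
  change coordMetric g e y (lieBracket ℝ (coordField e s) (coordField e l) y) (coordField e s y) =
    coordMetric g e y (lieBracket ℝ (coordField e a) (coordField e l) y) (coordField e a y) at key
  rw [hbs, hba, hs, ha] at key
  -- Pairing c s + q l with s, and c' a + t l with a, isolates c and c'.
  have hcc : c = c' := by simpa [mss, maa, mls, mla] using key
  subst hcc
  exact ⟨c, q, t, hcq.symm, hct.symm⟩

end AdaptedFrame

/-! ### Null force-free fields -/

section ForceFree

variable {M : Type*} [TopologicalSpace M] {e : OpenPartialHomeomorph M E4}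

theorem exists_eq_symm {q : M} (hq : q ∈ e.source) : ∃ y ∈ e.target, e.symm y = q :=
  ⟨e q, e.map_source hq, e.left_inv hq⟩

variable [ChartedSpace E4 M] {s l a n : ∀ p : M, TS p}

theorem eq_of_localForm_eq (he : e ∈ IsManifold.maximalAtlas 𝓘(ℝ, E4) ∞ M) {k : ℕ}
    {F G : DiffForm M k} {q : M} (hq : q ∈ e.source)
    (h : localForm e F (e q) = localForm e G (e q)) : F q = G q := by
  ext w
  rw [← localForm_chartDeriv he F hq, ← localForm_chartDeriv he G hq, h]

theorem adaptedForm_apply (u : ℝ × ℝ → ℝ) (q : M) (v w : TS q) :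
    adaptedForm e u q ![v, w] =
      leafFun e u q * (dCoord e 2 q v * dCoord e 3 q w - dCoord e 3 q v * dCoord e 2 q w) := by
  rw [adaptedForm, ContinuousAlternatingMap.smul_apply, wedge_two_apply, smul_eq_mul]

variable [IsManifold 𝓘(ℝ, E4) ∞ M] {g : LorentzMetric M} {D : ∀ p : M, Submodule ℝ (TS p)}
  {U : Set M}

theorem IsAdaptedChart.subset_kernelAt (he : IsAdaptedChart D e) (u : ℝ × ℝ → ℝ) {q : M}
    (hq : q ∈ e.source) : (D q : Set (TS q)) ⊆ kernelAt (adaptedForm e u) q := by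
  intro v hv w
  obtain ⟨h2, h3⟩ := (he.2.1 q hq v).1 hv
  rw [adaptedForm_apply, h2, h3]
  ring

theorem IsAdaptedChart.not_mem (he : IsAdaptedChart D e) {y : E4} (hy : y ∈ e.target) :
    chartInvDeriv e y (stdVec 2) ∉ D (e.symm y) := by
  intro h
  have h2 := ((he.2.1 _ (e.map_target hy) _).1 h).1
  rw [dCoord_chartInvDeriv he.1 hy] at h2
  simp at h2

theorem IsAdaptedChart.mem (he : IsAdaptedChart D e) {y : E4} (hy : y ∈ e.target) {v : E4}
    (h2 : v 2 = 0) (h3 : v 3 = 0) : chartInvDeriv e y v ∈ D (e.symm y) := by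
  rw [he.2.1 _ (e.map_target hy), dCoord_chartInvDeriv he.1 hy, dCoord_chartInvDeriv he.1 hy]
  exact ⟨h2, h3⟩

theorem IsAdaptedChart.kernelAt_eq_iff (he : IsAdaptedChart D e) (u : ℝ × ℝ → ℝ) {q : M}
    (hq : q ∈ e.source) : kernelAt (adaptedForm e u) q = D q ↔ leafFun e u q ≠ 0 := by
  obtain ⟨y, hy, rfl⟩ := exists_eq_symm hq
  constructor
  · intro h h0
    refine he.not_mem hy ?_
    have : chartInvDeriv e y (stdVec 2) ∈ kernelAt (adaptedForm e u) (e.symm y) := fun w => by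
      rw [adaptedForm_apply, h0, zero_mul]
    rwa [h] at this
  · intro h0
    refine Subset.antisymm (fun v hv => ?_) (he.subset_kernelAt u hq)
    have h2 := hv (chartInvDeriv e y (stdVec 3))
    have h3 := hv (chartInvDeriv e y (stdVec 2))
    rw [adaptedForm_apply, dCoord_chartInvDeriv he.1 hy, dCoord_chartInvDeriv he.1 hy] at h2 h3
    refine (he.2.1 _ hq v).2 ⟨?_, ?_⟩
    · simpa [h0] using h2
    · simpa [h0] using h3

/-- A closed `2`-form annihilated by `α♯` and `l` is a null force-free field if the brackets
`[s, l]` and `[α♯, l]` have the same component along `s` and `α♯` respectively. -/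
theorem IsAdaptedFrame.isNullForceFree (h : IsAdaptedFrame g D U s l a n) (hU : IsOpen U)
    (hbr : ∀ p ∈ U, ∃ c q t : ℝ, mlieBracket 𝓘(ℝ, E4) s l p = c • s p + q • l p ∧
      mlieBracket 𝓘(ℝ, E4) a l p = c • a p + t • l p) {V : Set M} (hV : IsOpen V) (hVU : V ⊆ U)
    {F : DiffForm M 2}
    (hF : ∀ e ∈ IsManifold.maximalAtlas 𝓘(ℝ, E4) ∞ M, ∀ y ∈ e.target, e.symm y ∈ V →
      ContDiffAt ℝ ∞ (localForm e F) y)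
    (hd : ∀ e ∈ IsManifold.maximalAtlas 𝓘(ℝ, E4) ∞ M, ∀ y ∈ e.target, e.symm y ∈ V →
      extDeriv (localForm e F) y = 0)
    (ha : ∀ p ∈ V, a p ∈ kernelAt F p) (hl : ∀ p ∈ V, l p ∈ kernelAt F p) :
    IsNullForceFree g V F where
  smooth := fun e he y hy => (hF e he y hy.1 hy.2).contDiffWithinAt
  closed := hd
  forceFree := by
    intro e he y hy hyV v
    have hev := eventually_mem_target_inter hV hy hyV
    obtain ⟨c, q, t, hs, ht⟩ := hbr _ (hVU hyV)
    refine force_free_of_brackets (β := coordMetric g e) (b := coordFrame e s l a n)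
      (hev.mono fun z hz => h.isNullFrame he hz.1 (hVU hz.2))
      (h.differentiableAt hU he hy (hVU hyV)) ((hF e he y hy hyV).differentiableAt (by simp))
      (hev.mono fun z hz => localForm_coordField he hz.1 (ha _ hz.2))
      (hev.mono fun z hz => localForm_coordField he hz.1 (hl _ hz.2))
      (hd e he y hy hyV) (p := c) (q := q) (t := t) ?_ ?_ v
    · refine (lieBracket_coordField he hU h.smooth_s h.smooth_l hy (hVU hyV)).trans ?_
      rw [coordField, hs, map_add, map_smul, map_smul]
      rfl
    · refine (lieBracket_coordField he hU h.smooth_a h.smooth_l hy (hVU hyV)).trans ?_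
      rw [coordField, ht, map_add, map_smul, map_smul]
      rfl
  null := fun e he y hy hyV => formSq_eq_zero (h.isNullFrame he hy (hVU hyV))
    (localForm_coordField he hy (ha _ hyV)) (localForm_coordField he hy (hl _ hyV))

theorem flatComp_symm (X : ∀ p : M, TS p) (i : Fin 4) {y : E4} (hy : y ∈ e.target) :
    flatComp g e X i (e.symm y) = flat g X (e.symm y) (chartInvDeriv e y (stdVec i)) :=
  congrArg (fun z => flat g X (e.symm z) (chartInvDeriv e z (stdVec i))) (e.right_inv hy)

/-- Both s♭ and l♭ annihilate the span of α♯ and l, which is the common kernel of dx³ and dx⁴. They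
are therefore combinations of dx³ and dx⁴, and their wedge is the determinant of the coefficients
times dx³ ∧ dx⁴. -/
theorem IsAdaptedFrame.adaptedForm_eq (h : IsAdaptedFrame g D U s l a n)
    (he : IsAdaptedChart (spanField a l) e) (u : ℝ × ℝ → ℝ) {q : M} (hq : q ∈ e.source)
    (hqU : q ∈ U) : adaptedForm e u q = (leafFun e u q * kappa g e s l q) •
      wedge ![flat g s q, flat g l q] := by
  obtain ⟨y, hy, rfl⟩ := exists_eq_symm hq
  have hexp : ∀ X : ∀ p : M, TS p, pair g X a (e.symm y) = 0 → pair g X l (e.symm y) = 0 →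
      ∀ v, flat g X (e.symm y) v = flatComp g e X 2 (e.symm y) * dCoord e 2 (e.symm y) v +
        flatComp g e X 3 (e.symm y) * dCoord e 3 (e.symm y) v := by
    intro X hXa hXl v
    have h0 : ∀ w ∈ spanField a l (e.symm y), flat g X (e.symm y) w = 0 := by
      intro w hw
      obtain ⟨c, d, rfl⟩ := Submodule.mem_span_pair.1 hw
      have h1 : flat g X (e.symm y) (a (e.symm y)) = 0 := hXa
      have h2 : flat g X (e.symm y) (l (e.symm y)) = 0 := hXl
      rw [map_add, map_smul, map_smul, h1, h2, smul_zero, smul_zero, add_zero]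
    have h1 := h0 (v - dCoord e 2 (e.symm y) v • chartInvDeriv e y (stdVec 2)
      - dCoord e 3 (e.symm y) v • chartInvDeriv e y (stdVec 3)) (by
        rw [he.2.1 _ hq]
        simp only [map_sub, map_smul, dCoord_chartInvDeriv he.1 hy]
        simp)
    rw [map_sub, map_sub, map_smul, map_smul, smul_eq_mul, smul_eq_mul, ← flatComp_symm X 2 hy,
      ← flatComp_symm X 3 hy] at h1
    linarith
  have hs := hexp s (h.sa _ hqU) (h.sl _ hqU)
  have hl := hexp l (h.la _ hqU) (h.ll _ hqU)
  have hw : ∀ v w, flat g s (e.symm y) v * flat g l (e.symm y) w -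
      flat g l (e.symm y) v * flat g s (e.symm y) w =
      (flatComp g e s 2 (e.symm y) * flatComp g e l 3 (e.symm y) -
        flatComp g e s 3 (e.symm y) * flatComp g e l 2 (e.symm y)) *
      (dCoord e 2 (e.symm y) v * dCoord e 3 (e.symm y) w -
        dCoord e 3 (e.symm y) v * dCoord e 2 (e.symm y) w) := by
    intro v w
    rw [hs, hs, hl, hl]
    ring
  have hne : flatComp g e s 2 (e.symm y) * flatComp g e l 3 (e.symm y) -
      flatComp g e s 3 (e.symm y) * flatComp g e l 2 (e.symm y) ≠ 0 := by
    intro h0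
    -- On (s, n) the form s♭ ∧ l♭ takes the value -1, so the determinant cannot vanish.
    have h1 := hw (s (e.symm y)) (n (e.symm y))
    have hss : flat g s (e.symm y) (s (e.symm y)) = 1 := h.ss _ hqU
    have hln : flat g l (e.symm y) (n (e.symm y)) = -1 := h.ln _ hqU
    have hsn : flat g s (e.symm y) (n (e.symm y)) = 0 := h.sn _ hqU
    rw [h0, hss, hln, hsn] at h1
    norm_num at h1
  ext v
  have hv : v = ![v 0, v 1] := by
    ext i : 1
    fin_cases i <;> rfl
  rw [hv, adaptedForm_apply, ContinuousAlternatingMap.smul_apply, wedge_two_apply, hw, kappa,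
    smul_eq_mul]
  field_simp

end ForceFree

/-! ### Null force-free fields with kernel span{α♯, l} -/

section Converse

variable {M : Type*} [TopologicalSpace M] {e : OpenPartialHomeomorph M E4}

theorem eq_leafWedge {η : E4 [⋀^Fin 2]→L[ℝ] ℝ} (h0 : ∀ w, η ![stdVec 0, w] = 0)
    (h1 : ∀ w, η ![stdVec 1, w] = 0) : η = η ![stdVec 2, stdVec 3] • leafWedge := by
  have hv : ∀ v w : E4, η ![v, w] = v 2 * η ![stdVec 2, w] + v 3 * η ![stdVec 3, w] := by
    intro v w
    conv_lhs => rw [← sum_coord_smul_stdVec v, Fin.sum_univ_four]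
    rw [form_add_left, form_add_left, form_add_left, form_smul_left, form_smul_left,
      form_smul_left, form_smul_left, h0, h1]
    ring
  ext v
  have e : v = ![v 0, v 1] := by
    ext i : 1
    fin_cases i <;> rfl
  rw [e, ContinuousAlternatingMap.smul_apply, leafWedge_apply, hv, form_swap η (stdVec 2),
    form_swap η (stdVec 3), hv, hv (v 1) (stdVec 3), form_self, form_self,
    form_swap η (stdVec 3) (stdVec 2), smul_eq_mul]
  ring

/-- A function on the domain of a chart with connected slices, with vanishing derivatives along the
slices, is a function of `x³, x⁴`. -/
theorem eq_of_fderiv_eq_zero {f : E4 → ℝ} {T : Set E4} (hT : IsOpen T)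
    (hf : DifferentiableOn ℝ f T)
    (h : ∀ y ∈ T, ∀ v : E4, v 2 = 0 → v 3 = 0 → fderiv ℝ f y v = 0) {c d : ℝ}
    (hc : IsPreconnected {y : E4 | y ∈ T ∧ y 2 = c ∧ y 3 = d}) {y z : E4} (hy : y ∈ T) (hz : z ∈ T)
    (hy2 : y 2 = c) (hy3 : y 3 = d) (hz2 : z 2 = c) (hz3 : z 3 = d) : f y = f z := by
  have : PreconnectedSpace {y : E4 | y ∈ T ∧ y 2 = c ∧ y 3 = d} :=
    isPreconnected_iff_preconnectedSpace.1 hc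
  have hloc : IsLocallyConstant fun w : {y : E4 | y ∈ T ∧ y 2 = c ∧ y 3 = d} => f w := by
    rw [IsLocallyConstant.iff_eventually_eq]
    rintro ⟨w, hwT, hw2, hw3⟩
    obtain ⟨r, hr, hball⟩ := Metric.isOpen_iff.1 hT w hwT
    have hmem : Subtype.val ⁻¹' Metric.ball w r ∈
        𝓝 (⟨w, hwT, hw2, hw3⟩ : {y : E4 | y ∈ T ∧ y 2 = c ∧ y 3 = d}) :=
      continuous_subtype_val.continuousAt.preimage_mem_nhds (Metric.ball_mem_nhds w hr)
    filter_upwards [hmem] with x hx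
    obtain ⟨x, hxT, hx2, hx3⟩ := x
    -- Inside a ball the segment from w to x stays in the domain and its direction is tangent to the
    -- slice, so the mean value theorem gives f x = f w.
    obtain ⟨m, hm, hmx⟩ := domain_mvt (f := f) (f' := fderiv ℝ f) (s := Metric.ball w r)
      (fun m hm => ((hf m (hball hm)).differentiableAt
        (hT.mem_nhds (hball hm))).hasFDerivAt.hasFDerivWithinAt) (convex_ball w r)
      (Metric.mem_ball_self hr) hx
    have hmT : m ∈ T := hball ((convex_ball w r).segment_subset (Metric.mem_ball_self hr) hx hm)
    rw [h m hmT _ (by simp [hx2, hw2]) (by simp [hx3, hw3])] at hmx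
    exact sub_eq_zero.1 hmx
  exact hloc.apply_eq_of_preconnectedSpace ⟨y, hy, hy2, hy3⟩ ⟨z, hz, hz2, hz3⟩

/-- Define u by evaluating f at an arbitrary point of the slice; connectedness makes the choice
immaterial. For smoothness, u agrees near (y 2, y 3) with f composed with an affine section of the
projection. -/
theorem exists_leafFun {f : E4 → ℝ} (hf : ContDiffOn ℝ ∞ f e.target)
    (h : ∀ y ∈ e.target, ∀ v : E4, v 2 = 0 → v 3 = 0 → fderiv ℝ f y v = 0)
    (hc : ∀ c d : ℝ, IsPreconnected {y : E4 | y ∈ e.target ∧ y 2 = c ∧ y 3 = d}) :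
    ∃ u : ℝ × ℝ → ℝ, ContDiffOn ℝ ∞ u (leafSpace e) ∧ ∀ y ∈ e.target, u (y 2, y 3) = f y := by
  let π : E4 → ℝ × ℝ := fun y => (y 2, y 3)
  have hu : ∀ y ∈ e.target, f (Function.invFunOn π e.target (π y)) = f y := by
    intro y hy
    have hex : ∃ x ∈ e.target, π x = π y := ⟨y, hy, rfl⟩
    have h1 := Function.invFunOn_eq hex
    exact eq_of_fderiv_eq_zero e.open_target (hf.differentiableOn (by simp)) h (hc (y 2) (y 3))
      (Function.invFunOn_mem hex) hy (congrArg Prod.fst h1) (congrArg Prod.snd h1) rfl rfl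
  refine ⟨fun z => f (Function.invFunOn π e.target z), ?_, hu⟩
  rintro - ⟨y, hy, rfl⟩
  -- An affine section through y of the projection to (x³, x⁴); it stays in the target near (y 2, y
  -- 3) because the target is open.
  let ι : ℝ × ℝ → E4 := fun z => y + (z.1 - y 2) • stdVec 2 + (z.2 - y 3) • stdVec 3
  have hι : ContDiff ℝ ∞ ι := by fun_prop
  have hιy : ι (y 2, y 3) = y := by simp [ι]
  have hπι : ∀ z, π (ι z) = z := by
    intro z
    ext <;> simp [π, ι]
  have hmem : ∀ᶠ z in 𝓝 (y 2, y 3), ι z ∈ e.target :=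
    hι.continuous.continuousAt.preimage_mem_nhds (by
      rw [hιy]; exact e.open_target.mem_nhds hy)
  have hfι : ContDiffAt ℝ ∞ (fun z => f (ι z)) (y 2, y 3) := by
    refine ContDiffAt.comp (y 2, y 3) (g := f) ?_ hι.contDiffAt
    rw [hιy]
    exact hf.contDiffAt (e.open_target.mem_nhds hy)
  refine (hfι.congr_of_eventuallyEq ?_).contDiffWithinAt
  filter_upwards [hmem] with z hz
  have := hu _ hz
  rwa [hπι] at this

variable [ChartedSpace E4 M] [IsManifold 𝓘(ℝ, E4) ∞ M] {g : LorentzMetric M}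
  {D : ∀ p : M, Submodule ℝ (TS p)}

/-- The kernel leaves only the dx³ ∧ dx⁴ component f, and dF = 0 evaluated on (v, ∂₃, ∂₄) with v
tangent to a slice says df(v) = 0. A zero of f would make the kernel the whole tangent space,
whereas ∂₃ is transverse to the planes. -/
theorem IsAdaptedChart.exists_adaptedForm_eq (he : IsAdaptedChart D e) {F : DiffForm M 2}
    (hF : IsNullForceFree g e.source F) (hk : ∀ q ∈ e.source, kernelAt F q = D q) :
    ∃ u : ℝ × ℝ → ℝ, ContDiffOn ℝ ∞ u (leafSpace e) ∧ (∀ z ∈ leafSpace e, u z ≠ 0) ∧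
      ∀ q ∈ e.source, F q = adaptedForm e u q := by
  have hsm : ContDiffOn ℝ ∞ (localForm e F) e.target :=
    (hF.smooth e he.1).mono fun y hy => ⟨hy, e.map_target hy⟩
  have hker : ∀ y ∈ e.target, ∀ v : E4, v 2 = 0 → v 3 = 0 → ∀ w, localForm e F y ![v, w] = 0 := by
    intro y hy v h2 h3 w
    rw [localForm_two]
    have h1 : chartInvDeriv e y v ∈ kernelAt F (e.symm y) := by
      rw [hk _ (e.map_target hy)]
      exact he.mem hy h2 h3
    exact h1 _
  have heq : ∀ y ∈ e.target,
      localForm e F y = localForm e F y ![stdVec 2, stdVec 3] • leafWedge := fun y hy =>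
    eq_leafWedge (hker y hy _ (by simp) (by simp)) (hker y hy _ (by simp) (by simp))
  have hf : ContDiffOn ℝ ∞ (fun y => localForm e F y ![stdVec 2, stdVec 3]) e.target :=
    (ContinuousAlternatingMap.apply ℝ E4 ℝ ![stdVec 2, stdVec 3]).contDiff.comp_contDiffOn hsm
  have hderiv : ∀ y ∈ e.target, ∀ v : E4, v 2 = 0 → v 3 = 0 →
      fderiv ℝ (fun y => localForm e F y ![stdVec 2, stdVec 3]) y v = 0 := by
    intro y hy v h2 h3
    have hd := hF.closed e he.1 y hy (e.map_target hy)
    have hev : localForm e F =ᶠ[𝓝 y]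
        fun z => localForm e F z ![stdVec 2, stdVec 3] • leafWedge := by
      filter_upwards [e.open_target.mem_nhds hy] with z hz using heq z hz
    rw [hev.extDeriv_eq] at hd
    have h1 := extDeriv_smul_leafWedge ((hf.contDiffAt
      (e.open_target.mem_nhds hy)).differentiableAt (by simp)) ![v, stdVec 2, stdVec 3]
    rw [hd] at h1
    simpa [h2, h3] using h1.symm
  obtain ⟨u, hu, huf⟩ := exists_leafFun hf hderiv he.2.2
  refine ⟨u, hu, ?_, ?_⟩
  · rintro - ⟨y, hy, rfl⟩ h0
    have h1 : localForm e F y = 0 := by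
      rw [heq y hy, ← huf y hy, h0, zero_smul]
    refine he.not_mem hy ?_
    change _ ∈ (D (e.symm y) : Set (TS (e.symm y)))
    rw [← hk _ (e.map_target hy)]
    intro w
    have h2 := localForm_two (e := e) F y (stdVec 2) (chartDeriv e (e.symm y) w)
    rw [chartInvDeriv_chartDeriv he.1 hy, h1] at h2
    exact h2.symm
  · intro q hq
    refine eq_of_localForm_eq he.1 hq ?_
    rw [localForm_adaptedForm he.1 u (e.map_source hq), huf _ (e.map_source hq),
      ← heq _ (e.map_source hq)]

end Converse

/-! ### Charts adapted to an involutive plane field -/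

section AdaptedChart

/-- The common kernel of two covectors on a 4-dimensional space has dimension at least 2 and the
span at most 2, so the inclusion is an equality. Only one direction of adaptedness then has to be
checked for the constructed chart. -/
theorem mem_span_pair_iff_of_ker_le {V : Type*} [AddCommGroup V] [Module ℝ V]
    [FiniteDimensional ℝ V] (hV : Module.finrank ℝ V = 4) (α β : V →ₗ[ℝ] ℝ) {x y : V}
    (h : ∀ v, α v = 0 → β v = 0 → v ∈ Submodule.span ℝ {x, y}) (v : V) :
    v ∈ Submodule.span ℝ {x, y} ↔ α v = 0 ∧ β v = 0 := by
  have hle : LinearMap.ker (α.prod β) ≤ Submodule.span ℝ {x, y} := by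
    intro w hw
    have hw' : α w = 0 ∧ β w = 0 := by simpa using hw
    exact h w hw'.1 hw'.2
  have hrank := LinearMap.finrank_range_add_finrank_ker (α.prod β)
  have hrange : Module.finrank ℝ (LinearMap.range (α.prod β)) ≤ 2 := by
    refine (Submodule.finrank_le _).trans ?_
    simp
  have hspan : Module.finrank ℝ (Submodule.span ℝ {x, y}) ≤ 2 := by
    classical
    have h1 := finrank_span_finset_le_card (R := ℝ) ({x, y} : Finset V)
    rw [Finset.coe_pair] at h1
    exact h1.trans Finset.card_le_two
  rw [← Submodule.eq_of_le_of_finrank_le hle (by omega)]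
  simp

theorem exists_basis_of_isNullFrame {β : E4 →L[ℝ] E4 →L[ℝ] ℝ} {b : Fin 4 → E4}
    (hb : IsNullFrame β b) : ∃ c : Module.Basis (Fin 4) ℝ E4, c 0 = b 1 ∧ c 1 = b 2 := by
  have hspan : ⊤ ≤ Submodule.span ℝ (range ![b 1, b 2, b 0, b 3]) := by
    rintro x -
    obtain ⟨k, rfl⟩ := frame_span hb.det_ne_zero x
    rw [Fin.sum_univ_four]
    have hm : ∀ j, ![b 1, b 2, b 0, b 3] j ∈ Submodule.span ℝ (range ![b 1, b 2, b 0, b 3]) :=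
      fun j => Submodule.subset_span (mem_range_self j)
    exact add_mem (add_mem (add_mem (Submodule.smul_mem _ _ (hm 2)) (Submodule.smul_mem _ _ (hm 0)))
      (Submodule.smul_mem _ _ (hm 1))) (Submodule.smul_mem _ _ (hm 3))
  refine ⟨basisOfTopLeSpanOfCardEqFinrank _ hspan (by simp), ?_, ?_⟩ <;> simp

variable {M : Type*} [TopologicalSpace M] [ChartedSpace E4 M] [IsManifold 𝓘(ℝ, E4) ∞ M]
  {g : LorentzMetric M} {D : ∀ p : M, Submodule ℝ (TS p)} {U : Set M} {s l a n : ∀ p : M, TS p}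

/-- If `α♯` and `l` are in involution, then there are charts adapted to the plane field they
span. -/
theorem IsAdaptedFrame.exists_isAdaptedChart (h : IsAdaptedFrame g D U s l a n) (hU : IsOpen U)
    (hinv : ∀ p ∈ U, mlieBracket 𝓘(ℝ, E4) a l p ∈ spanField a l p) {p : M} (hp : p ∈ U) :
    ∃ e : OpenPartialHomeomorph M E4,
      IsAdaptedChart (spanField a l) e ∧ e.source ⊆ U ∧ p ∈ e.source ∧ e p = 0 := by
  obtain ⟨e, he, hpe⟩ : ∃ e ∈ IsManifold.maximalAtlas 𝓘(ℝ, E4) ∞ M, p ∈ e.source :=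
    ⟨chartAt E4 p, IsManifold.chart_mem_maximalAtlas p, mem_chart_source E4 p⟩
  obtain ⟨y, hy, rfl⟩ := exists_eq_symm hpe
  have hev := eventually_mem_target_inter hU hy hp
  obtain ⟨c, hcA, hcL⟩ := exists_basis_of_isNullFrame (h.isNullFrame he hy hp)
  obtain ⟨Θ, hconv, h0, hΘ0, hΘU, hΘ, hΘs, hΘD⟩ :=
    exists_flat_homeomorph (A := coordField e a) (L := coordField e l) c hcA hcL
      (hev.mono fun z hz => contDiffAt_coordField he hU h.smooth_a hz.1 hz.2)
      (hev.mono fun z hz => contDiffAt_coordField he hU h.smooth_l hz.1 hz.2)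
      (hev.mono fun z hz => by
        rw [lieBracket_coordField he hU h.smooth_a h.smooth_l hz.1 hz.2]
        exact coordField_mem_span (hinv _ hz.2)) hev
  have htarget : ∀ w ∈ Θ.source, Θ w ∈ e.target := fun w hw => (hΘU (Θ.map_source hw)).1
  have hsource' : ∀ q ∈ (e ≫ₕ Θ.symm).source, q ∈ e.source ∧ e q ∈ Θ.target := fun q hq => by
    simpa using hq
  have htarget' : (e ≫ₕ Θ.symm).target = Θ.source := by
    ext w
    simp only [OpenPartialHomeomorph.trans_target, OpenPartialHomeomorph.symm_target,
      OpenPartialHomeomorph.symm_symm, mem_inter_iff, mem_preimage, and_iff_left_iff_imp]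
    exact htarget w
  have he' : e ≫ₕ Θ.symm ∈ IsManifold.maximalAtlas 𝓘(ℝ, E4) ∞ M := by
    refine OpenPartialHomeomorph.mem_maximalAtlas_of_contMDiffOn _ ?_ ?_
    · exact hΘs.contMDiffOn.comp ((contMDiffOn_of_mem_maximalAtlas he).mono
        fun q hq => (hsource' q hq).1) fun q hq => (hsource' q hq).2
    · rw [htarget']
      exact (contMDiffOn_symm_of_mem_maximalAtlas he).comp hΘ.contMDiffOn htarget
  refine ⟨e ≫ₕ Θ.symm, ⟨he', ?_, ?_⟩, ?_, ?_, ?_⟩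
  · intro q hq v
    obtain ⟨w, hw, rfl⟩ := exists_eq_symm hq
    have hwΘ : w ∈ Θ.source := htarget' ▸ hw
    refine mem_span_pair_iff_of_ker_le (V := E4) finrank_euclideanSpace_fin
      (dCoord (e ≫ₕ Θ.symm) 2 ((e ≫ₕ Θ.symm).symm w) : E4 →L[ℝ] ℝ).toLinearMap
      (dCoord (e ≫ₕ Θ.symm) 3 ((e ≫ₕ Θ.symm).symm w) : E4 →L[ℝ] ℝ).toLinearMap ?_ v
    intro v h2 h3
    have hv := chartInvDeriv_chartDeriv he' hw v
    have hfd := fderiv_transition he he' hw (hsource' _ hq).1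
      (chartDeriv (e ≫ₕ Θ.symm) ((e ≫ₕ Θ.symm).symm w) v)
    -- The transition from the new chart to e is Θ, whose derivative carries the slice directions
    -- into the span of the coordinate fields of α♯ and l.
    have hΘe : e ∘ (e ≫ₕ Θ.symm).symm =ᶠ[𝓝 w] Θ := by
      filter_upwards [Θ.open_source.mem_nhds hwΘ] with z hz using e.right_inv (htarget z hz)
    rw [hv, hΘe.fderiv_eq] at hfd
    have hmem := hΘD w hwΘ (chartDeriv (e ≫ₕ Θ.symm) ((e ≫ₕ Θ.symm).symm w) v) h2 h3
    rw [hfd] at hmem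
    obtain ⟨x, z, hxz⟩ := Submodule.mem_span_pair.1 hmem
    refine Submodule.mem_span_pair.2 ⟨x, z, ?_⟩
    have h4 := congrArg (chartInvDeriv e (Θ w)) hxz
    rw [map_add, map_smul, map_smul, chartInvDeriv_coordField he (htarget w hwΘ),
      chartInvDeriv_coordField he (htarget w hwΘ)] at h4
    exact h4.trans (chartInvDeriv_chartDeriv he (htarget w hwΘ) v)
  · intro c d
    rw [htarget']
    -- A slice is the intersection of the convex source of Θ with an affine plane.
    refine Convex.isPreconnected fun x hx z hz r t hr ht hrt => ⟨hconv hx.1 hz.1 hr ht hrt, ?_, ?_⟩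
    · simp only [PiLp.add_apply, PiLp.smul_apply, hx.2.1, hz.2.1, smul_eq_mul]
      rw [← add_mul, hrt, one_mul]
    · simp only [PiLp.add_apply, PiLp.smul_apply, hx.2.2, hz.2.2, smul_eq_mul]
      rw [← add_mul, hrt, one_mul]
  · intro q hq
    have h1 := (hΘU (hsource' q hq).2).2
    rwa [e.left_inv (hsource' q hq).1] at h1
  · rw [OpenPartialHomeomorph.trans_source]
    refine ⟨hpe, ?_⟩
    rw [mem_preimage, e.right_inv hy, OpenPartialHomeomorph.symm_source, ← hΘ0]
    exact Θ.map_source h0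
  · rw [OpenPartialHomeomorph.coe_trans, Function.comp_apply, e.right_inv hy, ← hΘ0]
    exact Θ.left_inv h0

end AdaptedChart

end NullFF

end

/-! ### The theorem -/

theorem mainTheorem6 {M : Type*} [TopologicalSpace M] [ChartedSpace NullFF.E4 M]
    [IsManifold 𝓘(ℝ, NullFF.E4) ∞ M] (g : NullFF.LorentzMetric M)
    (𝓕 : NullFF.Foliation M) (h𝓕 : NullFF.IsNullFieldSheetFoliation g 𝓕)
    (W : Set M) (hW : IsOpen W) (s l a n : ∀ p : M, NullFF.TS p)
    (hframe : NullFF.IsAdaptedFrame g 𝓕.tangent W s l a n)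
    (hinv : ∀ p ∈ W, mlieBracket 𝓘(ℝ, NullFF.E4) a l p ∈ NullFF.spanField a l p) :
    (∀ p ∈ W, ∃ e : OpenPartialHomeomorph M NullFF.E4,
      NullFF.IsAdaptedChart (NullFF.spanField a l) e ∧ e.source ⊆ W ∧ p ∈ e.source ∧ e p = 0) ∧
    ∀ e : OpenPartialHomeomorph M NullFF.E4,
      NullFF.IsAdaptedChart (NullFF.spanField a l) e → e.source ⊆ W →
      (∀ u : ℝ × ℝ → ℝ, ContDiffOn ℝ ∞ u (NullFF.leafSpace e) →
        NullFF.IsNullForceFree g e.source (NullFF.adaptedForm e u) ∧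
        (∀ q ∈ e.source, NullFF.adaptedForm e u q =
          (NullFF.leafFun e u q * NullFF.kappa g e s l q) •
            NullFF.wedge ![NullFF.flat g s q, NullFF.flat g l q]) ∧
        ∀ q ∈ e.source, NullFF.kernelAt (NullFF.adaptedForm e u) q = NullFF.spanField a l q ↔
          NullFF.leafFun e u q ≠ 0) ∧
      ∀ F : NullFF.DiffForm M 2, NullFF.IsNullForceFree g e.source F →
        (∀ q ∈ e.source, NullFF.kernelAt F q = NullFF.spanField a l q) →
        ∃ u : ℝ × ℝ → ℝ, ContDiffOn ℝ ∞ u (NullFF.leafSpace e) ∧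
          (∀ z ∈ NullFF.leafSpace e, u z ≠ 0) ∧
          ∀ q ∈ e.source, F q = NullFF.adaptedForm e u q := by
  refine ⟨fun p hp => hframe.exists_isAdaptedChart hW hinv hp, fun e he heW => ⟨fun u hu => ?_,
    fun F hF hk => he.exists_adaptedForm_eq hF hk⟩⟩
  refine ⟨?_, fun q hq => hframe.adaptedForm_eq he u hq (heW hq),
    fun q hq => he.kernelAt_eq_iff u hq⟩
  have hsm := NullFF.contDiffOn_localForm_adaptedForm he.1 hu
  exact hframe.isNullForceFree hW (fun p hp => h𝓕.exists_bracket_coeff hW hframe hinv hp)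
    e.open_source heW
    (fun e' he' y hy hye => NullFF.contDiffAt_localForm he.1 he' hsm hy hye)
    (fun e' he' y hy hye => NullFF.extDeriv_localForm he.1 he' hsm
      (fun z hz => NullFF.extDeriv_localForm_adaptedForm he.1 hu hz) hy hye)
    (fun q hq => he.subset_kernelAt u hq (Submodule.subset_span (by simp)))
    (fun q hq => he.subset_kernelAt u hq (Submodule.subset_span (by simp)))
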